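/- Let $\mathbb N=\{0,1,2,\dots\}$, fix $n\ge 1$, and let $I=\bigcap_{1\le i<j\le n}(x_i-x_j,\,y_i-y_j)\subset\mathbb C[x_1,y_1,\dots,x_n,y_n]$. Write $I_{<d}$ for the ideal generated by the homogeneous elements of $I$ of degree less than $d$. For $n$ distinct points $P_j=(\alpha_j,\beta_j)\in\mathbb N\times\mathbb N$, listed so that the degrees $s_j=\alpha_j+\beta_j$ satisfy $s_1\le\dots\le s_n$, put $D=\{P_1,\dots,P_n\}$, $d=\sum_j s_j$, $\Delta(D)=\det(x_i^{\alpha_j}y_i^{\beta_j})_{1\le i,j\le n}$, and call $(\sum_j\alpha_j,\sum_j\beta_j)$ the bidegree of $D$. A staircase form of $D$ is an $n\times n$ matrix $S$ (or its determinant) whose $(i,j)$ entry is $0$ if $i\le s_j$ and otherwise is a product $a_{i1}a_{i2}\cdots a_{i,s_j}$ in which each $a_{i\ell}$ is either $x_i-x_\ell$ or $y_i-y_\ell$ (the choice may depend on $i$, $j$ and $\ell$), and such that $\det S\equiv\Delta(D)\pmod{I_{<d}}$; the bidegree of $S$ means that of $D$. Let $\det S\neq 0$ and $\{j: s_j=j-1\}=\{r_1<\dots<r_\ell\}$,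 $r_{\ell+1}=n+1$. The $t$-th block of $S$ is the square submatrix of $S$ with rows and columns $r_t,r_t+1,\dots,r_{t+1}-1$. The partition type of $S$ is the partition whose parts are the positive numbers among the numbers of nonzero entries above the diagonal in the blocks of $S$. The form $S$ is called minimal if $\det S\ne0$ and the $(i,j)$ entry of $S$ is $0$ whenever $j>i+1$. For partitions $\mu,\nu$ of $k$ write $\nu<_P\mu$ if $\nu\neq\mu$ and the parts of $\nu$ can be distributed into groups whose sums are exactly the parts of $\mu$. **Proposition.** Let $k\ge 0$, $n\ge 8k+5$, $d_1,d_2\ge(2k+1)n$, $d=d_1+d_2$, and let $\mu$ be a partition of $k$. Let $J$ be the ideal generated by $I_{<d}$ and the determinants of all minimal staircase forms of bidegree $(d_1,d_2)$ whose partition type $\nu$ (a partition of $k$) satisfies $\nu<_P\mu$. If $S$ and $S'$ are any two minimal staircase forms of bidegree $(d_1,d_2)$ and of partition type $\mu$, then $$\det S'\in(\det S)+J .$$ -/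

import Mathlib

namespace DiagonalIdeal

/-- The coordinate ring `ℂ[x₁, y₁, …, xₙ, yₙ]` of `(ℂ²)ⁿ`. -/
abbrev Poly (n : ℕ) : Type := MvPolynomial (Fin n ⊕ Fin n) ℂ

/-- The coordinate `xᵢ`. -/
noncomputable def x {n : ℕ} (i : Fin n) : Poly n := MvPolynomial.X (Sum.inl i)

/-- The coordinate `yᵢ`. -/
noncomputable def y {n : ℕ} (i : Fin n) : Poly n := MvPolynomial.X (Sum.inr i)

/-- The radical ideal of the diagonal locus: the intersection of the ideals
`(xᵢ - xⱼ, yᵢ - yⱼ)` over all pairs `i < j`. -/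
noncomputable def diagIdeal (n : ℕ) : Ideal (Poly n) :=
  ⨅ (i : Fin n) (j : Fin n) (_ : i < j), Ideal.span {x i - x j, y i - y j}

/-- `I_{<d}`: the ideal generated by the homogeneous elements of degree less than `d`
in the ideal `I` of the diagonal locus. -/
noncomputable def diagIdealLT (n d : ℕ) : Ideal (Poly n) :=
  Ideal.span {f | f ∈ diagIdeal n ∧ ∃ e < d, f.IsHomogeneous e}

/-- The degree `|p| = α + β` of a point `p = (α, β)` of `ℕ × ℕ`. -/
def ptDeg (p : ℕ × ℕ) : ℕ := p.1 + p.2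

/-- The bidegree `(∑ αⱼ, ∑ βⱼ)` of the points `Pⱼ = (αⱼ, βⱼ)`. -/
def bidegree {n : ℕ} (P : Fin n → ℕ × ℕ) : ℕ × ℕ := (∑ j, (P j).1, ∑ j, (P j).2)

/-- The total degree `d = ∑ (αⱼ + βⱼ)` of the points `Pⱼ = (αⱼ, βⱼ)`. -/
def totalDegree {n : ℕ} (P : Fin n → ℕ × ℕ) : ℕ := ∑ j, ptDeg (P j)

/-- The bivariate Vandermonde-type determinant `Δ(D) = det (xᵢ ^ αⱼ * yᵢ ^ βⱼ)`. -/
noncomputable def Delta {n : ℕ} (P : Fin n → ℕ × ℕ) : Poly n :=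
  Matrix.det (Matrix.of fun i j : Fin n => x i ^ (P j).1 * y i ^ (P j).2)

/-- `S` is a staircase form of the set `D` of the `n` distinct points `P₁, …, Pₙ`, listed so that
their degrees `sⱼ` weakly increase: with rows and columns numbered from `1`, the `(i, j)` entry
is `0` if `i ≤ sⱼ`, and otherwise it is a product of `sⱼ` factors, the `l`-th of which is either
`xᵢ - xₗ` or `yᵢ - yₗ` (for `1 ≤ l ≤ sⱼ`); moreover `det S` agrees with `Δ(D)` modulo `I_{<d}`,
where `d` is the degree of `D`. Indices in `Fin n` start at `0`, hence `i < sⱼ` and `l < sⱼ`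
below. -/
structure IsStaircaseForm {n : ℕ} (P : Fin n → ℕ × ℕ) (S : Matrix (Fin n) (Fin n) (Poly n)) :
    Prop where
  injective : Function.Injective P
  monotone : Monotone fun j => ptDeg (P j)
  entries : ∃ a : Fin n → Fin n → Fin n → Poly n,
    (∀ i j l, a i j l = x i - x l ∨ a i j l = y i - y l) ∧
    ∀ i j, S i j = if (i : ℕ) < ptDeg (P j) then 0 else
      ∏ l ∈ Finset.univ.filter (fun l : Fin n => (l : ℕ) < ptDeg (P j)), a i j l
  det_equiv : S.det - Delta P ∈ diagIdealLT n (totalDegree P)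

/-- The positions `r₁ < r₂ < …` at which the diagonal blocks start: those `j` with `sⱼ = j - 1`
when counted from `1`, that is `sⱼ = j` when counted from `0`. -/
def blockStarts {n : ℕ} (P : Fin n → ℕ × ℕ) : Finset (Fin n) :=
  Finset.univ.filter fun j => ptDeg (P j) = (j : ℕ)

/-- The index set of the block starting at `r`: all `i ≥ r` that lie before the next start. -/
def block {n : ℕ} (P : Fin n → ℕ × ℕ) (r : Fin n) : Finset (Fin n) :=
  Finset.univ.filter fun i => r ≤ i ∧ ∀ r' ∈ blockStarts P, r' ≤ i → r' ≤ r

open Classical in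
/-- The number of nonzero entries above the diagonal in the block of `S` starting at `r`. -/
noncomputable def blockCount {n : ℕ} (P : Fin n → ℕ × ℕ) (S : Matrix (Fin n) (Fin n) (Poly n))
    (r : Fin n) : ℕ :=
  ((block P r ×ˢ block P r).filter fun q => q.1 < q.2 ∧ S q.1 q.2 ≠ 0).card

/-- `S` is a (nonzero) minimal staircase form of the points `P`, of partition type `μ`: its
determinant is nonzero, the parts of `μ` are the positive numbers among the numbers of nonzero
entries above the diagonal in the blocks of `S`, and all entries of `S` that are neither on, below,
nor directly above the diagonal vanish. -/
structure IsMinimalStaircaseForm {n k : ℕ} (P : Fin n → ℕ × ℕ)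
    (S : Matrix (Fin n) (Fin n) (Poly n)) (μ : Nat.Partition k) : Prop where
  isStaircaseForm : IsStaircaseForm P S
  det_ne_zero : S.det ≠ 0
  type_eq : ((blockStarts P).val.map (blockCount P S)).filter (fun c => 0 < c) = μ.parts
  minimal : ∀ i j : Fin n, (i : ℕ) + 1 < j → S i j = 0

/-- `μ <_P ν`: the partitions differ, and the parts of `μ` can be distributed into groups whose
sums are the parts of `ν`. No group is empty, as the parts of `ν` are positive. -/
def StrictSubpartition {k : ℕ} (μ ν : Nat.Partition k) : Prop :=
  μ ≠ ν ∧ ∃ G : Multiset (Multiset ℕ), G.join = μ.parts ∧ G.map Multiset.sum = ν.parts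

/-- The ideal generated by the (determinants of the) minimal staircase forms of bidegree
`(d₁, d₂)` whose partition type is strictly below `μ` in the subpartition order. -/
noncomputable def lowerIdeal (n d₁ d₂ : ℕ) {k : ℕ} (μ : Nat.Partition k) : Ideal (Poly n) :=
  Ideal.span {g | ∃ (ν : Nat.Partition k) (Q : Fin n → ℕ × ℕ)
    (T : Matrix (Fin n) (Fin n) (Poly n)),
    StrictSubpartition ν μ ∧ bidegree Q = (d₁, d₂) ∧ IsMinimalStaircaseForm Q T ν ∧ g = T.det}

end DiagonalIdeal

/-!
Modulo `I_{<d}`, a column of monomials `x i ^ α * y i ^ β` may be replaced by a column of products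
of `α` factors `x i - c` and `β` factors `y i - c`, the linear forms `c` not depending on the row
`i`: expanding such a product changes the determinant by multiples of determinants of smaller
degree that lie in `I` (`det_sub_Delta_mem`). Hence `Δ(D)` may be computed from a staircase matrix.
If all points from the `r`-th on have degree at least `r`, and all points from the `s`-th on have
degree at least `s`, then this matrix is block triangular, and multiplying its determinant by the
power sum `∑ x i` over the rows `r ≤ i < s` amounts to adding a factor `x` to each of the columns
`r ≤ j < s` in turn. The product has degree `d`, the determinant smaller degree, so the sum of the
resulting `Δ` vanishes modulo `I_{<d}` (`sum_Delta_update_mem`, likewise for `y`).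

The points of a minimal staircase form have degrees `j` or `j - 1` in position `j`, counted from
`0`, and so split into blocks, a block of length `m` at `r` having degrees
`r, r, r + 1, …, r + m - 1` (`HasShape`); the positive lengths form the partition type. The theorem
follows from the fact that modulo `J` every such `Δ(D)` is, up to sign, the multiple of one fixed
class `E` by the *slope* of `D`: the product over the blocks of positive length of the difference of
the `x`-exponents of the first two points. The slope of distinct points is nonzero, since these two
points have equal degree (`slope_ne_zero`).

The proof of that fact is formal, from the properties collected in `IsStaircaseSymbol`.

* The relations show that a run of single points, that is of blocks of length `0`, matters only
  through its sum (`IsStaircaseSymbol.singles`).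
* They also allow a block to be pushed past a single point: the determinant becomes the difference
  of two determinants in which the block has one of its first two points enlarged by a factor of the
  single point. The remaining terms split the block in two, and so belong to a type strictly below
  `μ` (`IsStaircaseSymbol.push`).
* Pushing a block of length `m` past `m` single points, and counting the factors `x` in two ways,
  one finds that the determinant, as an antisymmetric function of the exponents of the first two
  points, is a multiple of their difference, and does not depend on the other points of the block
  (`IsStaircaseSymbol.exists_block_linear`). The bounds on `d₁` and `d₂` ensure that there are
  enough factors of either kind. With enough single points in front, the blocks are treated one by
  one (`IsStaircaseSymbol.exists_isLinearOn`), and pushes give every other distribution of the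
  single points (`IsLinearOn.of_sorted`).
* Two adjacent blocks can be exchanged, up to sign: if every column of the second block is divisible
  by the product of the `x i - x l` over the rows `l` of the first block, this product can be
  removed from the second block and the corresponding one inserted into the first block, without
  changing the determinant up to sign (`Delta_exchange`). So the class `E` is the same, up to sign,
  for all orders of the blocks (`IsLinearOn.perm`).
-/

namespace DiagonalIdeal

/-! ### Shapes and the formal properties of the determinants -/

section

/-- The number of columns covered by consecutive blocks of lengths `l`; a block of length `m`
(that is, with `m` nonzero entries above the diagonal) has `m + 1` columns. -/
def width (l : List ℕ) : ℕ := (l.map (· + 1)).sum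

/-- The points `P r, P (r + 1), …` form consecutive blocks whose lengths are the entries of `l`:
a block of length `m` starting at `s` has points of degrees `s, s, s + 1, …, s + m - 1`. Columns
are numbered from `0`, and a block of length `0` is a single point of degree `s`. -/
def HasShape (P : ℕ → ℕ × ℕ) : ℕ → List ℕ → Prop
  | _, [] => True
  | r, m :: l => ptDeg (P r) = r ∧ (∀ i, 1 ≤ i → i ≤ m → ptDeg (P (r + i)) = r + i - 1) ∧
      HasShape P (r + m + 1) l

/-- The product, over the blocks of positive length, of the difference of the `x`-exponents of the
first two points of the block. These two points have the same degree. -/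
def slope (P : ℕ → ℕ × ℕ) : ℕ → List ℕ → ℤ
  | _, [] => 1
  | r, m :: l => (if m = 0 then 1 else ((P r).1 : ℤ) - (P (r + 1)).1) * slope P (r + m + 1) l

/-- The multiset of the positive block lengths. -/
def posParts (l : List ℕ) : Multiset ℕ := ((l : Multiset ℕ)).filter (0 < ·)

@[simp] lemma width_nil : width [] = 0 := rfl

@[simp] lemma width_cons (m : ℕ) (l : List ℕ) : width (m :: l) = m + 1 + width l := by
  simp [width]

@[simp] lemma width_append (l l' : List ℕ) : width (l ++ l') = width l + width l' := by
  simp [width]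

@[simp] lemma width_replicate (L : ℕ) : width (List.replicate L 0) = L := by
  simp [width]

@[simp] lemma posParts_append (l l' : List ℕ) :
    posParts (l ++ l') = posParts l + posParts l' := by
  simp only [posParts, ← Multiset.coe_add, Multiset.filter_add]

@[simp] lemma posParts_cons_zero (l : List ℕ) : posParts (0 :: l) = posParts l := by
  simp [posParts]

lemma posParts_cons_pos {m : ℕ} (hm : 0 < m) (l : List ℕ) :
    posParts (m :: l) = m ::ₘ posParts l := by
  simp [posParts, hm]

@[simp] lemma posParts_replicate (L : ℕ) : posParts (List.replicate L 0) = 0 := by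
  simp [posParts]

variable {P Q : ℕ → ℕ × ℕ}

lemma HasShape.congr {r : ℕ} {l : List ℕ} (h : HasShape P r l)
    (hPQ : ∀ j, r ≤ j → j < r + width l → Q j = P j) : HasShape Q r l := by
  induction l generalizing r with
  | nil => trivial
  | cons m l ih =>
    obtain ⟨h0, h1, h2⟩ := h
    simp only [width_cons] at hPQ
    refine ⟨?_, ?_, ih h2 fun j hj hj' => hPQ j (by omega) (by omega)⟩
    · rw [hPQ r le_rfl (by omega), h0]
    · intro i hi him
      rw [hPQ (r + i) (by omega) (by omega), h1 i hi him]

lemma slope_congr {r : ℕ} {l : List ℕ}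
    (hPQ : ∀ j, r ≤ j → j < r + width l → Q j = P j) : slope Q r l = slope P r l := by
  induction l generalizing r with
  | nil => rfl
  | cons m l ih =>
    simp only [width_cons] at hPQ
    simp only [slope]
    rw [ih fun j hj hj' => hPQ j (by omega) (by omega), hPQ r le_rfl (by omega)]
    by_cases hm : m = 0
    · simp [hm]
    · rw [hPQ (r + 1) (by omega) (by omega)]

lemma hasShape_append {r : ℕ} {l l' : List ℕ} :
    HasShape P r (l ++ l') ↔ HasShape P r l ∧ HasShape P (r + width l) l' := by
  induction l generalizing r with
  | nil => simp [HasShape]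
  | cons m l ih =>
    simp only [List.cons_append, HasShape, ih, width_cons, and_assoc]
    rw [show r + m + 1 + width l = r + (m + 1 + width l) by omega]

lemma slope_append (r : ℕ) (l l' : List ℕ) :
    slope P r (l ++ l') = slope P r l * slope P (r + width l) l' := by
  induction l generalizing r with
  | nil => simp [slope]
  | cons m l ih =>
    simp only [List.cons_append, slope, ih, width_cons, mul_assoc]
    rw [show r + m + 1 + width l = r + (m + 1 + width l) by omega]

lemma hasShape_replicate {r L : ℕ} :
    HasShape P r (List.replicate L 0) ↔ ∀ j, r ≤ j → j < r + L → ptDeg (P j) = j := by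
  induction L generalizing r with
  | zero => simp only [List.replicate_zero, HasShape, true_iff]; intros; omega
  | succ L ih =>
    simp only [List.replicate_succ, HasShape, ih]
    constructor
    · rintro ⟨h0, -, h2⟩ j hj hj'
      rcases hj.eq_or_lt with rfl | h
      · exact h0
      · exact h2 j (by omega) (by omega)
    · intro h
      exact ⟨h r le_rfl (by omega), fun i hi hi' => by omega,
        fun j hj hj' => h j (by omega) (by omega)⟩

@[simp] lemma slope_replicate (r L : ℕ) : slope P r (List.replicate L 0) = 1 := by
  induction L generalizing r with
  | zero => rfl
  | succ L ih => simp [List.replicate_succ, slope, ih]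

/-- Points of a shape starting at `r` have degree at least `r`. -/
lemma HasShape.le_ptDeg {r : ℕ} {l : List ℕ} (h : HasShape P r l) {j : ℕ} (hj : r ≤ j)
    (hj' : j < r + width l) : r ≤ ptDeg (P j) := by
  induction l generalizing r with
  | nil => simp at hj'; omega
  | cons m l ih =>
    obtain ⟨h0, h1, h2⟩ := h
    simp only [width_cons] at hj'
    by_cases h : j < r + m + 1
    · rcases hj.eq_or_lt with rfl | h'
      · exact h0.ge
      · have := h1 (j - r) (by omega) (by omega)
        rw [show r + (j - r) = j by omega] at this
        omega
    · have := ih h2 (by omega) (by omega)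
      omega

/-- Points of a shape lie in degree at most their position. -/
lemma HasShape.ptDeg_le {r : ℕ} {l : List ℕ} (h : HasShape P r l) {j : ℕ} (hj : r ≤ j)
    (hj' : j < r + width l) : ptDeg (P j) ≤ j := by
  induction l generalizing r with
  | nil => simp at hj'; omega
  | cons m l ih =>
    obtain ⟨h0, h1, h2⟩ := h
    simp only [width_cons] at hj'
    by_cases h : j < r + m + 1
    · rcases hj.eq_or_lt with rfl | h'
      · exact h0.le
      · have := h1 (j - r) (by omega) (by omega)
        rw [show r + (j - r) = j by omega] at this
        omega
    · exact ih h2 (by omega) (by omega)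

lemma sum_update_add {n c : ℕ} (hc : c < n) (P : ℕ → ℕ × ℕ) (v : ℕ × ℕ) :
    ∑ j ∈ Finset.range n, Function.update P c v j + P c = ∑ j ∈ Finset.range n, P j + v := by
  have hc' : c ∈ Finset.range n := Finset.mem_range.2 hc
  rw [Finset.sum_update_of_mem hc', ← Finset.add_sum_erase _ P hc',
    Finset.sdiff_singleton_eq_erase]
  abel

lemma ptDeg_add (p q : ℕ × ℕ) : ptDeg (p + q) = ptDeg p + ptDeg q := by
  simp only [ptDeg, Prod.fst_add, Prod.snd_add]; omega

open Finset in
/-- The formal properties of the determinants `Δ(D)` of bidegree `d`, modulo the ideal generated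
by `I_{<d}` and by the minimal staircase forms of partition type strictly below `μ`, from which the
theorem is derived. The points of `D` are `P 0, …, P (n - 1)`. -/
structure IsStaircaseSymbol {V : Type*} [AddCommGroup V] (n : ℕ) (d : ℕ × ℕ) (μ : Multiset ℕ)
    (T : (ℕ → ℕ × ℕ) → V) : Prop where
  /-- Only the first `n` points matter. -/
  congr : ∀ P Q : ℕ → ℕ × ℕ, (∀ j < n, P j = Q j) → T P = T Q
  /-- The symbol is alternating. -/
  swap : ∀ (P : ℕ → ℕ × ℕ) (i : ℕ), i + 1 < n → T (P ∘ Equiv.swap i (i + 1)) = - T P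
  /-- Multiplication by a linear power sum in the variables with indices in `[r, s)` gives zero,
  provided that the columns from `r` on, and those from `s` on, split off. -/
  rel : ∀ (P : ℕ → ℕ × ℕ) (w : ℕ × ℕ) (r s : ℕ), r ≤ s → s ≤ n → ptDeg w = 1 →
    ∑ j ∈ range n, P j + w = d → (∀ j, r ≤ j → j < n → r ≤ ptDeg (P j)) →
    (∀ j, s ≤ j → j < n → s ≤ ptDeg (P j)) →
    ∑ c ∈ Ico r s, T (Function.update P c (P c + w)) = 0
  /-- The symbol vanishes for the types obtained from `μ` by splitting a part. -/
  split : ∀ (P : ℕ → ℕ × ℕ) (A B : List ℕ) (a b : ℕ), 0 < a → 0 < b →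
    HasShape P 0 (A ++ a :: b :: B) → width (A ++ a :: b :: B) = n → ∑ j ∈ range n, P j = d →
    posParts (A ++ (a + b) :: B) = μ → T P = 0
  /-- Adjacent blocks of lengths `m` and `m'` can be exchanged, up to sign, if all points of the
  second block have `x`-exponent at least `m + 1`. -/
  exchange : ∀ (P Q : ℕ → ℕ × ℕ) (A B : List ℕ) (m m' : ℕ),
    HasShape P 0 (A ++ m :: m' :: B) → width (A ++ m :: m' :: B) = n → ∑ j ∈ range n, P j = d →
    ∑ j ∈ range n, Q j = d →
    (∀ j < n, j < width A → Q j = P j) →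
    (∀ i < m' + 1, P (width A + m + 1 + i) = Q (width A + i) + (m + 1, 0)) →
    (∀ i < m + 1, Q (width A + m' + 1 + i) = P (width A + i) + (m' + 1, 0)) →
    (∀ j < n, width A + m + m' + 2 ≤ j → Q j = P j) →
    T Q = T P ∨ T Q = - T P

end

/-! ### Pushing a block past a single point -/

section

open Finset

variable {V : Type*} [AddCommGroup V] {n : ℕ} {d : ℕ × ℕ} {μ : Multiset ℕ}
  {T : (ℕ → ℕ × ℕ) → V}

lemma sum_update_self_add {c : ℕ} (hc : c < n) {Q : ℕ → ℕ × ℕ} {w : ℕ × ℕ}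
    (hQ : ∑ j ∈ range n, Q j + w = d) :
    ∑ j ∈ range n, Function.update Q c (Q c + w) j = d := by
  have := sum_update_add hc Q (Q c + w)
  rw [← hQ]
  refine add_right_cancel (b := Q c) (this.trans ?_)
  abel

/-- Pushing a block of positive length past the single point on its right expresses the symbol as
a difference of two symbols in which the block is one position further to the right. -/
lemma IsStaircaseSymbol.push (h : IsStaircaseSymbol n d μ T) {P : ℕ → ℕ × ℕ} {A B : List ℕ}
    {m r : ℕ} (hr : width A = r) (hm : 0 < m) (hP : HasShape P 0 (A ++ m :: 0 :: B))
    (hn : width (A ++ m :: 0 :: B) = n) (hd : ∑ j ∈ range n, P j = d)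
    (hμ : posParts (A ++ m :: B) = μ) {f w : ℕ × ℕ} (hw : ptDeg w = 1)
    (hf : P (r + m + 1) = f + w) :
    ∃ X Y : ℕ → ℕ × ℕ, T P = T X - T Y ∧
      HasShape X 0 (A ++ 0 :: m :: B) ∧ HasShape Y 0 (A ++ 0 :: m :: B) ∧
      ∑ j ∈ range n, X j = d ∧ ∑ j ∈ range n, Y j = d ∧
      X r = P (r + 1) ∧ X (r + 1) = P r + w ∧ Y r = P r ∧ Y (r + 1) = P (r + 1) + w ∧
      X (r + m + 1) = f ∧ Y (r + m + 1) = f ∧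
      ∀ j, j ≠ r → j ≠ r + 1 → j ≠ r + m + 1 → X j = P j ∧ Y j = P j := by
  have hP' := hP
  rw [hasShape_append, zero_add, hr] at hP
  obtain ⟨hA, h0, h1, h2, -, hB⟩ := hP
  simp only [width_append, width_cons, hr] at hn
  have hdf : ptDeg f = r + m := by
    have := ptDeg_add f w
    rw [← hf, h2, hw] at this; omega
  set Q := Function.update P (r + m + 1) f with hQ
  have hQe : Q (r + m + 1) = f := by simp [Q]
  have hQn : ∀ j, j ≠ r + m + 1 → Q j = P j := fun j hj => by simp [Q, hj]
  have hQs : ∑ j ∈ range n, Q j + w = d := by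
    have := sum_update_add (n := n) (c := r + m + 1) (by omega) P f
    rw [← hQ, hf, hd, ← add_assoc, add_right_comm] at this
    exact add_right_cancel this
  have hrel := h.rel Q w r (r + m + 2) (by omega) (by omega) hw hQs
    (fun j hj hjn => by
      by_cases hj' : j = r + m + 1
      · rw [hj', hQe]; omega
      · rw [hQn j hj']
        rw [hasShape_append, zero_add, hr] at hP'
        exact hP'.2.le_ptDeg hj (by simp only [width_cons]; omega))
    (fun j hj hjn => by
      rw [hQn j (by omega)]
      exact hB.le_ptDeg (by omega) (by omega))
  -- The summands strictly inside the block split it in two.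
  have hmid : ∀ c ∈ Ico (r + 2) (r + m + 1), T (Function.update Q c (Q c + w)) = 0 := by
    intro c hc
    rw [mem_Ico] at hc
    have hcn : Q c = P c := hQn c (by omega)
    refine h.split _ A B (c - r - 1) (m + 1 + r - c) (by omega) (by omega) ?_ ?_ ?_ ?_
    · rw [hasShape_append, zero_add, hr]
      refine ⟨hA.congr fun j _ hj => ?_, ?_, ?_, ?_, ?_, ?_⟩
      · rw [Function.update_of_ne (by omega), hQn j (by omega)]
      · rw [Function.update_of_ne (by omega), hQn r (by omega), h0]
      · intro i hi hi'
        rw [Function.update_of_ne (by omega), hQn _ (by omega), h1 i hi (by omega)]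
      · rw [show r + (c - r - 1) + 1 = c by omega, Function.update_self, ptDeg_add, hw, hcn]
        have := h1 (c - r) (by omega) (by omega)
        rw [show r + (c - r) = c by omega] at this
        omega
      · intro i hi hi'
        rw [Function.update_of_ne (by omega)]
        by_cases hi2 : r + (c - r - 1) + 1 + i = r + m + 1
        · rw [hi2, hQe]; omega
        · rw [hQn _ hi2]
          have := h1 (c - r + i) (by omega) (by omega)
          rw [show r + (c - r + i) = r + (c - r - 1) + 1 + i by omega] at this
          omega
      · rw [show r + (c - r - 1) + 1 + (m + 1 + r - c) + 1 = r + m + 1 + 0 + 1 by omega]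
        refine hB.congr fun j hj hj' => ?_
        rw [Function.update_of_ne (by omega), hQn j (by omega)]
    · simp only [width_append, width_cons, hr]; omega
    · exact sum_update_self_add (by omega) hQs
    · rw [show c - r - 1 + (m + 1 + r - c) = m by omega, hμ]
  have hsum : T (Function.update Q r (Q r + w)) + T (Function.update Q (r + 1) (Q (r + 1) + w)) +
      T P = 0 := by
    rw [← Finset.sum_Ico_consecutive _ (show r ≤ r + 2 by omega) (show r + 2 ≤ r + m + 2 by omega),
      Finset.sum_Ico_succ_top (show r + 2 ≤ r + m + 1 by omega), Finset.sum_eq_zero hmid,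
      Finset.sum_Ico_succ_top (show r ≤ r + 1 by omega), Finset.sum_Ico_succ_top le_rfl,
      Finset.Ico_self, Finset.sum_empty, zero_add, zero_add] at hrel
    convert hrel using 3
    rw [hQe, ← hf, hQ, Function.update_idem, Function.update_eq_self]
  have hQr : Q r = P r := hQn r (by omega)
  have hQr1 : Q (r + 1) = P (r + 1) := hQn _ (by omega)
  set Y := Function.update Q (r + 1) (P (r + 1) + w) with hY
  set X := Function.update Q r (P r + w) ∘ Equiv.swap r (r + 1) with hX
  have hXs := h.swap (Function.update Q r (P r + w)) r (by omega)
  rw [← hX] at hXs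
  have hXr : X r = P (r + 1) := by simp [X, hQr1]
  have hXr1 : X (r + 1) = P r + w := by simp [X]
  have hXo : ∀ j, j ≠ r → j ≠ r + 1 → X j = Q j := fun j hj hj' => by
    simp only [X, Function.comp_apply, Equiv.swap_apply_of_ne_of_ne hj hj']
    rw [Function.update_of_ne hj]
  have hYr : Y r = P r := by simp [Y, hQr]
  have hYr1 : Y (r + 1) = P (r + 1) + w := by simp [Y]
  have hYo : ∀ j, j ≠ r → j ≠ r + 1 → Y j = Q j := fun j hj hj' => by
    simp only [Y]
    rw [Function.update_of_ne hj']
  have h11 := h1 1 le_rfl (by omega)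
  have key : ∀ Z : ℕ → ℕ × ℕ, ptDeg (Z r) = r → ptDeg (Z (r + 1)) = r + 1 →
      (∀ j, j ≠ r → j ≠ r + 1 → Z j = Q j) → HasShape Z 0 (A ++ 0 :: m :: B) := by
    intro Z hZ0 hZ1 hZ
    rw [hasShape_append, zero_add, hr]
    refine ⟨hA.congr fun j _ hj => ?_, hZ0, fun i hi hi' => by omega, hZ1, ?_, ?_⟩
    · rw [hZ j (by omega) (by omega), hQn j (by omega)]
    · intro i hi hi'
      rw [hZ _ (by omega) (by omega)]
      by_cases hi2 : i = m
      · rw [show r + 0 + 1 + i = r + m + 1 by omega, hQe]; omega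
      · rw [hQn _ (by omega)]
        have := h1 (i + 1) (by omega) (by omega)
        rw [show r + (i + 1) = r + 0 + 1 + i by omega] at this
        omega
    · rw [show r + 0 + 1 + m + 1 = r + m + 1 + 0 + 1 by omega]
      refine hB.congr fun j hj hj' => ?_
      rw [hZ j (by omega) (by omega), hQn j (by omega)]
  refine ⟨X, Y, ?_, ?_, ?_, ?_, ?_, hXr, hXr1, hYr, hYr1, ?_, ?_, ?_⟩
  · rw [hQr, hQr1] at hsum
    rw [hXs, ← sub_eq_zero, ← hsum]; abel
  · refine key X ?_ ?_ hXo
    · rw [hXr, h11]; omega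
    · rw [hXr1, ptDeg_add, hw, h0]
  · refine key Y ?_ ?_ hYo
    · rw [hYr, h0]
    · rw [hYr1, ptDeg_add, hw, h11]; omega
  · rw [← sum_update_self_add (c := r) (by omega) hQs, hQr]
    refine Finset.sum_equiv (Equiv.swap r (r + 1)) ?_ (fun j _ => rfl)
    intro j
    simp only [mem_range, Equiv.swap_apply_def]
    split_ifs <;> omega
  · rw [hY, ← hQr1]
    exact sum_update_self_add (by omega) hQs
  · rw [hXo _ (by omega) (by omega), hQe]
  · rw [hYo _ (by omega) (by omega), hQe]
  · intro j hj hj' hj2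
    rw [hXo j hj hj', hYo j hj hj', hQn j hj2]
    exact ⟨rfl, rfl⟩

end

/-! ### Runs of single points -/

section

open Finset

variable {V : Type*} [AddCommGroup V] {n : ℕ} {d : ℕ × ℕ} {μ : Multiset ℕ}
  {T : (ℕ → ℕ × ℕ) → V}

lemma ptDeg_sum (s : Finset ℕ) (P : ℕ → ℕ × ℕ) :
    ptDeg (∑ j ∈ s, P j) = ∑ j ∈ s, ptDeg (P j) := by
  simp only [ptDeg, Prod.fst_sum, Prod.snd_sum, Finset.sum_add_distrib]

/-- Points of prescribed degrees can be chosen with any prescribed bidegree of the right size. -/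
lemma exists_points (F : Finset ℕ) (s : ℕ → ℕ) (X : ℕ × ℕ) (hX : ptDeg X = ∑ j ∈ F, s j) :
    ∃ p : ℕ → ℕ × ℕ, (∀ j ∈ F, ptDeg (p j) = s j) ∧ ∑ j ∈ F, p j = X := by
  induction F using Finset.induction_on generalizing X with
  | empty =>
    refine ⟨fun _ => 0, by simp, ?_⟩
    simp only [sum_empty, ptDeg] at hX ⊢
    ext <;> simp <;> omega
  | insert a F ha ih =>
    rw [sum_insert ha] at hX
    obtain ⟨q, hq1, hq2⟩ : ∃ q : ℕ × ℕ, ptDeg q = s a ∧ ∃ X', X = q + X' := by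
      simp only [ptDeg] at hX ⊢
      rcases le_total (s a) X.1 with h | h
      · exact ⟨(s a, 0), by simp, (X.1 - s a, X.2), by ext <;> simp; omega⟩
      · exact ⟨(X.1, s a - X.1), by simp; omega, (0, X.2 - (s a - X.1)), by
          ext <;> simp; omega⟩
    obtain ⟨X', rfl⟩ := hq2
    rw [ptDeg_add] at hX
    obtain ⟨p, hp1, hp2⟩ := ih X' (by omega)
    refine ⟨Function.update p a q, ?_, ?_⟩
    · intro j hj
      by_cases hja : j = a
      · rw [hja, Function.update_self, hq1]
      · rw [Function.update_of_ne hja]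
        exact hp1 j (Finset.mem_of_mem_insert_of_ne hj hja)
    · rw [sum_insert ha, Function.update_self, ← hp2]
      congr 1
      refine sum_congr rfl fun j hj => Function.update_of_ne ?_ _ _
      rintro rfl; exact ha hj

lemma sum_range_add_sum_swap {M : Type*} [AddCommMonoid M] {s : Finset ℕ} (hs : s ⊆ range n)
    {P Q : ℕ → M} (h : ∀ j < n, j ∉ s → P j = Q j) :
    ∑ j ∈ range n, P j + ∑ j ∈ s, Q j = ∑ j ∈ range n, Q j + ∑ j ∈ s, P j := by
  rw [← sum_sdiff hs, ← sum_sdiff (f := Q) hs, sum_congr rfl fun j hj => ?_]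
  · abel
  · rw [mem_sdiff, mem_range] at hj
    exact h j hj.1 hj.2

lemma HasShape.of_singles {P Q : ℕ → ℕ × ℕ} {A B : List ℕ} {L u : ℕ} (hu : width A = u)
    (hP : HasShape P 0 (A ++ List.replicate L 0 ++ B))
    (hPQ : ∀ j < u + L + width B, j < u ∨ u + L ≤ j → Q j = P j)
    (hQ : ∀ j, u ≤ j → j < u + L → ptDeg (Q j) = j) :
    HasShape Q 0 (A ++ List.replicate L 0 ++ B) := by
  rw [hasShape_append, hasShape_append, zero_add, zero_add, width_append, width_replicate, hu,
    hasShape_replicate] at hP ⊢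
  exact ⟨⟨hP.1.1.congr fun j _ hj => hPQ j (by omega) (by omega), hQ⟩,
    hP.2.congr fun j hj hj' => hPQ j (by omega) (by omega)⟩

/-- For two adjacent single points, a factor of the second can be moved to the first when the
points trade places. -/
lemma IsStaircaseSymbol.trade_swap (h : IsStaircaseSymbol n d μ T) {P : ℕ → ℕ × ℕ}
    {A B : List ℕ} {c : ℕ} (hc : width A = c) (hP : HasShape P 0 (A ++ 0 :: 0 :: B))
    (hn : width (A ++ 0 :: 0 :: B) = n) (hd : ∑ j ∈ range n, P j = d)
    {f w : ℕ × ℕ} (hw : ptDeg w = 1) (hf : P (c + 1) = f + w) :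
    T P = T (Function.update (Function.update P c f) (c + 1) (P c + w)) := by
  rw [hasShape_append, zero_add, hc] at hP
  obtain ⟨-, h0, -, h1, -, hB⟩ := hP
  simp only [width_append, width_cons, hc] at hn
  have hdf : ptDeg f = c := by
    have := ptDeg_add f w
    rw [← hf, hw] at this
    have h1' : ptDeg (P (c + 1)) = c + 1 := h1
    omega
  set Q := Function.update P (c + 1) f with hQ
  have hQe : Q (c + 1) = f := by simp [Q]
  have hQn : ∀ j, j ≠ c + 1 → Q j = P j := fun j hj => by simp [Q, hj]
  have hQs : ∑ j ∈ range n, Q j + w = d := by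
    have := sum_update_add (n := n) (c := c + 1) (by omega) P f
    rw [← hQ, hf, hd, ← add_assoc, add_right_comm] at this
    exact add_right_cancel this
  have hge : ∀ j, c + 2 ≤ j → j < n → c + 2 ≤ ptDeg (Q j) := fun j hj hjn => by
    rw [hQn j (by omega)]
    exact hB.le_ptDeg (by omega) (by omega)
  have hrel := h.rel Q w c (c + 2) (by omega) (by omega) hw hQs
    (fun j hj hjn => by
      by_cases hj' : j = c + 1
      · rw [hj', hQe]; omega
      · by_cases hj2 : j = c
        · rw [hj2, hQn c (by omega)]; omega
        · have := hge j (by omega) hjn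
          omega) hge
  have e : Function.update (Function.update P c f) (c + 1) (P c + w) =
      Function.update Q c (P c + w) ∘ Equiv.swap c (c + 1) := by
    funext j
    by_cases h1 : j = c
    · simp [h1, Q]
    · by_cases h2 : j = c + 1
      · simp [h2, Q]
      · simp [Equiv.swap_apply_of_ne_of_ne h1 h2, h1, h2, Q]
  rw [e, h.swap _ _ (by omega)]
  rw [Finset.sum_Ico_succ_top (by omega), Finset.sum_Ico_succ_top (by omega), Finset.Ico_self,
    Finset.sum_empty, zero_add, hQe, ← hf, hQn c (by omega)] at hrel
  rw [← eq_neg_iff_add_eq_zero.2 ((add_comm _ _).trans hrel), hQ, Function.update_idem,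
    Function.update_eq_self]

/-- Two adjacent single points may exchange a factor `x` of one for a factor `y` of the other. -/
lemma IsStaircaseSymbol.trade (h : IsStaircaseSymbol n d μ T) {P R : ℕ → ℕ × ℕ}
    {A B : List ℕ} {c : ℕ} (hc : width A = c) (hP : HasShape P 0 (A ++ 0 :: 0 :: B))
    (hn : width (A ++ 0 :: 0 :: B) = n) (hd : ∑ j ∈ range n, P j = d)
    (h0 : R c + (0, 1) = P c + (1, 0)) (h1 : R (c + 1) + (1, 0) = P (c + 1) + (0, 1))
    (hR : ∀ j, j ≠ c → j ≠ c + 1 → R j = P j) : T P = T R := by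
  obtain ⟨f, hf⟩ : ∃ f, P (c + 1) = f + (1, 0) := by
    refine ⟨((P (c + 1)).1 - 1, (P (c + 1)).2), ?_⟩
    rw [Prod.ext_iff] at h1 ⊢
    simp at h1 ⊢
    omega
  have hfR : R (c + 1) = f + (0, 1) := by
    rw [hf, add_right_comm] at h1
    exact add_right_cancel h1
  rw [h.trade_swap hc hP hn hd (by simp [ptDeg]) hf]
  set P1 := Function.update (Function.update P c f) (c + 1) (P c + (1, 0)) with hP1
  have e0 : P1 c = f := by simp [P1]
  have e1 : P1 (c + 1) = R c + (0, 1) := by simp [P1, h0]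
  have en : ∀ j, j ≠ c → j ≠ c + 1 → P1 j = P j := fun j h1 h2 => by simp [P1, h1, h2]
  simp only [width_append, width_cons, hc] at hn
  have hs : ∑ j ∈ range n, P1 j = d := by
    have h2 := sum_range_add_sum_swap (s := {c, c + 1}) (n := n) (P := P) (Q := P1) (by
      intro j hj; simp at hj ⊢; omega) (fun j _ hj => by
        simp at hj; exact (en j hj.1 hj.2).symm)
    rw [sum_pair (by omega), sum_pair (by omega), e0, e1, h0, hd, hf] at h2
    refine (add_right_cancel (b := f + (P c + (1, 0))) (h2.trans ?_)).symm
    abel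
  have hP' := hP
  rw [hasShape_append, zero_add, hc] at hP
  obtain ⟨hA, g0, -, g1, -, hB⟩ := hP
  have hsh : HasShape P1 0 (A ++ 0 :: 0 :: B) := by
    rw [hasShape_append, zero_add, hc]
    refine ⟨hA.congr fun j _ hj => en j (by omega) (by omega), ?_, fun i _ _ => by omega, ?_,
      fun i _ _ => by omega, hB.congr fun j hj _ => en j (by omega) (by omega)⟩
    · rw [e0]
      have := ptDeg_add f (1, 0)
      rw [← hf, show ptDeg (P (c + 1)) = c + 1 from g1] at this
      simp [ptDeg] at this ⊢; omega
    · change ptDeg (P1 (c + 1)) = c + 1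
      rw [e1, h0, ptDeg_add, g0]
      simp [ptDeg]
  rw [h.trade_swap hc hsh (by simp [hc]; omega) hs (by simp [ptDeg]) e1]
  congr 1
  funext j
  by_cases h1 : j = c
  · simp [h1]
  · by_cases h2 : j = c + 1
    · simp [h2, e0, hfR]
    · simp [h1, h2, en j h1 h2, hR j h1 h2]

/-- The symbol depends on a run of single points only through their sum. -/
lemma IsStaircaseSymbol.singles (h : IsStaircaseSymbol n d μ T) {A : List ℕ} {u : ℕ}
    (hu : width A = u) {L : ℕ} {B : List ℕ} {P Q : ℕ → ℕ × ℕ}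
    (hP : HasShape P 0 (A ++ List.replicate L 0 ++ B))
    (hQ : HasShape Q 0 (A ++ List.replicate L 0 ++ B))
    (hn : width (A ++ List.replicate L 0 ++ B) = n)
    (hPQ : ∀ j < n, j < u ∨ u + L ≤ j → P j = Q j)
    (hPd : ∑ j ∈ range n, P j = d) (hQd : ∑ j ∈ range n, Q j = d) : T P = T Q := by
  induction L generalizing B P Q with
  | zero => exact h.congr P Q fun j hj => hPQ j hj (by omega)
  | succ L ih =>
    have hlist : A ++ List.replicate (L + 1) 0 ++ B = A ++ List.replicate L 0 ++ (0 :: B) := by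
      simp [List.replicate_succ', List.append_assoc]
    rw [hlist] at hn hP hQ
    simp only [width_append, width_replicate, width_cons, hu] at hn
    have hdeg : ∀ {Z : ℕ → ℕ × ℕ}, HasShape Z 0 (A ++ List.replicate L 0 ++ (0 :: B)) →
        ∀ j, u ≤ j → j < u + L + 1 → ptDeg (Z j) = j := by
      intro Z hZ
      rw [← hlist, hasShape_append, hasShape_append, zero_add, hu, hasShape_replicate] at hZ
      exact hZ.1.2
    -- It suffices to reduce the discrepancy at the last point of the run.
    have key : ∀ k : ℕ, ∀ {P Q : ℕ → ℕ × ℕ},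
        HasShape P 0 (A ++ List.replicate L 0 ++ (0 :: B)) →
        HasShape Q 0 (A ++ List.replicate L 0 ++ (0 :: B)) →
        (∀ j < n, j < u ∨ u + (L + 1) ≤ j → P j = Q j) →
        ∑ j ∈ range n, P j = d → ∑ j ∈ range n, Q j = d →
        (Q (u + L)).1 = (P (u + L)).1 + k → T P = T Q := by
      intro k
      induction k with
      | zero =>
        intro P Q hP hQ hPQ hPd hQd hk
        refine ih hP hQ (by simp [hu]; omega) (fun j hj hj' => ?_) hPd hQd
        by_cases hjq : j = u + L
        · have h1 := hdeg hP j (by omega) (by omega)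
          have h2 := hdeg hQ j (by omega) (by omega)
          subst hjq
          simp only [ptDeg] at h1 h2
          ext <;> omega
        · exact hPQ j hj (by omega)
      | succ k ihk =>
        intro P Q hP hQ hPQ hPd hQd hk
        have hsum := sum_range_add_sum_swap (s := Ico u (u + L + 1)) (n := n) (P := P) (Q := Q)
          (fun j hj => by simp at hj ⊢; omega) (fun j hj hj' => hPQ j hj (by simp at hj'; omega))
        rw [hPd, hQd, add_left_cancel_iff, Finset.sum_Ico_succ_top (by omega),
          Finset.sum_Ico_succ_top (by omega)] at hsum
        set X := ∑ j ∈ Ico u (u + L), P j with hX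
        have hX1 : 1 ≤ X.1 := by
          have := congrArg Prod.fst hsum
          simp only [Prod.fst_add] at this
          omega
        obtain ⟨j₀, hj₀, hj₁⟩ : ∃ j ∈ Ico u (u + L), 1 ≤ (P j).1 := by
          by_contra! hcon
          have : X.1 = 0 := by
            rw [hX, Prod.fst_sum]
            exact Finset.sum_eq_zero fun j hj => by have := hcon j hj; omega
          omega
        rw [mem_Ico] at hj₀
        have hj₀d := hdeg hP j₀ hj₀.1 (by omega)
        obtain ⟨L', rfl⟩ : ∃ L', L = L' + 1 := ⟨L - 1, by omega⟩
        set c := u + L' with hcdef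
        have hXdeg : ptDeg X = ∑ j ∈ Ico u c, j + c := by
          rw [hX, ptDeg_sum, sum_congr rfl fun j hj => hdeg hP j (by simp at hj; omega)
            (by simp at hj; omega), show u + (L' + 1) = c + 1 by omega,
            Finset.sum_Ico_succ_top (by omega)]
        have hc1 : 1 ≤ c := by simp only [ptDeg] at hj₀d; omega
        -- Rearrange the run, with a factor `x` in its last point but one.
        obtain ⟨z, X', hz, hzc, hz1⟩ : ∃ z X' : ℕ × ℕ, X = X' + z ∧ ptDeg z = c ∧ 1 ≤ z.1 := by
          simp only [ptDeg] at hXdeg ⊢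
          rcases le_total c X.1 with hle | hle
          · exact ⟨(c, 0), (X.1 - c, X.2), by ext <;> simp; omega, by simp, hc1⟩
          · exact ⟨(X.1, c - X.1), (0, X.2 - (c - X.1)), by ext <;> simp; omega,
              by simp; omega, hX1⟩
        obtain ⟨p, hp1, hp2⟩ := exists_points (Ico u c) (fun j => j) X' (by
          have := ptDeg_add X' z
          rw [← hz] at this
          omega)
        set W : ℕ → ℕ × ℕ := fun j => if u ≤ j ∧ j < c then p j else if j = c then z else P j
          with hW
        have hWp : ∀ j, u ≤ j → j < c → W j = p j := fun j h1 h2 => by simp [W, h1, h2]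
        have hWc : W c = z := by simp [W]
        have hWo : ∀ j, j < u ∨ c < j → W j = P j := fun j hj => by
          simp only [W]; rw [if_neg (by omega), if_neg (by omega)]
        have hWsh : HasShape W 0 (A ++ List.replicate (L' + 1) 0 ++ (0 :: B)) := by
          refine hP.of_singles hu (fun j _ hj => hWo j (by omega)) fun j hj hj' => ?_
          by_cases hjc : j < c
          · rw [hWp j hj hjc, hp1 j (by simp; omega)]
          · rw [show j = c by omega, hWc, hzc]
        have hWd : ∑ j ∈ range n, W j = d := by
          have h2 := sum_range_add_sum_swap (s := Ico u (c + 1)) (n := n) (P := P) (Q := W)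
            (fun j hj => by simp at hj ⊢; omega)
            (fun j hj hj' => (hWo j (by simp at hj'; omega)).symm)
          rw [show c + 1 = u + (L' + 1) by omega, ← hX, show u + (L' + 1) = c + 1 by omega,
            Finset.sum_Ico_succ_top (by omega), hWc,
            sum_congr rfl fun j hj => hWp j (by simp at hj; omega) (by simp at hj; omega),
            hp2, ← hz, hPd] at h2
          exact (add_right_cancel h2).symm
        rw [ih hP hWsh (by simp [hu]; omega) (fun j hj hj' => (hWo j (by omega)).symm) hPd hWd]
        -- Move that factor to the last point.
        have hPc1 := hdeg hP (c + 1) (by omega) (by omega)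
        have hQc1 := hdeg hQ (c + 1) (by omega) (by omega)
        have hcL : u + (L' + 1) = c + 1 := by omega
        rw [hcL] at hk
        simp only [ptDeg] at hPc1 hQc1 hzc
        set R : ℕ → ℕ × ℕ := fun j => if j = c then (z.1 - 1, z.2 + 1) else
          if j = c + 1 then ((P (c + 1)).1 + 1, (P (c + 1)).2 - 1) else W j with hR
        have hRc : R c = (z.1 - 1, z.2 + 1) := by simp [R]
        have hRc1 : R (c + 1) = ((P (c + 1)).1 + 1, (P (c + 1)).2 - 1) := by simp [R]
        have hRo : ∀ j, j ≠ c → j ≠ c + 1 → R j = W j := fun j h1 h2 => by simp [R, h1, h2]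
        have hRsh : HasShape R 0 (A ++ List.replicate (L' + 1 + 1) 0 ++ B) := by
          rw [← hlist] at hWsh
          refine hWsh.of_singles hu (fun j _ hj => hRo j (by omega) (by omega))
            fun j hj hj' => ?_
          by_cases hjc : j = c
          · rw [hjc, hRc]; simp only [ptDeg]; omega
          by_cases hjc1 : j = c + 1
          · rw [hjc1, hRc1]; simp only [ptDeg]; omega
          rw [hRo j hjc hjc1, hWp j hj (by omega), hp1 j (by simp; omega)]
        have hRd : ∑ j ∈ range n, R j = d := by
          have h2 := sum_range_add_sum_swap (s := {c, c + 1}) (n := n) (P := W) (Q := R)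
            (fun j hj => by simp at hj ⊢; omega)
            (fun j hj hj' => by simp at hj'; exact (hRo j hj'.1 hj'.2).symm)
          rw [sum_pair (by omega), sum_pair (by omega), hRc, hRc1, hWc, hWo (c + 1) (by omega),
            hWd] at h2
          refine (add_right_cancel (b := z + P (c + 1)) (Eq.trans ?_ h2)).symm
          congr 1
          ext <;> simp <;> omega
        have hlist2 : A ++ List.replicate (L' + 1 + 1) 0 ++ B =
            (A ++ List.replicate L' 0) ++ 0 :: 0 :: B := by
          simp [List.replicate_succ', List.append_assoc]
        have htr : T R = T W := by
          refine h.trade (A := A ++ List.replicate L' 0) (B := B) (c := c) (by simp [hu]; omega)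
            (hlist2 ▸ hRsh) (by simp [hu]; omega) hRd ?_ ?_ fun j h1 h2 => (hRo j h1 h2).symm
          · rw [hWc, hRc]; ext <;> simp; omega
          · rw [hWo (c + 1) (by omega), hRc1]; ext <;> simp; omega
        rw [← htr]
        refine ihk (hlist ▸ hRsh) hQ (fun j hj hj' => ?_) hRd hQd ?_
        · rw [hRo j (by omega) (by omega), hWo j (by omega), hPQ j hj (by omega)]
        · rw [hcL, hRc1, hk]; simp; omega
    rcases le_total (P (u + L)).1 (Q (u + L)).1 with hle | hle
    · exact key _ hP hQ hPQ hPd hQd (Nat.add_sub_of_le hle).symm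
    · exact (key _ hQ hP (fun j hj hj' => (hPQ j hj hj').symm) hQd hPd
        (Nat.add_sub_of_le hle).symm).symm

end

/-! ### Pushing a block past several single points -/

section

open Finset

variable {V : Type*} [AddCommGroup V] {n : ℕ} {d : ℕ × ℕ} {μ : Multiset ℕ}
  {T : (ℕ → ℕ × ℕ) → V}

/-- Pushing a block twice, for two choices of its first point (compensated for by the single points
before the block): the subtracted terms of the two pushes cancel. -/
lemma IsStaircaseSymbol.push_pair (h : IsStaircaseSymbol n d μ T) {P P' : ℕ → ℕ × ℕ}
    {A B : List ℕ} {m u g s : ℕ} (hu : width A = u) (hs : u + g = s) (hm : 0 < m)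
    (hP : HasShape P 0 (A ++ List.replicate g 0 ++ m :: 0 :: B))
    (hP' : HasShape P' 0 (A ++ List.replicate g 0 ++ m :: 0 :: B))
    (hn : width (A ++ List.replicate g 0 ++ m :: 0 :: B) = n)
    (hμ : posParts (A ++ m :: B) = μ)
    (hd : ∑ j ∈ range n, P j = d) (hd' : ∑ j ∈ range n, P' j = d)
    (hPP : ∀ j < n, j < u ∨ s < j → P j = P' j) {f w : ℕ × ℕ} (hw : ptDeg w = 1)
    (hf : P (s + m + 1) = f + w) :
    ∃ R R' : ℕ → ℕ × ℕ, T P - T P' = T R - T R' ∧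
      HasShape R 0 (A ++ List.replicate (g + 1) 0 ++ m :: B) ∧
      HasShape R' 0 (A ++ List.replicate (g + 1) 0 ++ m :: B) ∧
      ∑ j ∈ range n, R j = d ∧ ∑ j ∈ range n, R' j = d ∧
      R (s + 1) = P s + w ∧ R' (s + 1) = P' s + w ∧
      R (s + m + 1) = f ∧ R' (s + m + 1) = f ∧
      ∀ j, j ≠ s → j ≠ s + 1 → j ≠ s + m + 1 → R j = P j ∧ R' j = P' j := by
  have hws : width (A ++ List.replicate g 0) = s := by simp [hu, hs]
  have hμ' : posParts (A ++ List.replicate g 0 ++ m :: B) = μ := by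
    rw [← hμ]; simp
  have hns : s + m + 1 < n := by
    rw [← hn]; simp [hu]; omega
  have hl : A ++ List.replicate g 0 ++ 0 :: m :: B =
      A ++ List.replicate (g + 1) 0 ++ m :: B := by
    simp [List.replicate_succ', List.append_assoc]
  obtain ⟨X, Y, e, hX, hY, hXd, hYd, x0, x1, y0, y1, x2, y2, h3⟩ :=
    h.push hws hm hP hn hd hμ' hw hf
  obtain ⟨X', Y', e', hX', hY', hXd', hYd', x0', x1', y0', y1', x2', y2', h3'⟩ :=
    h.push hws hm hP' hn hd' hμ' hw (by rw [← hPP _ hns (by omega), hf])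
  rw [hl] at hX hY hX' hY'
  have hYY : T Y = T Y' := by
    refine h.singles hu hY hY' ?_ (fun j hj hj' => ?_) hYd hYd'
    · rw [← hl, ← hn]; simp; omega
    · by_cases h1 : j = s + 1
      · rw [h1, y1, y1', hPP _ (by omega) (by omega)]
      · by_cases h2 : j = s + m + 1
        · rw [h2, y2, y2']
        · rw [(h3 j (by omega) h1 h2).2, (h3' j (by omega) h1 h2).2, hPP j hj (by omega)]
  refine ⟨X, X', ?_, hX, hX', hXd, hXd', x1, x1', x2, x2', fun j h1 h2 h4 =>
    ⟨(h3 j h1 h2 h4).1, (h3' j h1 h2 h4).1⟩⟩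
  rw [e, e', hYY]; abel

/-- Pushing a block past `k` single points, for two choices of its first point. All terms but the
leading ones cancel, because of `push_pair`. -/
lemma IsStaircaseSymbol.push_iter (h : IsStaircaseSymbol n d μ T) {A B : List ℕ} {m u : ℕ}
    (hu : width A = u) (hm : 0 < m) (hμ : posParts (A ++ m :: B) = μ) (k : ℕ) :
    ∀ {g s : ℕ} {P P' f w : ℕ → ℕ × ℕ}, k ≤ m → u + g = s →
    HasShape P 0 (A ++ List.replicate g 0 ++ m :: (List.replicate k 0 ++ B)) →
    HasShape P' 0 (A ++ List.replicate g 0 ++ m :: (List.replicate k 0 ++ B)) →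
    width (A ++ List.replicate g 0 ++ m :: (List.replicate k 0 ++ B)) = n →
    ∑ j ∈ range n, P j = d → ∑ j ∈ range n, P' j = d →
    (∀ j < n, j < u ∨ s < j → P j = P' j) → (∀ i < k, ptDeg (w i) = 1) →
    (∀ i < k, P (s + m + 1 + i) = f i + w i) →
    ∃ R R' : ℕ → ℕ × ℕ, T P - T P' = T R - T R' ∧
      HasShape R 0 (A ++ List.replicate (g + k) 0 ++ m :: B) ∧
      HasShape R' 0 (A ++ List.replicate (g + k) 0 ++ m :: B) ∧
      ∑ j ∈ range n, R j = d ∧ ∑ j ∈ range n, R' j = d ∧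
      R (s + k) = P s + ∑ i ∈ range k, w i ∧ R' (s + k) = P' s + ∑ i ∈ range k, w i ∧
      (∀ i < k, R (s + m + 1 + i) = f i ∧ R' (s + m + 1 + i) = f i) ∧
      ∀ j, j < u ∨ s + k < j ∧ j ≤ s + m ∨ s + m + 1 + k ≤ j → R j = P j ∧ R' j = P' j := by
  induction k with
  | zero =>
    intro g s P P' f w hk hs hP hP' hn hd hd' hPP hw hf
    exact ⟨P, P', rfl, by simpa using hP, by simpa using hP', hd, hd', by simp, by simp,
      fun i hi => by omega, fun j _ => ⟨rfl, rfl⟩⟩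
  | succ k ih =>
    intro g s P P' f w hk hs hP hP' hn hd hd' hPP hw hf
    rw [List.replicate_succ, List.cons_append] at hP hP' hn
    have hμ' : posParts (A ++ m :: (List.replicate k 0 ++ B)) = μ := by
      rw [← hμ]; simp [posParts_cons_pos hm]
    obtain ⟨R, R', e, hR, hR', hRd, hRd', r1, r1', r2, r2', h3⟩ :=
      h.push_pair hu hs hm hP hP' hn hμ' hd hd' hPP (hw 0 (by omega))
        (by simpa using hf 0 (by omega))
    have hns : s + m + 1 + k < n := by
      rw [← hn]; simp [hu]; omega
    obtain ⟨Q, Q', e2, hQ, hQ', hQd, hQd', q1, q1', q2, q3⟩ := ih (g := g + 1) (s := s + 1)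
      (P := R) (P' := R') (f := fun i => f (i + 1)) (w := fun i => w (i + 1)) (by omega)
      (by omega) hR hR' (by rw [← hn]; simp; omega) hRd hRd' (fun j hj hj' => by
        by_cases h2 : j = s + m + 1
        · rw [h2, r2, r2']
        · rw [(h3 j (by omega) (by omega) h2).1, (h3 j (by omega) (by omega) h2).2,
            hPP j hj (by omega)]) (fun i hi => hw _ (by omega)) (fun i hi => by
        rw [(h3 _ (by omega) (by omega) (by omega)).1, ← hf _ (by omega)]
        congr 1; omega)
    refine ⟨Q, Q', e.trans e2, ?_, ?_, hQd, hQd', ?_, ?_, ?_, ?_⟩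
    · rwa [show g + (k + 1) = g + 1 + k by omega]
    · rwa [show g + (k + 1) = g + 1 + k by omega]
    · rw [show s + (k + 1) = s + 1 + k by omega, q1, r1, sum_range_succ']; abel
    · rw [show s + (k + 1) = s + 1 + k by omega, q1', r1', sum_range_succ']; abel
    · intro i hi
      rcases i with _ | i
      · rw [add_zero, (q3 _ (by omega)).1, (q3 _ (by omega)).2, r2, r2']
        exact ⟨rfl, rfl⟩
      · rw [show s + m + 1 + (i + 1) = s + 1 + m + 1 + i by omega]
        exact q2 i (by omega)
    · intro j hj
      rw [(q3 j (by omega)).1, (q3 j (by omega)).2]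
      exact h3 j (by omega) (by omega) (by omega)

/-- Pushing a block of length `m` past `m` single points. Every point of the pushed block but the
first is obtained from one of these single points by removing a factor, and the removed factors
all go into its first point. -/
lemma IsStaircaseSymbol.push_all (h : IsStaircaseSymbol n d μ T) {A B : List ℕ} {m u g r p : ℕ}
    (hu : width A = u) (hr : u + g = r) (hp : r + m = p) (hm : 0 < m)
    (hμ : posParts (A ++ m :: B) = μ) {P f w : ℕ → ℕ × ℕ}
    (hP : HasShape P 0 (A ++ List.replicate g 0 ++ m :: (List.replicate m 0 ++ B)))
    (hn : width (A ++ List.replicate g 0 ++ m :: (List.replicate m 0 ++ B)) = n)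
    (hd : ∑ j ∈ range n, P j = d) (hw : ∀ i < m, ptDeg (w i) = 1)
    (hf : ∀ i < m, P (p + 1 + i) = f i + w i) :
    ∃ R R' : ℕ → ℕ × ℕ, T P = T R - T R' ∧
      HasShape R 0 (A ++ List.replicate (g + m) 0 ++ m :: B) ∧
      HasShape R' 0 (A ++ List.replicate (g + m) 0 ++ m :: B) ∧
      ∑ j ∈ range n, R j = d ∧ ∑ j ∈ range n, R' j = d ∧
      R p = P r + ∑ i ∈ range m, w i ∧ R' p = P (r + 1) + ∑ i ∈ range m, w i ∧
      (∀ i < m, R (p + 1 + i) = f i ∧ R' (p + 1 + i) = f i) ∧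
      ∀ j, j < u ∨ p + 1 + m ≤ j → R j = P j ∧ R' j = P j := by
  obtain ⟨k, rfl⟩ : ∃ k, m = k + 1 := ⟨m - 1, by omega⟩
  set m := k + 1
  have hl : List.replicate m 0 ++ B = 0 :: (List.replicate k 0 ++ B) := by
    simp [m, List.replicate_succ]
  rw [hl] at hP hn
  have hws : width (A ++ List.replicate g 0) = r := by simp [hu, hr]
  have hμ' : posParts (A ++ List.replicate g 0 ++ m :: (List.replicate k 0 ++ B)) = μ := by
    rw [← hμ]; simp [posParts_cons_pos hm]
  have hns : p + m < n := by
    rw [← hn]; simp [hu, m]; omega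
  obtain ⟨X, Y, e, hX, hY, hXd, hYd, x0, x1, y0, y1, x2, y2, h3⟩ :=
    h.push hws hm hP hn hd hμ' (hw 0 hm) (by rw [← hf 0 hm]; congr 1; omega)
  have hl2 : A ++ List.replicate g 0 ++ 0 :: m :: (List.replicate k 0 ++ B) =
      A ++ List.replicate (g + 1) 0 ++ m :: (List.replicate k 0 ++ B) := by
    simp [List.replicate_succ', List.append_assoc]
  rw [hl2] at hX hY
  obtain ⟨Q, Q', e2, hQ, hQ', hQd, hQd', q1, q1', q2, q3⟩ := h.push_iter hu hm hμ k
    (s := r + 1) (f := fun i => f (i + 1)) (w := fun i => w (i + 1)) (by omega) (by omega)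
    hX hY (by rw [← hl2, ← hn]; simp; omega) hXd hYd (fun j hj hj' => by
      by_cases h2 : j = r + m + 1
      · rw [h2, x2, y2]
      · rw [(h3 j (by omega) (by omega) h2).1, (h3 j (by omega) (by omega) h2).2])
      (fun i hi => hw _ (by omega)) (fun i hi => by
        rw [(h3 _ (by omega) (by omega) (by omega)).1, ← hf _ (by omega)]
        congr 1; omega)
  refine ⟨Q, Q', e.trans e2, ?_, ?_, hQd, hQd', ?_, ?_, ?_, ?_⟩
  · rwa [show g + m = g + 1 + k by omega]
  · rwa [show g + m = g + 1 + k by omega]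
  · rw [show p = r + 1 + k by omega, q1, x1, sum_range_succ']; abel
  · rw [show p = r + 1 + k by omega, q1', y1, sum_range_succ']; abel
  · intro i hi
    rcases i with _ | i
    · rw [add_zero, (q3 _ (by omega)).1, (q3 _ (by omega)).2, show p + 1 = r + m + 1 by omega,
        x2, y2]
      exact ⟨rfl, rfl⟩
    · rw [show p + 1 + (i + 1) = r + 1 + m + 1 + i by omega]
      exact q2 i (by omega)
  · intro j hj
    rw [(q3 j (by omega)).1, (q3 j (by omega)).2]
    exact h3 j (by omega) (by omega) (by omega)

/-- An antisymmetric function on `{0, …, p}²` whose first differences `δ(a, b)` in the first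
argument satisfy `δ(a, b + 1) = δ(a + 1, b)` is a multiple of `a - b`. -/
lemma exists_eq_sub_smul [Module ℂ V] {p : ℕ} {t : ℕ → ℕ → V}
    (anti : ∀ a b, a ≤ p → b ≤ p → t a b = - t b a)
    (rel : ∀ a b, a + 2 ≤ p → b + 1 ≤ p →
      t (a + 1) (b + 1) - t a (b + 1) = t (a + 2) b - t (a + 1) b) :
    ∃ δ : V, ∀ a b, a ≤ p → b ≤ p → t a b = ((a : ℤ) - b) • δ := by
  have two : ∀ v : V, v + v = 0 → v = 0 := fun v hv => by
    have : (2 : ℂ) • v = 0 := by rw [two_smul, hv]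
    exact (smul_eq_zero.1 this).resolve_left two_ne_zero
  have zero : ∀ a ≤ p, t a a = 0 := fun a ha => two _ (by
    nth_rewrite 1 [anti a a ha ha]; simp)
  obtain ⟨δ, hδ⟩ : ∃ δ : ℕ → ℕ → V, ∀ a b, δ a b = t (a + 1) b - t a b := ⟨_, fun _ _ => rfl⟩
  -- The difference depends only on `a + b`.
  have hsum : ∀ b k a, a + k + 1 ≤ p → b + k ≤ p → δ a (b + k) = δ (a + k) b := by
    intro b k
    induction k with
    | zero => intro a _ _; rfl
    | succ k ih =>
      intro a ha hb
      have h1 := rel a (b + k) (by omega) (by omega)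
      rw [← add_assoc, hδ, h1, show a + (k + 1) = a + 1 + k by omega, ← ih (a + 1) (by omega)
        (by omega), hδ]
  have hstep : ∀ a b, a + 1 ≤ p → b + 1 ≤ p →
      δ a (b + 1) - δ b a = δ a b - δ b (a + 1) := by
    intro a b ha hb
    rw [hδ, hδ, hδ, hδ, anti (b + 1) (a + 1) hb ha, anti b (a + 1) (by omega) ha,
      anti b a (by omega) (by omega), anti (b + 1) a hb (by omega)]
    abel
  have hsymm : ∀ a b, a + 1 ≤ p → b + 1 ≤ p → δ a b = δ b a := by
    intro a b ha hb
    rcases le_total a b with hab | hab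
    · obtain ⟨k, rfl⟩ := Nat.exists_eq_add_of_le hab
      exact hsum a k a (by omega) (by omega)
    · obtain ⟨k, rfl⟩ := Nat.exists_eq_add_of_le hab
      exact (hsum b k b (by omega) (by omega)).symm
  have hsucc : ∀ a b, a + 1 ≤ p → b + 1 ≤ p → δ a (b + 1) = δ a b := by
    intro a b ha hb
    have h1 := hstep a b ha hb
    have h2 : δ b (a + 1) = δ a (b + 1) := by
      rcases le_total a b with hab | hab
      · obtain ⟨k, rfl⟩ := Nat.exists_eq_add_of_le hab
        rw [show a + k + 1 = a + 1 + k by omega, ← hsum (a + 1) k a (by omega) (by omega)]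
      · obtain ⟨k, rfl⟩ := Nat.exists_eq_add_of_le hab
        rw [show b + k + 1 = b + 1 + k by omega, ← hsum (b + 1) k b (by omega) (by omega)]
    rw [← hsymm a b ha hb, h2] at h1
    rw [← sub_eq_zero]
    refine two _ ?_
    nth_rewrite 1 [h1]
    abel
  have hconst : ∀ a b, a + 1 ≤ p → b ≤ p → δ a b = δ 0 0 := by
    have h0 : ∀ b, ∀ a, a + 1 ≤ p → b ≤ p → δ a b = δ a 0 := by
      intro b
      induction b with
      | zero => intros; rfl
      | succ b ih => intro a ha hb; rw [hsucc a b ha hb, ih a ha (by omega)]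
    intro a b ha hb
    rw [h0 b a ha hb, hsymm a 0 ha (by omega), h0 a 0 (by omega) (by omega)]
  have hmul : ∀ b k, b + k ≤ p → t (b + k) b = (k : ℤ) • δ 0 0 := by
    intro b k
    induction k with
    | zero => intro hb; simp [zero b (by omega)]
    | succ k ih =>
      intro hb
      have h1 := hδ (b + k) b
      rw [hconst _ _ (by omega) (by omega), ih (by omega), eq_sub_iff_add_eq] at h1
      rw [← add_assoc, ← h1, Nat.cast_succ, add_smul, one_smul, add_comm]
  refine ⟨δ 0 0, fun a b ha hb => ?_⟩
  rcases le_total a b with hab | hab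
  · obtain ⟨k, rfl⟩ := Nat.exists_eq_add_of_le hab
    rw [anti a _ ha hb, hmul a k hb, ← neg_smul]
    congr 1; push_cast; ring
  · obtain ⟨k, rfl⟩ := Nat.exists_eq_add_of_le hab
    rw [hmul b k ha]
    congr 1; push_cast; ring

end

/-! ### Configurations of a block preceded by single points -/

section

open Finset

variable {V : Type*} [AddCommGroup V] {n : ℕ} {d : ℕ × ℕ} {μ : Multiset ℕ}
  {T : (ℕ → ℕ × ℕ) → V}

/-- Shape, bidegree, and values outside of the columns `u, …, p + m` of a system of points in which
a block of length `m` starts at `p` and is preceded by the single points `u, …, p - 1`. The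
`x`-exponents of the points of the block are prescribed by `y`. -/
structure BlockConfig (n : ℕ) (d : ℕ × ℕ) (A B : List ℕ) (L m u p : ℕ) (P₀ : ℕ → ℕ × ℕ)
    (y : ℕ → ℕ) (P : ℕ → ℕ × ℕ) : Prop where
  shape : HasShape P 0 (A ++ List.replicate L 0 ++ m :: B)
  sum : ∑ j ∈ range n, P j = d
  outside : ∀ j < n, j < u ∨ p + m + 1 ≤ j → P j = P₀ j
  block : ∀ j, p ≤ j → j ≤ p + m → (P j).1 = y j

lemma sum_range_split {M : Type*} [AddCommMonoid M] (f : ℕ → M) {a b c : ℕ} (hab : a ≤ b)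
    (hbc : b ≤ c) (hcn : c ≤ n) :
    ∑ j ∈ range n, f j =
      ∑ j ∈ range a, f j + ∑ j ∈ Ico c n, f j + ∑ j ∈ Ico a b, f j + ∑ j ∈ Ico b c, f j := by
  rw [range_eq_Ico, ← sum_Ico_consecutive f (Nat.zero_le a) (by omega : a ≤ n),
    ← sum_Ico_consecutive f hab (by omega : b ≤ n), ← sum_Ico_consecutive f hbc hcn,
    range_eq_Ico]
  abel

/-- The degrees of the points of a block of positive length that starts at `p`. -/
lemma HasShape.ptDeg_block {P : ℕ → ℕ × ℕ} {p m : ℕ} {B : List ℕ} (h : HasShape P p (m :: B))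
    {j : ℕ} (hj : p ≤ j) (hj' : j ≤ p + m) : ptDeg (P j) = max p (j - 1) := by
  rcases hj.eq_or_lt with rfl | hlt
  · rw [h.1]; omega
  · have := h.2.1 (j - p) (by omega) (by omega)
    rw [show p + (j - p) = j by omega] at this
    omega

lemma hasShape_cons {P : ℕ → ℕ × ℕ} {p m : ℕ} {B : List ℕ}
    (h : ∀ j, p ≤ j → j ≤ p + m → ptDeg (P j) = max p (j - 1))
    (hB : HasShape P (p + m + 1) B) : HasShape P p (m :: B) := by
  refine ⟨?_, fun i hi hi' => ?_, hB⟩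
  · rw [h p le_rfl (by omega)]; omega
  · rw [h (p + i) (by omega) (by omega)]; omega

section

variable {A B : List ℕ} {m u L p : ℕ} {P₀ : ℕ → ℕ × ℕ}

/-- A block configuration is determined by its parameters up to the distribution of the factors
among the single points, which does not affect the symbol. -/
lemma IsStaircaseSymbol.eq_of_blockConfig (h : IsStaircaseSymbol n d μ T) (hu : width A = u)
    (hp : u + L = p) (hn : width (A ++ List.replicate L 0 ++ m :: B) = n) {y : ℕ → ℕ}
    {P Q : ℕ → ℕ × ℕ} (hP : BlockConfig n d A B L m u p P₀ y P)
    (hQ : BlockConfig n d A B L m u p P₀ y Q) : T P = T Q := by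
  refine h.singles hu hP.shape hQ.shape hn (fun j hj hj' => ?_) hP.sum hQ.sum
  by_cases hjo : j < u ∨ p + m + 1 ≤ j
  · rw [hP.outside j hj hjo, hQ.outside j hj hjo]
  · have h1 := hP.block j (by omega) (by omega)
    have h2 := hQ.block j (by omega) (by omega)
    have hPs := hP.shape
    have hQs := hQ.shape
    rw [hasShape_append, zero_add, width_append, width_replicate, hu, hp] at hPs hQs
    have h3 := hPs.2.ptDeg_block (j := j) (by omega) (by omega)
    have h4 := hQs.2.ptDeg_block (j := j) (by omega) (by omega)
    simp only [ptDeg] at h3 h4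
    ext <;> omega

/-- The hypotheses on `d` say that the bidegree leaves enough factors `x` and `y` for the single
points, whatever the block is. -/
lemma exists_blockConfig (hu : width A = u) (hp : u + L = p)
    (hn : width (A ++ List.replicate L 0 ++ m :: B) = n)
    (hA : HasShape P₀ 0 A) (hB : HasShape P₀ (p + m + 1) B)
    (hd₁ : (∑ j ∈ range u, P₀ j + ∑ j ∈ Ico (p + m + 1) n, P₀ j).1 +
      ∑ j ∈ Ico p (p + m + 1), max p (j - 1) ≤ d.1)
    (hd₂ : (∑ j ∈ range u, P₀ j + ∑ j ∈ Ico (p + m + 1) n, P₀ j).2 +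
      ∑ j ∈ Ico p (p + m + 1), max p (j - 1) ≤ d.2)
    (hd : ptDeg d = ptDeg (∑ j ∈ range u, P₀ j + ∑ j ∈ Ico (p + m + 1) n, P₀ j) +
      ∑ j ∈ Ico u p, j + ∑ j ∈ Ico p (p + m + 1), max p (j - 1))
    {y : ℕ → ℕ} (hy : ∀ j, p ≤ j → j ≤ p + m → y j ≤ max p (j - 1)) :
    ∃ P, BlockConfig n d A B L m u p P₀ y P := by
  set Z := ∑ j ∈ range u, P₀ j + ∑ j ∈ Ico (p + m + 1) n, P₀ j with hZ
  set G : ℕ → ℕ × ℕ := fun j => (y j, max p (j - 1) - y j) with hG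
  simp only [width_append, width_replicate, width_cons, hu] at hn
  have hGdeg : ∀ j ∈ Ico p (p + m + 1), ptDeg (G j) = max p (j - 1) := fun j hj => by
    rw [mem_Ico] at hj
    have := hy j hj.1 (by omega)
    simp only [ptDeg, G]; omega
  have hS : ptDeg (∑ j ∈ Ico p (p + m + 1), G j) = ∑ j ∈ Ico p (p + m + 1), max p (j - 1) := by
    rw [ptDeg_sum, sum_congr rfl hGdeg]
  obtain ⟨X, hX⟩ : ∃ X, Z + X + ∑ j ∈ Ico p (p + m + 1), G j = d := by
    simp only [ptDeg] at hS
    refine ⟨(d.1 - Z.1 - (∑ j ∈ Ico p (p + m + 1), G j).1,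
      d.2 - Z.2 - (∑ j ∈ Ico p (p + m + 1), G j).2), ?_⟩
    ext <;> simp only [Prod.fst_add, Prod.snd_add] <;> omega
  obtain ⟨q, hq1, hq2⟩ := exists_points (Ico u p) (fun j => j) X (by
    have := ptDeg_add (Z + X) (∑ j ∈ Ico p (p + m + 1), G j)
    rw [hX, ptDeg_add, hS] at this
    omega)
  set P : ℕ → ℕ × ℕ := fun j => if j < u ∨ p + m + 1 ≤ j then P₀ j else if j < p then q j else G j
    with hPdef
  have e1 : ∀ j, j < u ∨ p + m + 1 ≤ j → P j = P₀ j := fun j hj => by simp only [P]; rw [if_pos hj]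
  have e2 : ∀ j, u ≤ j → j < p → P j = q j := fun j h1 h2 => by
    simp only [P]; rw [if_neg (by omega), if_pos h2]
  have e3 : ∀ j, p ≤ j → j ≤ p + m → P j = G j := fun j h1 h2 => by
    simp only [P]; rw [if_neg (by omega), if_neg (by omega)]
  refine ⟨P, ?_, ?_, fun j _ hj => e1 j hj, fun j h1 h2 => by rw [e3 j h1 h2]⟩
  · rw [hasShape_append, hasShape_append, zero_add, zero_add, width_append, width_replicate, hu,
      hp, hasShape_replicate]
    refine ⟨⟨hA.congr fun j _ hj => e1 j (by omega), fun j h1 h2 => ?_⟩,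
      hasShape_cons (fun j h1 h2 => ?_) (hB.congr fun j hj _ => e1 j (by omega))⟩
    · rw [e2 j h1 (by omega), hq1 j (by simp; omega)]
    · rw [e3 j h1 h2, hGdeg j (by simp; omega)]
  · rw [sum_range_split P (show u ≤ p by omega) (show p ≤ p + m + 1 by omega) (by omega), ← hX,
      ← hq2, hZ]
    congr 1
    · congr 1
      · congr 1
        · exact sum_congr rfl fun j hj => e1 j (by simp at hj; omega)
        · exact sum_congr rfl fun j hj => e1 j (by simp at hj; omega)
      · exact sum_congr rfl fun j hj => e2 j (by simp at hj; omega) (by simp at hj; omega)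
    · exact sum_congr rfl fun j hj => e3 j (by simp at hj; omega) (by simp at hj; omega)

lemma sum_Ico_ite_lt (a m ω : ℕ) (hω : ω ≤ m) :
    ∑ j ∈ Ico a (a + m), (if j < a + ω then 1 else 0) = ω := by
  rw [← sum_Ico_consecutive _ (show a ≤ a + ω by omega) (show a + ω ≤ a + m by omega),
    sum_congr rfl fun j hj => if_pos (mem_Ico.1 hj).2,
    sum_congr (s₁ := Ico (a + ω) (a + m)) rfl fun j hj => if_neg (by rw [mem_Ico] at hj; omega)]
  simp

/-- Points from which the block configurations with block starting at `p` arise by `m` pushes: the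
block starts at `r = p - m`, its first two points have `x`-exponents `a + 1` and `a`, and the
`x`-exponents `q` of the `m` single points following it are prescribed. -/
lemma exists_config_before_push (hu : width A = u) {g r : ℕ} (hr : u + g = r) (hp : r + m = p)
    (hm : 0 < m)
    (hn : width (A ++ List.replicate g 0 ++ m :: (List.replicate m 0 ++ B)) = n)
    (hA : HasShape P₀ 0 A) (hB : HasShape P₀ (p + m + 1) B)
    (hd₁ : (∑ j ∈ range u, P₀ j + ∑ j ∈ Ico (p + m + 1) n, P₀ j).1 +
      ∑ j ∈ Ico p (p + m + 1), max p (j - 1) + p ≤ d.1)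
    (hd₂ : (∑ j ∈ range u, P₀ j + ∑ j ∈ Ico (p + m + 1) n, P₀ j).2 +
      ∑ j ∈ Ico p (p + m + 1), max p (j - 1) + p ≤ d.2)
    (hd : ptDeg d = ptDeg (∑ j ∈ range u, P₀ j + ∑ j ∈ Ico (p + m + 1) n, P₀ j) +
      ∑ j ∈ Ico u p, j + ∑ j ∈ Ico p (p + m + 1), max p (j - 1))
    {a ω : ℕ} {y : ℕ → ℕ} (ha : a + 1 ≤ r) (hω : ω ≤ m)
    (hy : ∀ j, p + 1 ≤ j → j ≤ p + m → y j ≤ j - 1) :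
    ∃ P : ℕ → ℕ × ℕ,
      HasShape P 0 (A ++ List.replicate g 0 ++ m :: (List.replicate m 0 ++ B)) ∧
      ∑ j ∈ range n, P j = d ∧ (∀ j < n, j < u ∨ p + m + 1 ≤ j → P j = P₀ j) ∧
      P r = (a + 1, r - (a + 1)) ∧ P (r + 1) = (a, r - a) ∧
      ∀ j, p + 1 ≤ j → j ≤ p + m → (P j).1 = y j + if j < p + 1 + ω then 1 else 0 := by
  set Z := ∑ j ∈ range u, P₀ j + ∑ j ∈ Ico (p + m + 1) n, P₀ j with hZ
  set G : ℕ → ℕ × ℕ := fun j => (y j + (if j < p + 1 + ω then 1 else 0),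
    j - (y j + (if j < p + 1 + ω then 1 else 0))) with hG
  simp only [width_append, width_replicate, width_cons, hu] at hn
  have hGle : ∀ j ∈ Ico (p + 1) (p + m + 1), y j + (if j < p + 1 + ω then 1 else 0) ≤ j := by
    intro j hj
    rw [mem_Ico] at hj
    have := hy j hj.1 (by omega)
    split_ifs <;> omega
  have hG1 : (∑ j ∈ Ico (p + 1) (p + m + 1), G j).1 =
      ∑ j ∈ Ico (p + 1) (p + m + 1), y j + ω := by
    rw [Prod.fst_sum]
    simp only [G]
    rw [sum_add_distrib, show p + m + 1 = p + 1 + m by omega, sum_Ico_ite_lt _ _ _ hω]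
  have hG2 : ptDeg (∑ j ∈ Ico (p + 1) (p + m + 1), G j) = ∑ j ∈ Ico (p + 1) (p + m + 1), j := by
    rw [ptDeg_sum]
    refine sum_congr rfl fun j hj => ?_
    have := hGle j hj
    simp only [ptDeg, G]; omega
  have hye : ∑ j ∈ Ico (p + 1) (p + m + 1), y j ≤ ∑ j ∈ Ico (p + 1) (p + m + 1), (j - 1) :=
    sum_le_sum fun j hj => by rw [mem_Ico] at hj; exact hy j hj.1 (by omega)
  have hS : ∑ j ∈ Ico p (p + m + 1), max p (j - 1) = p + ∑ j ∈ Ico (p + 1) (p + m + 1), (j - 1) := by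
    rw [sum_eq_sum_Ico_succ_bot (by omega)]
    congr 1
    · omega
    · exact sum_congr rfl fun j hj => by rw [mem_Ico] at hj; omega
  have hS' : ∑ j ∈ Ico (p + 1) (p + m + 1), j = ∑ j ∈ Ico (p + 1) (p + m + 1), (j - 1) + m := by
    have : ∑ j ∈ Ico (p + 1) (p + m + 1), j = ∑ j ∈ Ico (p + 1) (p + m + 1), ((j - 1) + 1) :=
      sum_congr rfl fun j hj => by rw [mem_Ico] at hj; omega
    rw [this, sum_add_distrib]
    simp
  have hup : ∑ j ∈ Ico u p, j = ∑ j ∈ Ico u r, j + r + ∑ j ∈ Ico (r + 2) (p + 1), (j - 1) := by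
    rw [← sum_Ico_consecutive _ (show u ≤ r by omega) (show r ≤ p by omega),
      sum_eq_sum_Ico_succ_bot (show r < p by omega), ← add_assoc]
    congr 1
    rw [show r + 2 = r + 1 + 1 by omega, ← sum_Ico_add' (fun j => j - 1) (r + 1) p 1]
    rfl
  obtain ⟨X, hX⟩ : ∃ X, Z + X + ((a + 1, r - (a + 1)) + (a, r - a)) +
      ∑ j ∈ Ico (p + 1) (p + m + 1), G j = d := by
    simp only [ptDeg] at hG2
    refine ⟨(d.1 - Z.1 - (a + 1 + a) - (∑ j ∈ Ico (p + 1) (p + m + 1), G j).1,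
      d.2 - Z.2 - (r - (a + 1) + (r - a)) - (∑ j ∈ Ico (p + 1) (p + m + 1), G j).2), ?_⟩
    ext <;> simp only [Prod.fst_add, Prod.snd_add] <;> omega
  have hdisj : Disjoint (Ico u r) (Ico (r + 2) (p + 1)) := by
    rw [Finset.disjoint_left]; intro j; simp; omega
  obtain ⟨q, hq1, hq2⟩ := exists_points (Ico u r ∪ Ico (r + 2) (p + 1))
    (fun j => if j < r then j else j - 1) X (by
      rw [sum_union hdisj, sum_congr rfl fun j hj => if_pos (mem_Ico.1 hj).2,
        sum_congr (s₁ := Ico (r + 2) (p + 1)) rfl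
          fun j hj => if_neg (by rw [mem_Ico] at hj; omega)]
      have h1 := congrArg ptDeg hX
      rw [ptDeg_add, ptDeg_add, ptDeg_add, hG2] at h1
      have h2 : ptDeg ((a + 1, r - (a + 1)) + (a, r - a)) = r + r := by
        simp [ptDeg]; omega
      omega)
  set P : ℕ → ℕ × ℕ := fun j => if j < u ∨ p + m + 1 ≤ j then P₀ j else
    if j = r then (a + 1, r - (a + 1)) else if j = r + 1 then (a, r - a) else
    if j ≤ p then q j else G j with hPdef
  have e1 : ∀ j, j < u ∨ p + m + 1 ≤ j → P j = P₀ j := fun j hj => by simp only [P]; rw [if_pos hj]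
  have er : P r = (a + 1, r - (a + 1)) := by simp only [P]; rw [if_neg (by omega), if_pos trivial]
  have er1 : P (r + 1) = (a, r - a) := by
    simp only [P]; rw [if_neg (by omega), if_neg (by omega), if_pos trivial]
  have e2 : ∀ j, u ≤ j → j < r → P j = q j := fun j h1 h2 => by
    simp only [P]
    rw [if_neg (by omega), if_neg (by omega), if_neg (by omega), if_pos (by omega)]
  have e3 : ∀ j, r + 2 ≤ j → j ≤ p → P j = q j := fun j h1 h2 => by
    simp only [P]
    rw [if_neg (by omega), if_neg (by omega), if_neg (by omega), if_pos (by omega)]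
  have e4 : ∀ j, p + 1 ≤ j → j ≤ p + m → P j = G j := fun j h1 h2 => by
    simp only [P]
    rw [if_neg (by omega), if_neg (by omega), if_neg (by omega), if_neg (by omega)]
  refine ⟨P, ?_, ?_, fun j _ hj => e1 j hj, er, er1, fun j h1 h2 => by rw [e4 j h1 h2]⟩
  · rw [hasShape_append, hasShape_append, zero_add, zero_add, width_append, width_replicate, hu,
      hr, hasShape_replicate]
    refine ⟨⟨hA.congr fun j _ hj => e1 j (by omega), fun j h1 h2 => ?_⟩,
      hasShape_cons (fun j h1 h2 => ?_) ?_⟩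
    · rw [e2 j h1 (by omega), hq1 j (by simp; omega), if_pos (by omega)]
    · by_cases hj : j = r
      · rw [hj, er]; simp [ptDeg]; omega
      by_cases hj1 : j = r + 1
      · rw [hj1, er1]; simp [ptDeg]; omega
      rw [e3 j (by omega) (by omega), hq1 j (by simp; omega), if_neg (by omega)]
      omega
    · rw [hasShape_append, hasShape_replicate, width_replicate]
      refine ⟨fun j h1 h2 => ?_, ?_⟩
      · rw [e4 j (by omega) (by omega)]
        have := hGle j (by simp; omega)
        simp only [ptDeg, G]; omega
      · rw [show r + m + 1 + m = p + m + 1 by omega]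
        exact hB.congr fun j hj _ => e1 j (by omega)
  · rw [sum_range_split P (show u ≤ p + 1 by omega) (show p + 1 ≤ p + m + 1 by omega) (by omega),
      ← hX, ← hq2, hZ, sum_union hdisj]
    congr 1
    · rw [add_assoc (∑ j ∈ range u, P₀ j + ∑ j ∈ Ico (p + m + 1) n, P₀ j)]
      congr 1
      · congr 1
        · exact sum_congr rfl fun j hj => e1 j (by simp at hj; omega)
        · exact sum_congr rfl fun j hj => e1 j (by simp at hj; omega)
      · rw [← sum_Ico_consecutive _ (show u ≤ r by omega) (show r ≤ p + 1 by omega),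
          sum_eq_sum_Ico_succ_bot (show r < p + 1 by omega),
          sum_eq_sum_Ico_succ_bot (show r + 1 < p + 1 by omega), er, er1,
          sum_congr rfl fun j hj => e2 j (by simp at hj; omega) (by simp at hj; omega),
          sum_congr (s₁ := Ico (r + 2) (p + 1)) rfl
            fun j hj => e3 j (by simp at hj; omega) (by simp at hj; omega)]
        abel
    · exact sum_congr rfl fun j hj => e4 j (by simp at hj; omega) (by simp at hj; omega)

end

end

/-! ### Linearity in the slope of one block -/

section

open Finset

variable {V : Type*} [AddCommGroup V] {n : ℕ} {d : ℕ × ℕ} {μ : Multiset ℕ}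
  {T : (ℕ → ℕ × ℕ) → V}

section

variable {A B : List ℕ} {m u g r p : ℕ} {P₀ : ℕ → ℕ × ℕ} {t : (ℕ → ℕ) → V}

/-- The difference of the symbols of two block configurations, whose first points differ by a
factor, as the symbol of the configuration before the pushes. -/
lemma IsStaircaseSymbol.eq_sub_of_before_push (h : IsStaircaseSymbol n d μ T) (hu : width A = u)
    (hr : u + g = r) (hp : r + m = p) (hm : 0 < m)
    (hn : width (A ++ List.replicate g 0 ++ m :: (List.replicate m 0 ++ B)) = n)
    (hμ : posParts (A ++ m :: B) = μ)
    (ht : ∀ y P, BlockConfig n d A B (g + m) m u p P₀ y P → T P = t y)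
    {a ω : ℕ} {y : ℕ → ℕ} (hω : ω ≤ m) (hya : y p = a + ω)
    {P : ℕ → ℕ × ℕ}
    (hP : HasShape P 0 (A ++ List.replicate g 0 ++ m :: (List.replicate m 0 ++ B)))
    (hd : ∑ j ∈ range n, P j = d) (hPo : ∀ j < n, j < u ∨ p + m + 1 ≤ j → P j = P₀ j)
    (hPr : (P r).1 = a + 1) (hPr1 : (P (r + 1)).1 = a)
    (hPy : ∀ j, p + 1 ≤ j → j ≤ p + m → (P j).1 = y j + if j < p + 1 + ω then 1 else 0)
    (hy : ∀ j, p + 1 ≤ j → j ≤ p + m → y j ≤ j - 1) :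
    T P = t (Function.update y p (y p + 1)) - t y := by
  have hP' := hP
  rw [hasShape_append, zero_add, width_append, width_replicate, hu, hr] at hP'
  have hPs : ∀ j, p + 1 ≤ j → j ≤ p + m → ptDeg (P j) = j := by
    have := hP'.2.2.2
    rw [hasShape_append, hasShape_replicate] at this
    exact fun j h1 h2 => this.1 j (by omega) (by omega)
  set w : ℕ → ℕ × ℕ := fun i => if i < ω then (1, 0) else (0, 1) with hw
  have hw1 : (∑ i ∈ range m, w i).1 = ω := by
    have := sum_Ico_ite_lt 0 m ω hω
    rw [zero_add, zero_add, ← range_eq_Ico] at this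
    rw [Prod.fst_sum, ← this]
    refine sum_congr rfl fun i _ => ?_
    simp only [w]; split_ifs <;> rfl
  obtain ⟨R, R', e, hR, hR', hRd, hRd', r1, r1', r2, r3⟩ := h.push_all hu hr hp hm hμ
    (f := fun i => (y (p + 1 + i), p + i - y (p + 1 + i))) (w := w) hP hn hd
    (fun i _ => by simp only [w]; split_ifs <;> simp [ptDeg]) (fun i hi => by
      have h1 := hPs (p + 1 + i) (by omega) (by omega)
      have h2 := hPy (p + 1 + i) (by omega) (by omega)
      have h3 := hy (p + 1 + i) (by omega) (by omega)
      simp only [ptDeg] at h1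
      simp only [w]
      by_cases hi : i < ω
      · rw [if_pos (by omega)] at h2
        rw [if_pos hi]
        ext <;> simp <;> omega
      · rw [if_neg (by omega)] at h2
        rw [if_neg hi]
        ext <;> simp <;> omega)
  rw [e]
  congr 1
  · refine ht _ _ ⟨hR, hRd, fun j hj hj' => ?_, fun j h1 h2 => ?_⟩
    · rw [(r3 j (by omega)).1, hPo j hj hj']
    · by_cases hj : j = p
      · rw [hj, r1, Function.update_self, Prod.fst_add, hPr, hw1]; omega
      · obtain ⟨i, rfl⟩ : ∃ i, j = p + 1 + i := ⟨j - (p + 1), by omega⟩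
        rw [Function.update_of_ne hj, (r2 i (by omega)).1]
  · refine ht _ _ ⟨hR', hRd', fun j hj hj' => ?_, fun j h1 h2 => ?_⟩
    · rw [(r3 j (by omega)).2, hPo j hj hj']
    · by_cases hj : j = p
      · rw [hj, r1', Prod.fst_add, hPr1, hw1]; omega
      · obtain ⟨i, rfl⟩ : ∃ i, j = p + 1 + i := ⟨j - (p + 1), by omega⟩
        rw [(r2 i (by omega)).2]

/-- If a block of length `m` is preceded by at least `m` single points and there are enough factors
`x` and `y` to go around, then the symbol depends on the block only through the difference of the
`x`-exponents of its first two points, and it is linear in that difference. -/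
theorem IsStaircaseSymbol.exists_block_linear [Module ℂ V] (h : IsStaircaseSymbol n d μ T)
    (hu : width A = u) (hr : u + g = r) (hr1 : 1 ≤ r) (hp : r + m = p) (hm : 0 < m)
    (hn : width (A ++ List.replicate (g + m) 0 ++ m :: B) = n)
    (hμ : posParts (A ++ m :: B) = μ)
    (hA : HasShape P₀ 0 A) (hB : HasShape P₀ (p + m + 1) B)
    (hd₁ : (∑ j ∈ range u, P₀ j + ∑ j ∈ Ico (p + m + 1) n, P₀ j).1 +
      ∑ j ∈ Ico p (p + m + 1), max p (j - 1) + p ≤ d.1)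
    (hd₂ : (∑ j ∈ range u, P₀ j + ∑ j ∈ Ico (p + m + 1) n, P₀ j).2 +
      ∑ j ∈ Ico p (p + m + 1), max p (j - 1) + p ≤ d.2)
    (hd : ptDeg d = ptDeg (∑ j ∈ range u, P₀ j + ∑ j ∈ Ico (p + m + 1) n, P₀ j) +
      ∑ j ∈ Ico u p, j + ∑ j ∈ Ico p (p + m + 1), max p (j - 1)) :
    ∃ E : V, ∀ P, HasShape P 0 (A ++ List.replicate (g + m) 0 ++ m :: B) →
      ∑ j ∈ range n, P j = d → (∀ j < n, j < u ∨ p + m + 1 ≤ j → P j = P₀ j) →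
      T P = (((P p).1 : ℤ) - (P (p + 1)).1) • E := by
  have hn0 : width (A ++ List.replicate g 0 ++ m :: (List.replicate m 0 ++ B)) = n := by
    rw [← hn]; simp; omega
  have hnn : p + m + 1 ≤ n := by rw [← hn]; simp [hu]; omega
  obtain ⟨t, ht⟩ : ∃ t : (ℕ → ℕ) → V,
      ∀ y P, BlockConfig n d A B (g + m) m u p P₀ y P → T P = t y := by
    classical
    refine ⟨fun y => if hy : ∃ P, BlockConfig n d A B (g + m) m u p P₀ y P
      then T hy.choose else 0, fun y P hP => ?_⟩
    have hy : ∃ P, BlockConfig n d A B (g + m) m u p P₀ y P := ⟨P, hP⟩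
    beta_reduce
    rw [dif_pos hy]
    exact h.eq_of_blockConfig hu (by omega) hn hP hy.choose_spec
  obtain ⟨valid, hvalid⟩ : ∃ valid : (ℕ → ℕ) → Prop, ∀ y, valid y ↔
      ∀ j, p ≤ j → j ≤ p + m → y j ≤ max p (j - 1) := ⟨_, fun _ => Iff.rfl⟩
  have hex : ∀ y, valid y → ∃ P, BlockConfig n d A B (g + m) m u p P₀ y P := fun y hy =>
    exists_blockConfig hu (by omega) hn hA hB (by omega) (by omega) hd ((hvalid y).1 hy)
  have tcongr : ∀ y y', valid y → (∀ j, p ≤ j → j ≤ p + m → y j = y' j) → t y = t y' := by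
    intro y y' hy hyy
    obtain ⟨P, hP⟩ := hex y hy
    rw [← ht y P hP]
    exact ht y' P ⟨hP.shape, hP.sum, hP.outside, fun j h1 h2 => by
      rw [hP.block j h1 h2, hyy j h1 h2]⟩
  obtain ⟨F, hF⟩ : ∃ F : (ℕ → ℕ) → ℕ → ℕ → ℕ → ℕ, ∀ y a b,
      F y a b = Function.update (Function.update y p a) (p + 1) b := ⟨_, fun _ _ _ => rfl⟩
  have Fp : ∀ y a b, F y a b p = a := fun y a b => by simp [hF]
  have Fp1 : ∀ y a b, F y a b (p + 1) = b := fun y a b => by simp [hF]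
  have Fo : ∀ y a b j, j ≠ p → j ≠ p + 1 → F y a b j = y j := fun y a b j h1 h2 => by
    simp [hF, h1, h2]
  have Fvalid : ∀ y a b, valid y → a ≤ p → b ≤ p → valid (F y a b) := by
    intro y a b hy ha hb
    rw [hvalid] at hy ⊢
    intro j h1 h2
    by_cases hj : j = p
    · rw [hj, Fp]; omega
    by_cases hj' : j = p + 1
    · rw [hj', Fp1]; omega
    rw [Fo y a b j hj hj']
    exact hy j h1 h2
  have anti : ∀ y a b, valid y → a ≤ p → b ≤ p → t (F y a b) = - t (F y b a) := by
    intro y a b hy ha hb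
    obtain ⟨P, hP⟩ := hex _ (Fvalid y b a hy hb ha)
    rw [← ht _ P hP, ← h.swap P p (by omega)]
    have hsh := hP.shape
    rw [hasShape_append, hasShape_append, zero_add, zero_add, width_append, width_replicate, hu,
      show u + (g + m) = p by omega] at hsh
    have hso : ∀ j, j < p ∨ p + 1 < j → (P ∘ Equiv.swap p (p + 1)) j = P j := fun j hj => by
      rw [Function.comp_apply, Equiv.swap_apply_of_ne_of_ne (by omega) (by omega)]
    refine (ht _ _ ⟨?_, ?_, fun j hj hj' => ?_, fun j h1 h2 => ?_⟩).symm
    · rw [hasShape_append, hasShape_append, zero_add, zero_add, width_append, width_replicate, hu,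
        show u + (g + m) = p by omega]
      refine ⟨⟨hsh.1.1.congr fun j _ hj => hso j (by omega),
        hsh.1.2.congr fun j hj hj' => hso j (by rw [width_replicate] at hj'; omega)⟩,
        hasShape_cons (fun j h1 h2 => ?_) (hsh.2.2.2.congr fun j hj hj' => hso j (by omega))⟩
      by_cases hj : j = p
      · rw [hj, Function.comp_apply, Equiv.swap_apply_left, hsh.2.ptDeg_block (by omega) (by omega)]
        omega
      by_cases hj' : j = p + 1
      · rw [hj', Function.comp_apply, Equiv.swap_apply_right,
          hsh.2.ptDeg_block (by omega) (by omega)]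
        omega
      rw [hso j (by omega), hsh.2.ptDeg_block h1 h2]
    · rw [← hP.sum]
      refine Finset.sum_equiv (Equiv.swap p (p + 1)) ?_ (fun j _ => rfl)
      intro j
      simp only [mem_range, Equiv.swap_apply_def]
      split_ifs <;> omega
    · rw [hso j (by omega), hP.outside j hj hj']
    · by_cases hj : j = p
      · rw [hj, Function.comp_apply, Equiv.swap_apply_left, hP.block _ (by omega) (by omega),
          Fp, Fp1]
      by_cases hj' : j = p + 1
      · rw [hj', Function.comp_apply, Equiv.swap_apply_right, hP.block _ (by omega) (by omega),
          Fp, Fp1]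
      rw [hso j (by omega), hP.block j h1 h2, Fo _ _ _ j hj hj', Fo _ _ _ j hj hj']
  -- The key relation: both sides are symbols of configurations before the pushes that differ only
  -- in the run of single points after the block.
  have key : ∀ y y' a ω ω', valid y → valid y' → y p = a + ω → y' p = a + ω' → a + 1 ≤ r →
      ω ≤ m → ω' ≤ m →
      ω + ∑ j ∈ Ico (p + 1) (p + m + 1), y j = ω' + ∑ j ∈ Ico (p + 1) (p + m + 1), y' j →
      t (Function.update y p (y p + 1)) - t y = t (Function.update y' p (y' p + 1)) - t y' := by
    intro y y' a ω ω' hy hy' hya hya' har hω hω' hsum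
    have hyv : ∀ j, p + 1 ≤ j → j ≤ p + m → y j ≤ j - 1 := fun j h1 h2 => by
      have := (hvalid y).1 hy j (by omega) h2; omega
    have hyv' : ∀ j, p + 1 ≤ j → j ≤ p + m → y' j ≤ j - 1 := fun j h1 h2 => by
      have := (hvalid y').1 hy' j (by omega) h2; omega
    obtain ⟨P, hP, hPd, hPo, hPr, hPr1, hPy⟩ := exists_config_before_push hu hr hp hm hn0 hA hB
      hd₁ hd₂ hd har hω hyv
    set ε : ℕ → ℕ := fun j => if j < p + 1 + ω' then 1 else 0 with hε
    have hε1 : ∀ j, ε j ≤ 1 := fun j => by simp only [ε]; split_ifs <;> omega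
    set P' : ℕ → ℕ × ℕ := fun j => if p + 1 ≤ j ∧ j ≤ p + m then (y' j + ε j, j - (y' j + ε j))
      else P j with hP'
    have e1 : ∀ j, p + 1 ≤ j → j ≤ p + m → P' j = (y' j + ε j, j - (y' j + ε j)) :=
      fun j h1 h2 => by simp only [P']; rw [if_pos ⟨h1, h2⟩]
    have e2 : ∀ j, j < p + 1 ∨ p + m + 1 ≤ j → P' j = P j :=
      fun j hj => by simp only [P']; rw [if_neg (by omega)]
    have hl : A ++ List.replicate g 0 ++ m :: (List.replicate m 0 ++ B) =
      (A ++ List.replicate g 0 ++ [m]) ++ List.replicate m 0 ++ B := by simp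
    have hw : width (A ++ List.replicate g 0 ++ [m]) = p + 1 := by simp [hu]; omega
    have hnB : p + 1 + m + width B = n := by
      rw [← hn]; simp [hu]; omega
    have hPs : ∀ j, p + 1 ≤ j → j ≤ p + m → ptDeg (P j) = j := by
      have := hP
      rw [hl, hasShape_append, hasShape_append, zero_add, hw, hasShape_replicate] at this
      exact fun j h1 h2 => this.1.2 j h1 (by omega)
    have hPsh : HasShape P' 0
        (A ++ List.replicate g 0 ++ m :: (List.replicate m 0 ++ B)) := by
      rw [hl] at hP ⊢
      refine hP.of_singles hw (fun j _ hj => e2 j (by omega)) fun j h1 h2 => ?_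
      rw [e1 j h1 (by omega)]
      have := hyv' j h1 (by omega)
      have := hε1 j
      simp only [ptDeg]; omega
    have hPs' : ∀ j, p + 1 ≤ j → j ≤ p + m → ptDeg (P' j) = j := by
      have := hPsh
      rw [hl, hasShape_append, hasShape_append, zero_add, hw, hasShape_replicate] at this
      exact fun j h1 h2 => this.1.2 j h1 (by omega)
    have hPPs : ∑ j ∈ Ico (p + 1) (p + m + 1), P' j = ∑ j ∈ Ico (p + 1) (p + m + 1), P j := by
      have h1 : (∑ j ∈ Ico (p + 1) (p + m + 1), P' j).1 =
          (∑ j ∈ Ico (p + 1) (p + m + 1), P j).1 := by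
        rw [Prod.fst_sum, Prod.fst_sum,
          sum_congr rfl fun j hj => hPy j (mem_Ico.1 hj).1 (by rw [mem_Ico] at hj; omega),
          sum_congr rfl fun j hj => congrArg Prod.fst
            (e1 j (mem_Ico.1 hj).1 (by rw [mem_Ico] at hj; omega))]
        simp only [ε]
        rw [sum_add_distrib, sum_add_distrib, show p + m + 1 = p + 1 + m by omega,
          sum_Ico_ite_lt _ _ _ hω, sum_Ico_ite_lt _ _ _ hω', ← show p + m + 1 = p + 1 + m by omega]
        omega
      have h2 : ptDeg (∑ j ∈ Ico (p + 1) (p + m + 1), P' j) =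
          ptDeg (∑ j ∈ Ico (p + 1) (p + m + 1), P j) := by
        rw [ptDeg_sum, ptDeg_sum]
        exact sum_congr rfl fun j hj => by
          rw [mem_Ico] at hj
          rw [hPs j hj.1 (by omega), hPs' j hj.1 (by omega)]
      simp only [ptDeg] at h2
      ext
      · exact h1
      · omega
    have hPd' : ∑ j ∈ range n, P' j = d := by
      have := sum_range_add_sum_swap (s := Ico (p + 1) (p + m + 1)) (n := n) (P := P) (Q := P')
        (fun j hj => by simp at hj ⊢; omega)
        (fun j hj hj' => (e2 j (by simp at hj'; omega)).symm)
      rw [hPPs, hPd] at this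
      exact (add_right_cancel this).symm
    have hTT : T P = T P' := by
      rw [hl] at hP hPsh hn0
      exact h.singles hw hP hPsh hn0 (fun j _ hj => (e2 j (by omega)).symm) hPd hPd'
    rw [← h.eq_sub_of_before_push hu hr hp hm hn0 hμ ht hω hya hP hPd hPo (by rw [hPr])
      (by rw [hPr1]) hPy hyv,
      ← h.eq_sub_of_before_push hu hr hp hm hn0 hμ ht hω' hya' hPsh hPd'
      (fun j hj hj' => by rw [e2 j (by omega), hPo j hj hj']) (by rw [e2 r (by omega), hPr])
      (by rw [e2 (r + 1) (by omega), hPr1]) (fun j h1 h2 => by rw [e1 j h1 h2]) hyv', hTT]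
  have Fupd : ∀ y a b, Function.update (F y a b) p (F y a b p + 1) = F y (a + 1) b := by
    intro y a b
    funext j
    by_cases hj : j = p
    · rw [hj, Function.update_self, Fp, Fp]
    by_cases hj' : j = p + 1
    · rw [hj', Function.update_of_ne (by omega), Fp1, Fp1]
    rw [Function.update_of_ne hj, Fo _ _ _ j hj hj', Fo _ _ _ j hj hj']
  have Fsum : ∀ y a b, ∑ j ∈ Ico (p + 1) (p + m + 1), F y a b j =
      b + ∑ j ∈ Ico (p + 2) (p + m + 1), y j := by
    intro y a b
    rw [sum_eq_sum_Ico_succ_bot (by omega), Fp1]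
    congr 1
    exact sum_congr rfl fun j hj => Fo _ _ _ j (by rw [mem_Ico] at hj; omega)
      (by rw [mem_Ico] at hj; omega)
  have lin : ∀ y, valid y → ∃ δ : V, ∀ a b, a ≤ p → b ≤ p → t (F y a b) = ((a : ℤ) - b) • δ := by
    intro y hy
    refine exists_eq_sub_smul (fun a b ha hb => anti y a b hy ha hb) fun a b ha hb => ?_
    have := key (F y a (b + 1)) (F y (a + 1) b) (a - (a + 1 - r)) (a + 1 - r) (a + 1 - r + 1)
      (Fvalid y _ _ hy (by omega) hb) (Fvalid y _ _ hy (by omega) (by omega))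
      (by rw [Fp]; omega) (by rw [Fp]; omega) (by omega) (by omega) (by omega)
      (by rw [Fsum, Fsum]; omega)
    rwa [Fupd, Fupd] at this
  have hzero : valid fun _ => 0 := (hvalid _).2 fun _ _ _ => Nat.zero_le _
  obtain ⟨E, hE⟩ := lin _ hzero
  -- Lowering the exponents of the last points of the block one by one.
  have all : ∀ N, ∀ y, valid y → ∑ j ∈ Ico (p + 2) (p + m + 1), y j = N →
      ∀ a b, a ≤ p → b ≤ p → t (F y a b) = ((a : ℤ) - b) • E := by
    intro N
    induction N with
    | zero =>
      intro y hy hN a b ha hb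
      rw [← hE a b ha hb]
      refine tcongr _ _ (Fvalid y a b hy ha hb) fun j h1 h2 => ?_
      by_cases hj : j = p
      · rw [hj, Fp, Fp]
      by_cases hj' : j = p + 1
      · rw [hj', Fp1, Fp1]
      rw [Fo _ _ _ j hj hj', Fo _ _ _ j hj hj']
      exact Finset.sum_eq_zero_iff.1 hN j (by simp; omega)
    | succ N ih =>
      intro y hy hN
      obtain ⟨c, hc, hyc⟩ : ∃ c ∈ Ico (p + 2) (p + m + 1), y c ≠ 0 := by
        by_contra! hcon
        rw [Finset.sum_eq_zero hcon] at hN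
        omega
      set y' := Function.update y c (y c - 1) with hy'
      have hyv : valid y' := by
        rw [hvalid] at hy ⊢
        intro j h1 h2
        by_cases hj : j = c
        · have := hy c (by omega) (by omega)
          rw [hj, hy', Function.update_self]; omega
        · rw [hy', Function.update_of_ne hj]; exact hy j h1 h2
      have hys : ∑ j ∈ Ico (p + 2) (p + m + 1), y' j = N := by
        have h1 := Finset.sum_update_of_mem hc y (y c - 1)
        have h2 := Finset.add_sum_erase _ y hc
        rw [Finset.sdiff_singleton_eq_erase] at h1
        rw [hy', h1]; omega
      obtain ⟨δ, hδ⟩ := lin y hy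
      have hk := key (F y 0 0) (F y' 0 1) 0 0 0 (Fvalid y _ _ hy (by omega) (by omega))
        (Fvalid y' _ _ hyv (by omega) (by omega)) (by rw [Fp]) (by rw [Fp]) (by omega) (by omega)
        (by omega) (by rw [Fsum, Fsum, hN, hys]; omega)
      rw [Fupd, Fupd, hδ _ _ (by omega) (by omega), hδ _ _ (by omega) (by omega),
        ih y' hyv hys _ _ (by omega) (by omega), ih y' hyv hys _ _ (by omega) (by omega)] at hk
      have : δ = E := by simpa using hk
      rw [← this]
      exact hδ
  refine ⟨E, fun P hP hPd hPo => ?_⟩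
  have hPs := hP
  rw [hasShape_append, zero_add, width_append, width_replicate, hu,
    show u + (g + m) = p by omega] at hPs
  have hv : valid fun j => (P j).1 := (hvalid _).2 fun j h1 h2 => by
    have := hPs.2.ptDeg_block h1 h2
    simp only [ptDeg] at this; omega
  have h0 := hPs.2.ptDeg_block (j := p) (by omega) (by omega)
  have h1 := hPs.2.ptDeg_block (j := p + 1) (by omega) (by omega)
  simp only [ptDeg] at h0 h1
  rw [← all _ _ hv rfl _ _ (by omega) (by omega)]
  refine ht _ _ ⟨hP, hPd, hPo, fun j _ _ => ?_⟩
  by_cases hj : j = p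
  · rw [hj, Fp]
  by_cases hj' : j = p + 1
  · rw [hj', Fp1]
  rw [Fo _ _ _ j hj hj']

end

end

/-! ### Linearity in the slopes of all blocks -/

section

open Finset

variable {V : Type*} [AddCommGroup V] {n : ℕ} {d : ℕ × ℕ} {μ : Multiset ℕ}
  {T : (ℕ → ℕ × ℕ) → V}

/-- The symbols with blocks `l ++ B` and bidegree `d`, whose points in the blocks `B` agree with
those of `P₀`, are the multiples of `E` by the slopes. -/
def IsLinearOn (n : ℕ) (d : ℕ × ℕ) (T : (ℕ → ℕ × ℕ) → V) (l B : List ℕ) (P₀ : ℕ → ℕ × ℕ) (E : V) :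
    Prop :=
  ∀ P, HasShape P 0 (l ++ B) → ∑ j ∈ range n, P j = d → (∀ j < n, width l ≤ j → P j = P₀ j) →
    T P = slope P 0 l • E

lemma exists_add_of_pos {q : ℕ × ℕ} (hq : 0 < ptDeg q) : ∃ f w, ptDeg w = 1 ∧ q = f + w := by
  simp only [ptDeg] at hq ⊢
  rcases Nat.eq_zero_or_pos q.1 with h | h
  · exact ⟨(q.1, q.2 - 1), (0, 1), rfl, by ext <;> simp; omega⟩
  · exact ⟨(q.1 - 1, q.2), (1, 0), rfl, by ext <;> simp; omega⟩

section

variable {B : List ℕ} {P₀ : ℕ → ℕ × ℕ} {E : V}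

/-- The slope of the original points is the difference of the slopes of the two terms of a push. -/
lemma IsLinearOn.push (h : IsStaircaseSymbol n d μ T) {C D : List ℕ} {m : ℕ} (hm : 0 < m)
    (hn : width (C ++ m :: 0 :: D ++ B) = n) (hμ : posParts (C ++ m :: D ++ B) = μ)
    (hE : IsLinearOn n d T (C ++ 0 :: m :: D) B P₀ E) :
    IsLinearOn n d T (C ++ m :: 0 :: D) B P₀ E := by
  intro P hP hPd hP0
  have hP' := hP
  simp only [List.append_assoc, List.cons_append] at hP hn hμ
  have hlast : ptDeg (P (width C + m + 1)) = width C + m + 1 := by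
    rw [hasShape_append, zero_add] at hP
    exact hP.2.2.2.1
  obtain ⟨f, w, hw, hf⟩ := exists_add_of_pos (q := P (width C + m + 1)) (by omega)
  obtain ⟨X, Y, e, hX, hY, hXd, hYd, x0, x1, y0, y1, x2, y2, h3⟩ := h.push rfl hm hP hn hPd hμ hw hf
  have hsup : ∀ j < n, width (C ++ 0 :: m :: D) ≤ j → X j = P₀ j ∧ Y j = P₀ j := by
    intro j hj hj'
    simp only [width_append, width_cons] at hj'
    rw [(h3 j (by omega) (by omega) (by omega)).1, (h3 j (by omega) (by omega) (by omega)).2]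
    exact ⟨hP0 j hj (by simp; omega), hP0 j hj (by simp; omega)⟩
  rw [e, hE X (by simpa using hX) hXd fun j hj hj' => (hsup j hj hj').1,
    hE Y (by simpa using hY) hYd fun j hj hj' => (hsup j hj hj').2, ← sub_smul]
  congr 1
  have h2 : X (width C + 2) = Y (width C + 2) := by
    by_cases hm1 : m = 1
    · subst hm1
      exact x2.trans y2.symm
    · rw [(h3 _ (by omega) (by omega) (by omega)).1, (h3 _ (by omega) (by omega) (by omega)).2]
  have key : ∀ Z : ℕ → ℕ × ℕ, (∀ j, j ≠ width C → j ≠ width C + 1 → j ≠ width C + m + 1 →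
      Z j = P j) → slope Z 0 (C ++ 0 :: m :: D) = slope P 0 C *
        ((((Z (width C + 1)).1 : ℤ) - (Z (width C + 2)).1) *
          slope P (width C + m + 2) D) := by
    intro Z hZ
    rw [slope_append, zero_add, slope_congr (P := P) (Q := Z) (r := 0)
      fun j _ hj => hZ j (by omega) (by omega) (by omega)]
    simp only [slope, if_pos, one_mul, if_neg hm.ne', add_zero]
    rw [show width C + 1 + m + 1 = width C + m + 2 by omega, slope_congr (P := P) (Q := Z)
      fun j hj _ => hZ j (by omega) (by omega) (by omega)]
  rw [key X fun j a b c => (h3 j a b c).1, key Y fun j a b c => (h3 j a b c).2, slope_append,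
    zero_add]
  simp only [slope, if_pos, one_mul, if_neg hm.ne', add_zero]
  rw [h2, x1, y1, show width C + m + 1 + 1 = width C + m + 2 by omega]
  simp only [Prod.fst_add]
  push_cast
  ring

lemma IsLinearOn.push_replicate (h : IsStaircaseSymbol n d μ T) {D : List ℕ} {m : ℕ} (hm : 0 < m)
    (N : ℕ) : ∀ {C : List ℕ}, width (C ++ m :: (List.replicate N 0 ++ D) ++ B) = n →
    posParts (C ++ m :: D ++ B) = μ →
    IsLinearOn n d T (C ++ List.replicate N 0 ++ m :: D) B P₀ E →
    IsLinearOn n d T (C ++ m :: (List.replicate N 0 ++ D)) B P₀ E := by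
  induction N with
  | zero => intro C hn hμ hE; simpa using hE
  | succ N ih =>
    intro C hn hμ hE
    have hE' : IsLinearOn n d T (C ++ [0] ++ List.replicate N 0 ++ m :: D) B P₀ E := by
      simpa [List.replicate_succ] using hE
    have h1 := ih (C := C ++ [0]) (by rw [← hn]; simp; omega) (by rw [← hμ]; simp) hE'
    have h2 : IsLinearOn n d T (C ++ 0 :: m :: (List.replicate N 0 ++ D)) B P₀ E := by
      simpa using h1
    have h3 := IsLinearOn.push h hm (by rw [← hn]; simp; omega)
      (by rw [← hμ]; simp [posParts_cons_pos hm]) h2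
    simpa [List.replicate_succ] using h3

lemma width_eq_count_add (l : List ℕ) :
    width l = l.count 0 + width (l.filter (0 < ·)) := by
  induction l with
  | nil => rfl
  | cons a l ihl =>
    rcases Nat.eq_zero_or_pos a with rfl | ha
    · simp [ihl]; omega
    · simp only [width_cons, List.count_cons, List.filter_cons, ihl]
      simp [ha, ha.ne']; omega

/-- If the symbols with all single points in front are proportional to the slopes, then so are the
symbols with the single points at any other places between the blocks. -/
lemma IsLinearOn.of_sorted (h : IsStaircaseSymbol n d μ T) (l : List ℕ) :
    ∀ {C : List ℕ}, width (C ++ l ++ B) = n → posParts (C ++ l ++ B) = μ →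
    IsLinearOn n d T (C ++ List.replicate (l.count 0) 0 ++ l.filter (0 < ·)) B P₀ E →
    IsLinearOn n d T (C ++ l) B P₀ E := by
  induction l with
  | nil => intro C _ _ hE; simpa using hE
  | cons m l ih =>
    intro C hn hμ hE
    rcases Nat.eq_zero_or_pos m with rfl | hm
    · have := ih (C := C ++ [0]) (by simpa using hn) (by simpa using hμ)
        (by simpa [List.replicate_succ] using hE)
      simpa using this
    · have hpl : posParts (l.filter (0 < ·)) = posParts l := by
        simp [posParts]
      have h1 : IsLinearOn n d T (C ++ m :: (List.replicate (l.count 0) 0 ++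
          l.filter (0 < ·))) B P₀ E := by
        refine IsLinearOn.push_replicate h hm _ ?_ ?_ ?_
        · rw [← hn]
          have := width_eq_count_add l
          simp; omega
        · rw [← hμ]
          simp [posParts_cons_pos hm, hpl]
        · simpa [List.count_cons, List.filter_cons, hm, hm.ne'] using hE
      have := ih (C := C ++ [m]) (by simpa using hn) (by simpa using hμ) (by simpa using h1)
      simpa using this

end

/-- Blocks with a standard choice of points, all but one factor of each being an `x`. -/
lemma exists_standard_points (l : List ℕ) : ∀ r, 1 ≤ r → ∃ z : ℕ → ℕ × ℕ, HasShape z r l ∧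
    slope z r l = 1 ∧ ∀ j, r ≤ j → j < r + width l → ptDeg (z j) ≤ (z j).1 + 1 := by
  induction l with
  | nil => exact fun r _ => ⟨0, trivial, rfl, fun j h1 h2 => by simp at h2; omega⟩
  | cons m l ih =>
    intro r hr
    obtain ⟨z, hz1, hz2, hz3⟩ := ih (r + m + 1) (by omega)
    set z' : ℕ → ℕ × ℕ := fun j => if r + m + 1 ≤ j then z j else if j = r then (r, 0) else
      if j = r + 1 then (r - 1, 1) else (j - 1, 0) with hz'
    have e0 : z' r = (r, 0) := by simp only [z']; rw [if_neg (by omega), if_pos trivial]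
    have e1 : 0 < m → z' (r + 1) = (r - 1, 1) := fun hm => by
      simp only [z']; rw [if_neg (by omega), if_neg (by omega), if_pos trivial]
    have e2 : ∀ j, r + 2 ≤ j → j < r + m + 1 → z' j = (j - 1, 0) := fun j h1 h2 => by
      simp only [z']; rw [if_neg (by omega), if_neg (by omega), if_neg (by omega)]
    have e3 : ∀ j, r + m + 1 ≤ j → z' j = z j := fun j hj => by simp only [z']; rw [if_pos hj]
    refine ⟨z', ⟨?_, fun i h1 h2 => ?_, hz1.congr fun j hj _ => e3 j hj⟩, ?_, fun j h1 h2 => ?_⟩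
    · rw [e0]; rfl
    · by_cases hi : i = 1
      · rw [hi, e1 (by omega)]; simp [ptDeg]; omega
      · rw [e2 _ (by omega) (by omega)]; simp [ptDeg]
    · simp only [slope]
      rw [slope_congr (P := z) fun j hj _ => e3 j hj, hz2]
      split_ifs with hm
      · rfl
      · rw [e0, e1 (by omega)]; simp; omega
    · simp only [width_cons] at h2
      by_cases hj : r + m + 1 ≤ j
      · rw [e3 j hj]; exact hz3 j hj (by omega)
      by_cases hj0 : j = r
      · rw [hj0, e0]; simp [ptDeg]
      by_cases hj1 : j = r + 1
      · rw [hj1, e1 (by omega)]; simp [ptDeg]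
      rw [e2 j (by omega) (by omega)]; simp [ptDeg]

lemma HasShape.sum_ptDeg {P : ℕ → ℕ × ℕ} {r : ℕ} {l : List ℕ} (h : HasShape P r l) :
    ∑ j ∈ Ico r (r + width l), ptDeg (P j) + l.sum = ∑ j ∈ Ico r (r + width l), j := by
  induction l generalizing r with
  | nil => simp
  | cons m l ih =>
    have h2 := ih h.2.2
    simp only [width_cons, List.sum_cons]
    rw [← sum_Ico_consecutive _ (show r ≤ r + m + 1 by omega)
        (show r + m + 1 ≤ r + (m + 1 + width l) by omega),
      ← sum_Ico_consecutive (fun j => j) (show r ≤ r + m + 1 by omega)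
        (show r + m + 1 ≤ r + (m + 1 + width l) by omega),
      show r + (m + 1 + width l) = r + m + 1 + width l by omega, ← h2]
    have h3 : ∑ j ∈ Ico r (r + m + 1), ptDeg (P j) + m = ∑ j ∈ Ico r (r + m + 1), j := by
      rw [sum_eq_sum_Ico_succ_bot (by omega), sum_eq_sum_Ico_succ_bot (by omega) (fun j => j), h.1]
      have h4 : ∑ j ∈ Ico (r + 1) (r + m + 1), j =
          ∑ j ∈ Ico (r + 1) (r + m + 1), (ptDeg (P j) + 1) := by
        refine sum_congr rfl fun j hj => ?_
        rw [mem_Ico] at hj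
        rw [HasShape.ptDeg_block (B := l) h (by omega) (by omega)]
        omega
      rw [h4, sum_add_distrib]
      simp; omega
    omega

lemma HasShape.sum_ptDeg_le {P : ℕ → ℕ × ℕ} {r : ℕ} {l : List ℕ} (h : HasShape P r l)
    (hn : r + width l ≤ n) : ∑ j ∈ Ico r (r + width l), ptDeg (P j) ≤ width l * n := by
  have : ∑ j ∈ Ico r (r + width l), ptDeg (P j) ≤ ∑ _j ∈ Ico r (r + width l), n :=
    sum_le_sum fun j hj => by
      rw [mem_Ico] at hj
      have := h.ptDeg_le hj.1 hj.2
      omega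
  simpa using this

/-- If sufficiently many single points come first, and if there are enough factors `x` and `y` to
go around, then the symbols are proportional to the slopes. The blocks are treated one by one, by
exchanging the blocks before the block in question with the single points. -/
theorem IsStaircaseSymbol.exists_isLinearOn [Module ℂ V] (h : IsStaircaseSymbol n d μ T) {N : ℕ}
    (hN : 1 ≤ N) (ms : List ℕ) : ∀ {B : List ℕ} (P₀ : ℕ → ℕ × ℕ),
    (∀ m ∈ ms, 0 < m ∧ m + 1 ≤ N) → width (List.replicate N 0 ++ ms ++ B) = n →
    posParts (ms ++ B) = μ → (width ms + width B + 1) * n ≤ d.1 →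
    (width ms + width B + 1) * n ≤ d.2 →
    ∃ E : V, IsLinearOn n d T (List.replicate N 0 ++ ms) B P₀ E := by
  induction ms using List.reverseRecOn with
  | nil =>
    intro B P₀ _ hn hμ _ _
    by_cases hex : ∃ P, HasShape P 0 (List.replicate N 0 ++ [] ++ B) ∧ ∑ j ∈ range n, P j = d ∧
        ∀ j < n, width (List.replicate N 0 ++ []) ≤ j → P j = P₀ j
    · obtain ⟨P, hP, hPd, hP0⟩ := hex
      refine ⟨T P, fun Q hQ hQd hQ0 => ?_⟩
      simp only [List.append_nil, width_replicate, slope_replicate, one_smul] at *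
      refine h.singles (A := []) (u := 0) rfl (L := N) (B := B) (by simpa using hQ)
        (by simpa using hP) (by simpa using hn) (fun j hj hj' => ?_) hQd hPd
      rw [hP0 j hj (by omega), hQ0 j hj (by omega)]
    · exact ⟨0, fun P hP hPd hP0 => absurd ⟨P, hP, hPd, hP0⟩ hex⟩
  | append_singleton ms m ih =>
    intro B P₀ hms hn hμ hd₁ hd₂
    have hm := hms m (by simp)
    have hms' : ∀ m ∈ ms, 0 < m ∧ m + 1 ≤ N := fun a ha => hms a (by simp [ha])
    by_cases hex : ∃ P, HasShape P 0 (List.replicate N 0 ++ (ms ++ [m]) ++ B) ∧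
        ∑ j ∈ range n, P j = d ∧
        ∀ j < n, width (List.replicate N 0 ++ (ms ++ [m])) ≤ j → P j = P₀ j
    swap
    · exact ⟨0, fun P hP hPd hP0 => absurd ⟨P, hP, hPd, hP0⟩ hex⟩
    obtain ⟨W, hW, hWd, hW0⟩ := hex
    simp only [width_append, width_replicate, width_cons, width_nil] at hn hd₁ hd₂ hW0
    obtain ⟨u, hu⟩ : ∃ u, u = width (0 :: ms) := ⟨_, rfl⟩
    have hu' : u = 1 + width ms := by rw [hu]; simp
    obtain ⟨p, hp⟩ : ∃ p, p = u + (N - 1) := ⟨_, rfl⟩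
    obtain ⟨z, hz1, hz2, -⟩ := exists_standard_points ms 1 le_rfl
    set Z : ℕ → ℕ × ℕ := fun j => if j = 0 then 0 else if j < u then z j else P₀ j with hZ
    have eZ0 : Z 0 = 0 := by simp [Z]
    have eZ1 : ∀ j, 1 ≤ j → j < u → Z j = z j := fun j h1 h2 => by
      simp only [Z]; rw [if_neg (by omega), if_pos h2]
    have eZ2 : ∀ j, u ≤ j → Z j = P₀ j := fun j h1 => by
      simp only [Z]; rw [if_neg (by omega), if_neg (by omega)]
    have hZA : HasShape Z 0 (0 :: ms) :=
      ⟨by rw [eZ0]; rfl, fun i _ _ => by omega, hz1.congr fun j h1 h2 => eZ1 j h1 (by omega)⟩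
    have hWB := hW
    rw [hasShape_append, zero_add] at hWB
    simp only [width_append, width_replicate, width_cons, width_nil] at hWB
    have hZB : HasShape Z (p + m + 1) B := by
      rw [show p + m + 1 = N + (width ms + (m + 1 + 0)) by omega]
      refine hWB.2.congr fun j h1 h2 => ?_
      rw [eZ2 j (by omega), hW0 j (by omega) (by omega)]
    -- There are enough factors `x` and `y`.
    have hSB : ∑ j ∈ Ico p (p + m + 1), max p (j - 1) + m = ∑ j ∈ Ico p (p + m + 1), j := by
      have h1 : ∑ j ∈ Ico p (p + m + 1), max p (j - 1) + ∑ j ∈ Ico p (p + m + 1),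
          (if j < p + 1 then 0 else 1) = ∑ j ∈ Ico p (p + m + 1), j := by
        rw [← sum_add_distrib]
        refine sum_congr rfl fun j hj => ?_
        rw [mem_Ico] at hj
        split_ifs <;> omega
      rw [sum_eq_sum_Ico_succ_bot (show p < p + m + 1 by omega) fun j => if j < p + 1 then 0 else 1,
        sum_congr (s₁ := Ico (p + 1) (p + m + 1)) rfl fun j hj => if_neg (by simp at hj; omega)]
        at h1
      simpa using h1
    have hSBle : ∑ j ∈ Ico p (p + m + 1), max p (j - 1) ≤ (m + 1) * n := by
      have : ∑ j ∈ Ico p (p + m + 1), max p (j - 1) ≤ ∑ _j ∈ Ico p (p + m + 1), n :=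
        sum_le_sum fun j hj => by rw [mem_Ico] at hj; omega
      simpa [show p + m + 1 - p = m + 1 by omega] using this
    have hZBn : p + m + 1 + width B = n := by omega
    have hZA' := hZA.sum_ptDeg
    have hZB' := hZB.sum_ptDeg
    have hZBle := hZB.sum_ptDeg_le hZBn.le
    have hzle := (hZA.2.2).sum_ptDeg_le (n := n) (by omega)
    rw [zero_add, ← hu, ← range_eq_Ico] at hZA'
    rw [hZBn] at hZB' hZBle
    have hZAle : ∑ j ∈ range u, ptDeg (Z j) ≤ width ms * n := by
      rw [range_eq_Ico, sum_eq_sum_Ico_succ_bot (by omega), eZ0, hu']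
      simpa [ptDeg, add_comm, add_left_comm, add_assoc] using hzle
    have htot : ptDeg d + (ms.sum + m + B.sum) = ∑ j ∈ range n, j := by
      have := hW.sum_ptDeg
      have hwn : width (List.replicate N 0 ++ (ms ++ [m]) ++ B) = n := by simp; omega
      rw [hwn, zero_add, ← range_eq_Ico, ← ptDeg_sum, hWd] at this
      rw [← this]
      simp; ring
    have hpZ : ptDeg (∑ j ∈ range u, Z j + ∑ j ∈ Ico (p + m + 1) n, Z j) =
        ∑ j ∈ range u, ptDeg (Z j) + ∑ j ∈ Ico (p + m + 1) n, ptDeg (Z j) := by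
      rw [ptDeg_add, ptDeg_sum, ptDeg_sum]
    have hsplit := sum_range_split (n := n) (fun j => j) (show u ≤ p by omega)
      (show p ≤ p + m + 1 by omega) (by omega)
    have hroom : ∑ j ∈ range u, ptDeg (Z j) + ∑ j ∈ Ico (p + m + 1) n, ptDeg (Z j) +
        ∑ j ∈ Ico p (p + m + 1), max p (j - 1) + p ≤ (width ms + (m + 1 + 0) + width B + 1) * n := by
      calc _ ≤ width ms * n + width B * n + (m + 1) * n + n := by omega
        _ = _ := by ring
    have hZ₁ : (∑ j ∈ range u, Z j + ∑ j ∈ Ico (p + m + 1) n, Z j).1 +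
        ∑ j ∈ Ico p (p + m + 1), max p (j - 1) + p ≤ d.1 := by
      refine le_trans ?_ (hroom.trans hd₁)
      rw [← hpZ]; simp only [ptDeg]; omega
    have hZ₂ : (∑ j ∈ range u, Z j + ∑ j ∈ Ico (p + m + 1) n, Z j).2 +
        ∑ j ∈ Ico p (p + m + 1), max p (j - 1) + p ≤ d.2 := by
      refine le_trans ?_ (hroom.trans hd₂)
      rw [← hpZ]; simp only [ptDeg]; omega
    have hZd : ptDeg d = ptDeg (∑ j ∈ range u, Z j + ∑ j ∈ Ico (p + m + 1) n, Z j) +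
        ∑ j ∈ Ico u p, j + ∑ j ∈ Ico p (p + m + 1), max p (j - 1) := by
      rw [List.sum_cons, zero_add] at hZA'
      omega
    have hL : N - 1 - m + m = N - 1 := by omega
    have hnA : width (0 :: ms ++ List.replicate (N - 1) 0 ++ m :: B) = n := by simp; omega
    obtain ⟨E, hE⟩ := h.exists_block_linear (A := 0 :: ms) (B := B) (m := m) (g := N - 1 - m)
      (r := u + (N - 1 - m)) (p := p) (P₀ := Z) hu.symm rfl (by omega) (by omega) hm.1
      (by rw [hL]; exact hnA) (by rw [← hμ]; simp) hZA hZB hZ₁ hZ₂ hZd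
    rw [hL] at hE
    refine ⟨E, fun P hP hPd hP0 => ?_⟩
    simp only [width_append, width_replicate, width_cons, width_nil] at hP0
    obtain ⟨F, hF⟩ := ih (B := m :: B) P hms' (by simp; omega) (by rw [← hμ]; simp)
      (by simp only [width_cons]; convert hd₁ using 2; omega)
      (by simp only [width_cons]; convert hd₂ using 2; omega)
    have hPsh : HasShape P 0 (List.replicate N 0 ++ ms ++ m :: B) := by simpa using hP
    have hTP := hF P hPsh hPd fun _ _ _ => rfl
    -- The configuration with standard points in the preceding blocks, moved to the front.
    have hPb := hPsh
    rw [hasShape_append, zero_add, width_append, width_replicate,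
      show N + width ms = p by omega] at hPb
    obtain ⟨Q, hQ⟩ := exists_blockConfig (n := n) (d := d) (L := N - 1) (m := m) (u := u) (p := p)
      hu.symm hp.symm hnA hZA hZB (by omega) (by omega) hZd
      (y := fun j => (P j).1) (fun j h1 h2 => by
        have := hPb.2.ptDeg_block h1 h2
        simp only [ptDeg] at this; omega)
    have hQb := hQ.shape
    rw [hasShape_append, zero_add, width_append, width_replicate, ← hu,
      show u + (N - 1) = p by omega] at hQb
    have hQP : ∀ j < n, p ≤ j → Q j = P j := by
      intro j hj hj'
      by_cases hjm : j ≤ p + m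
      · have h1 := hPb.2.ptDeg_block hj' hjm
        have h2 := hQb.2.ptDeg_block hj' hjm
        have h3 := hQ.block j hj' hjm
        simp only [ptDeg] at h1 h2
        ext <;> omega
      · rw [hQ.outside j hj (by omega), eZ2 j (by omega), hP0 j hj (by omega)]
    have hcount : (0 :: ms ++ List.replicate (N - 1) 0).count 0 = N := by
      have : ms.count 0 = 0 := List.count_eq_zero.2 fun h0 => absurd (hms' 0 h0).1 (by simp)
      rw [List.count_append, List.count_cons, this]
      simp; omega
    have hfilter : (0 :: ms ++ List.replicate (N - 1) 0).filter (0 < ·) = ms := by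
      rw [List.cons_append, List.filter_cons_of_neg (by simp), List.filter_append,
        List.filter_eq_self.2 fun a ha => by simpa using (hms' a ha).1]
      simp
    have hTQ : T Q = F := by
      have hF' := IsLinearOn.of_sorted h (C := []) (B := m :: B) (P₀ := P) (E := F)
        (0 :: ms ++ List.replicate (N - 1) 0) (by simp; omega)
        (by rw [← hμ]; simp) (by rw [hcount, hfilter]; simpa using hF)
      have := hF' Q (by simpa using hQ.shape) hQ.sum (fun j hj hj' => hQP j hj (by
        simp at hj'; omega))
      rw [this, List.nil_append, slope_append, slope_replicate, mul_one]
      have hs : slope Q 0 (0 :: ms) = 1 := by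
        simp only [slope, if_pos, one_mul]
        rw [← hz2]
        exact slope_congr fun j h1 h2 => by
          rw [hQ.outside j (by omega) (by omega), eZ1 j h1 (by omega)]
      rw [hs, one_smul]
    have hTQ' := hE Q hQ.shape hQ.sum hQ.outside
    rw [hTP, ← hTQ, hTQ', hQP p (by omega) le_rfl, hQP (p + 1) (by omega) (by omega), smul_smul,
      ← List.append_assoc, slope_append 0 (List.replicate N 0 ++ ms) [m]]
    congr 1
    simp only [slope, width_append, width_replicate, zero_add, if_neg hm.1.ne', mul_one]
    rw [show N + width ms = p by omega]

end

/-! ### The order of the blocks -/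

section

open Finset

variable {V : Type*} [AddCommGroup V] {n : ℕ} {d : ℕ × ℕ} {μ : Multiset ℕ}
  {T : (ℕ → ℕ × ℕ) → V}

lemma IsLinearOn.eq_or_eq_neg_of_swap (h : IsStaircaseSymbol n d μ T) {N : ℕ} (hN : 1 ≤ N)
    {C D : List ℕ} {a b : ℕ} (ha : 0 < a) (hb : 0 < b)
    (hn : N + width (C ++ a :: b :: D) = n)
    (hd₁ : width (C ++ a :: b :: D) * n ≤ d.1) (hd₂ : width (C ++ a :: b :: D) * n ≤ d.2)
    (hd : ptDeg d + (C ++ a :: b :: D).sum = ∑ j ∈ range n, j) {P₁ P₂ : ℕ → ℕ × ℕ} {E F : V}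
    (hE : IsLinearOn n d T (List.replicate N 0 ++ (C ++ a :: b :: D)) [] P₁ E)
    (hF : IsLinearOn n d T (List.replicate N 0 ++ (C ++ b :: a :: D)) [] P₂ F) :
    F = E ∨ F = -E := by
  obtain ⟨z, hz1, hz2, hz3⟩ := exists_standard_points (C ++ a :: b :: D) N hN
  rw [hn] at hz3
  have hsumz := hz1.sum_ptDeg
  have hzle := hz1.sum_ptDeg_le hn.le
  rw [hn] at hsumz hzle
  have hrange : ∑ j ∈ range n, j = ∑ j ∈ range N, j + ∑ j ∈ Ico N n, j := by
    rw [range_eq_Ico, range_eq_Ico, sum_Ico_consecutive _ (Nat.zero_le _) (by omega)]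
  obtain ⟨X, hX⟩ : ∃ X, X + ∑ j ∈ Ico N n, z j = d := by
    have := ptDeg_sum (Ico N n) z
    simp only [ptDeg] at this hzle
    refine ⟨(d.1 - (∑ j ∈ Ico N n, z j).1, d.2 - (∑ j ∈ Ico N n, z j).2), ?_⟩
    ext <;> simp only [Prod.fst_add, Prod.snd_add] <;> omega
  obtain ⟨q, hq1, hq2⟩ := exists_points (range N) (fun j => j) X (by
    have := congrArg ptDeg hX
    rw [ptDeg_add, ptDeg_sum] at this
    omega)
  -- Standard points, and the points obtained by exchanging the two blocks.
  set P : ℕ → ℕ × ℕ := fun j => if j < N then q j else z j with hPdef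
  have e1 : ∀ j, j < N → P j = q j := fun j hj => by simp only [P]; rw [if_pos hj]
  have e2 : ∀ j, N ≤ j → P j = z j := fun j hj => by simp only [P]; rw [if_neg (by omega)]
  have hPz : HasShape P N (C ++ a :: b :: D) := hz1.congr fun j hj _ => e2 j hj
  have hPN : HasShape P 0 (List.replicate N 0) := hasShape_replicate.2 fun j _ hj => by
    rw [e1 j (by omega), hq1 j (by simp; omega)]
  have hP : HasShape P 0 (List.replicate N 0 ++ (C ++ a :: b :: D)) := by
    rw [hasShape_append, zero_add, width_replicate]
    exact ⟨hPN, hPz⟩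
  have hPd : ∑ j ∈ range n, P j = d := by
    rw [← hX, ← hq2, range_eq_Ico, ← sum_Ico_consecutive _ (Nat.zero_le N) (by omega : N ≤ n),
      range_eq_Ico]
    congr 1
    · exact sum_congr rfl fun j hj => e1 j (by simp at hj; omega)
    · exact sum_congr rfl fun j hj => e2 j (by simp at hj; omega)
  have hPs : slope P N (C ++ a :: b :: D) = 1 := by
    rw [slope_congr (P := z) fun j hj _ => e2 j hj, hz2]
  obtain ⟨R, hR⟩ : ∃ R, R = N + width C := ⟨_, rfl⟩
  simp only [width_append, width_cons] at hn
  rw [hasShape_append, ← hR] at hPz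
  obtain ⟨hPC, hPab⟩ := hPz
  have hPb := hPab.2.2
  have hPD := hPb.2.2
  set Q : ℕ → ℕ × ℕ := fun j => if R ≤ j ∧ j < R + b + 1 then P (j + a + 1) - (a + 1, 0) else
    if R + b + 1 ≤ j ∧ j < R + a + b + 2 then P (j - (b + 1)) + (b + 1, 0) else P j with hQdef
  have q1 : ∀ j, j < R ∨ R + a + b + 2 ≤ j → Q j = P j := fun j hj => by
    simp only [Q]; rw [if_neg (by omega), if_neg (by omega)]
  have q2 : ∀ j, R ≤ j → j < R + b + 1 → P (j + a + 1) = Q j + (a + 1, 0) := fun j h1 h2 => by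
    simp only [Q]
    rw [if_pos ⟨h1, h2⟩]
    have h3 := hz3 (j + a + 1) (by omega) (by omega)
    rw [← e2 _ (by omega), hPb.ptDeg_block (by omega) (by omega)] at h3
    ext <;> simp
    omega
  have q3 : ∀ j, R + b + 1 ≤ j → j < R + a + b + 2 → Q j = P (j - (b + 1)) + (b + 1, 0) :=
    fun j h1 h2 => by
      simp only [Q]; rw [if_neg (by omega), if_pos ⟨h1, h2⟩]
  have hQsh : HasShape Q 0 (List.replicate N 0 ++ (C ++ b :: a :: D)) := by
    rw [hasShape_append, hasShape_append, zero_add, width_replicate, ← hR]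
    refine ⟨hPN.congr fun j _ hj => q1 j (by rw [width_replicate] at hj; omega),
      hPC.congr fun j _ hj => q1 j (by omega),
      hasShape_cons (fun j h1 h2 => ?_) (hasShape_cons (fun j h1 h2 => ?_) ?_)⟩
    · have h3 := congrArg ptDeg (q2 j h1 (by omega))
      rw [hPb.ptDeg_block (by omega) (by omega), ptDeg_add] at h3
      simp only [ptDeg] at h3 ⊢
      omega
    · rw [q3 j (by omega) (by omega), ptDeg_add, hPab.ptDeg_block (by omega) (by omega)]
      simp only [ptDeg]; omega
    · rw [show R + b + 1 + a + 1 = R + a + 1 + b + 1 by omega]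
      exact hPD.congr fun j hj _ => q1 j (by omega)
  have hQd : ∑ j ∈ range n, Q j = d := by
    rw [← hPd]
    have h1 := sum_range_add_sum_swap (s := Ico R (R + a + b + 2)) (n := n) (P := P) (Q := Q)
      (fun j hj => by simp at hj ⊢; omega) (fun j hj hj' => (q1 j (by simp at hj'; omega)).symm)
    have hb : ∑ j ∈ Ico R (R + b + 1), Q j + ∑ j ∈ Ico R (R + b + 1), (a + 1, 0) =
        ∑ j ∈ Ico (R + a + 1) (R + a + b + 2), P j := by
      rw [← sum_add_distrib, show R + a + 1 = R + (a + 1) by omega,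
        show R + a + b + 2 = R + b + 1 + (a + 1) by omega, ← sum_Ico_add' P R (R + b + 1) (a + 1)]
      exact sum_congr rfl fun j hj => by
        rw [mem_Ico] at hj
        rw [← q2 j hj.1 hj.2, add_assoc]
    have ha : ∑ j ∈ Ico (R + b + 1) (R + a + b + 2), Q j =
        ∑ j ∈ Ico R (R + a + 1), P j + ∑ j ∈ Ico R (R + a + 1), (b + 1, 0) := by
      rw [← sum_add_distrib, show R + b + 1 = R + (b + 1) by omega,
        show R + a + b + 2 = R + a + 1 + (b + 1) by omega,
        ← sum_Ico_add' Q R (R + a + 1) (b + 1)]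
      exact sum_congr rfl fun j hj => by
        rw [mem_Ico] at hj
        rw [q3 _ (by omega) (by omega), Nat.add_sub_cancel]
    rw [← sum_Ico_consecutive Q (show R ≤ R + b + 1 by omega)
      (show R + b + 1 ≤ R + a + b + 2 by omega),
      ← sum_Ico_consecutive P (show R ≤ R + a + 1 by omega)
      (show R + a + 1 ≤ R + a + b + 2 by omega), ha, ← hb] at h1
    have hc : ∑ j ∈ Ico R (R + b + 1), ((a + 1, 0) : ℕ × ℕ) =
        ∑ j ∈ Ico R (R + a + 1), ((b + 1, 0) : ℕ × ℕ) := by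
      rw [sum_const, sum_const, Nat.card_Ico, Nat.card_Ico,
        show R + b + 1 - R = b + 1 by omega, show R + a + 1 - R = a + 1 by omega]
      ext <;> simp [mul_comm]
    rw [hc] at h1
    refine (add_right_cancel (Eq.trans ?_ h1)).symm
    congr 1
    abel
  have hQs : slope Q N (C ++ b :: a :: D) = 1 := by
    rw [← hPs, slope_append, slope_append, slope_congr (P := P) (Q := Q) fun j _ hj =>
      q1 j (by omega), ← hR]
    simp only [slope, if_neg ha.ne', if_neg hb.ne']
    rw [show R + b + 1 + a + 1 = R + a + 1 + b + 1 by omega,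
      slope_congr (P := P) (Q := Q) fun j hj _ => q1 j (by omega), q3 _ le_rfl (by omega),
      q3 (R + b + 1 + 1) (by omega) (by omega), show R + b + 1 - (b + 1) = R by omega,
      show R + b + 1 + 1 - (b + 1) = R + 1 by omega,
      show R + a + 1 + 1 = R + 1 + a + 1 by omega, q2 R le_rfl (by omega),
      q2 (R + 1) (by omega) (by omega)]
    simp only [Prod.fst_add]
    push_cast
    ring
  have hTP := hE P (by simpa using hP) hPd fun j hj hj' => by simp at hj'; omega
  have hTQ := hF Q (by simpa using hQsh) hQd fun j hj hj' => by simp at hj'; omega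
  rw [slope_append, slope_replicate, width_replicate, zero_add, hPs, one_mul, one_smul] at hTP
  rw [slope_append, slope_replicate, width_replicate, zero_add, hQs, one_mul, one_smul] at hTQ
  rw [← hTP, ← hTQ]
  have hw : width (List.replicate N 0 ++ C) = R := by simp [hR]
  refine h.exchange P Q (List.replicate N 0 ++ C) D a b (by simpa using hP) (by simp; omega) hPd hQd
    (fun j _ hj => q1 j (by omega)) (fun i hi => ?_) (fun i hi => ?_)
    (fun j _ hj => q1 j (by omega))
  · rw [hw, show R + a + 1 + i = R + i + a + 1 by omega]
    exact q2 _ (by omega) (by omega)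
  · rw [hw, q3 _ (by omega) (by omega)]
    congr 2
    omega

/-- The proportionality factor is independent of the order of the blocks, up to sign. -/
lemma IsLinearOn.perm [Module ℂ V] (h : IsStaircaseSymbol n d μ T) {N : ℕ} (hN : 1 ≤ N)
    {ms ms' : List ℕ} (hp : ms.Perm ms') : ∀ {C : List ℕ} {P₀ : ℕ → ℕ × ℕ} {E : V},
    (∀ m ∈ C ++ ms, 0 < m ∧ m + 1 ≤ N) → N + width (C ++ ms) = n → posParts (C ++ ms) = μ →
    (width (C ++ ms) + 1) * n ≤ d.1 → (width (C ++ ms) + 1) * n ≤ d.2 →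
    ptDeg d + (C ++ ms).sum = ∑ j ∈ range n, j →
    IsLinearOn n d T (List.replicate N 0 ++ (C ++ ms)) [] P₀ E →
    ∃ F, (F = E ∨ F = -E) ∧ IsLinearOn n d T (List.replicate N 0 ++ (C ++ ms')) [] P₀ F := by
  induction hp with
  | nil => exact fun _ _ _ _ _ _ hE => ⟨_, .inl rfl, hE⟩
  | @cons a l l' hl ih =>
    intro C P₀ E h1 h2 h3 h4 h5 h6 hE
    have e : ∀ l : List ℕ, C ++ a :: l = C ++ [a] ++ l := fun l => by simp
    rw [e] at h1 h2 h3 h4 h5 h6 hE ⊢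
    exact ih h1 h2 h3 h4 h5 h6 hE
  | swap a b l =>
    intro C P₀ E h1 h2 h3 h4 h5 h6 hE
    have ha : 0 < a := (h1 a (by simp)).1
    have hb : 0 < b := (h1 b (by simp)).1
    have hw : width (C ++ a :: b :: l) = width (C ++ b :: a :: l) := by simp; omega
    obtain ⟨F, hF⟩ := h.exists_isLinearOn hN (C ++ a :: b :: l) (B := []) P₀
      (fun m hm => h1 m (by simp at hm ⊢; tauto)) (by rw [← h2, ← hw]; simp)
      (by rw [← h3]; simp [posParts_cons_pos, ha, hb]; exact Multiset.cons_swap _ _ _)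
      (by rw [hw]; simpa using h4) (by rw [hw]; simpa using h5)
    refine ⟨F, ?_, hF⟩
    exact hE.eq_or_eq_neg_of_swap h hN hb ha h2
      ((Nat.mul_le_mul_right n (Nat.le_succ _)).trans h4)
      ((Nat.mul_le_mul_right n (Nat.le_succ _)).trans h5) h6 hF
  | @trans l₁ l₂ l₃ hp₁ hp₂ ih₁ ih₂ =>
    intro C P₀ E h1 h2 h3 h4 h5 h6 hE
    obtain ⟨F, hFE, hF⟩ := ih₁ h1 h2 h3 h4 h5 h6 hE
    have hpp : (C ++ l₁).Perm (C ++ l₂) := hp₁.append_left C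
    have hw : width (C ++ l₁) = width (C ++ l₂) := (hpp.map _).sum_eq
    obtain ⟨G, hGF, hG⟩ := ih₂ (fun m hm => h1 m (hpp.mem_iff.2 hm)) (hw ▸ h2)
      (by rw [← h3]; simp only [posParts]; rw [Multiset.coe_eq_coe.2 hpp]) (hw ▸ h4) (hw ▸ h5)
      (hpp.sum_eq ▸ h6) hF
    refine ⟨G, ?_, hG⟩
    rcases hFE with rfl | rfl <;> rcases hGF with rfl | rfl <;> simp

lemma width_le_two_mul_sum {l : List ℕ} (hl : ∀ m ∈ l, 0 < m) : width l ≤ 2 * l.sum := by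
  induction l with
  | nil => simp
  | cons a l ih =>
    have h1 := ih fun m hm => hl m (by simp [hm])
    have h2 := hl a (by simp)
    simp; omega

lemma le_sum_of_mem {l : List ℕ} {m : ℕ} (hm : m ∈ l) : m ≤ l.sum :=
  List.single_le_sum (by simp) m hm

/-- Two symbols of the same type and bidegree are proportional. -/
theorem IsStaircaseSymbol.exists_smul_eq [Module ℂ V] (h : IsStaircaseSymbol n d μ T) {k : ℕ}
    (hk : μ.sum = k) (hkn : 3 * k + 1 ≤ n) (hd₁ : (2 * k + 1) * n ≤ d.1)
    (hd₂ : (2 * k + 1) * n ≤ d.2) {P P' : ℕ → ℕ × ℕ} {l l' : List ℕ}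
    (hP : HasShape P 0 l) (hP' : HasShape P' 0 l') (hl : width l = n) (hl' : width l' = n)
    (hμ : posParts l = μ) (hμ' : posParts l' = μ) (hPd : ∑ j ∈ range n, P j = d)
    (hPd' : ∑ j ∈ range n, P' j = d) (hs : slope P 0 l ≠ 0) : ∃ c : ℂ, T P' = c • T P := by
  obtain ⟨ms, hms⟩ : ∃ ms, ms = l.filter (0 < ·) := ⟨_, rfl⟩
  obtain ⟨ms', hms'⟩ : ∃ ms', ms' = l'.filter (0 < ·) := ⟨_, rfl⟩
  have hcoe : (ms : Multiset ℕ) = μ := by rw [← hμ, hms]; simp [posParts]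
  have hcoe' : (ms' : Multiset ℕ) = μ := by rw [← hμ', hms']; simp [posParts]
  have hperm : ms.Perm ms' := Multiset.coe_eq_coe.1 (hcoe.trans hcoe'.symm)
  have hsum : ms.sum = k := by rw [← hk, ← hcoe, Multiset.sum_coe]
  have hpos : ∀ m ∈ ms, 0 < m := fun m hm => by rw [hms] at hm; simpa using (List.mem_filter.1 hm).2
  have hw := width_le_two_mul_sum hpos
  have hww : width ms = width ms' := (hperm.map _).sum_eq
  have hc := width_eq_count_add l
  have hc' := width_eq_count_add l'
  rw [← hms] at hc
  rw [← hms'] at hc'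
  obtain ⟨N, hN⟩ : ∃ N, N = l.count 0 := ⟨_, rfl⟩
  have hN' : N = l'.count 0 := by omega
  have hposN : ∀ m ∈ ms, 0 < m ∧ m + 1 ≤ N := fun m hm => by
    have := le_sum_of_mem hm
    exact ⟨hpos m hm, by omega⟩
  have hμms : posParts ms = μ := by
    rw [posParts, Multiset.filter_eq_self.2 (by simpa using hpos), hcoe]
  have hroom : (width ms + 1) * n ≤ (2 * k + 1) * n := Nat.mul_le_mul_right n (by omega)
  obtain ⟨E, hE⟩ := h.exists_isLinearOn (N := N) (by omega) ms (B := []) 0 hposN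
    (by simp; omega) (by simpa using hμms) (by simpa using hroom.trans hd₁)
    (by simpa using hroom.trans hd₂)
  have htot : ptDeg d + ms.sum = ∑ j ∈ range n, j := by
    have h1 := hP.sum_ptDeg
    rw [zero_add, hl, ← range_eq_Ico, ← ptDeg_sum, hPd] at h1
    rw [← h1, hms]
    congr 1
    clear hms hP hl hμ hs hc hN h1
    induction l with
    | nil => rfl
    | cons a l ih =>
      rcases Nat.eq_zero_or_pos a with rfl | ha
      · simpa using ih
      · simp [ha, ih]
  obtain ⟨F, hFE, hF⟩ := IsLinearOn.perm h (N := N) (by omega) hperm (C := []) (P₀ := 0) (E := E)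
    (by simpa using hposN) (by simp; omega) (by simpa using hμms)
    (by simpa using hroom.trans hd₁) (by simpa using hroom.trans hd₂) (by simpa using htot)
    (by simpa using hE)
  have hlE : IsLinearOn n d T l [] 0 E := by
    have := IsLinearOn.of_sorted h (B := []) (P₀ := 0) (E := E) l (C := []) (by simpa using hl)
      (by simpa using hμ) (by rw [← hN, ← hms]; simpa using hE)
    simpa using this
  have hlF : IsLinearOn n d T l' [] 0 F := by
    have := IsLinearOn.of_sorted h (B := []) (P₀ := 0) (E := F) l' (C := []) (by simpa using hl')
      (by simpa using hμ') (by rw [← hN', ← hms']; simpa using hF)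
    simpa using this
  have hTP := hlE P (by simpa using hP) hPd fun j hj hj' => by omega
  have hTP' := hlF P' (by simpa using hP') hPd' fun j hj hj' => by omega
  have hsC : ((slope P 0 l : ℤ) : ℂ) ≠ 0 := by exact_mod_cast hs
  have hEP : E = ((slope P 0 l : ℤ) : ℂ)⁻¹ • T P := by
    rw [hTP, ← Int.cast_smul_eq_zsmul ℂ, smul_smul, inv_mul_cancel₀ hsC, one_smul]
  rcases hFE with rfl | rfl
  · refine ⟨(slope P' 0 l' : ℂ) * ((slope P 0 l : ℤ) : ℂ)⁻¹, ?_⟩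
    rw [mul_smul, ← hEP, hTP', Int.cast_smul_eq_zsmul]
  · refine ⟨-((slope P' 0 l' : ℂ) * ((slope P 0 l : ℤ) : ℂ)⁻¹), ?_⟩
    rw [neg_smul, mul_smul, ← hEP, hTP', Int.cast_smul_eq_zsmul, smul_neg]

end

/-! ### Determinants with monic columns -/

section

open Finset

variable {n : ℕ}

/-- A column `F 0, …, F (n - 1)` of homogeneous polynomials of degree `s` whose entries `F p` and
`F q` agree modulo `(x p - x q, y p - y q)`. Columns of this kind span determinants in the ideal of
the diagonal locus. -/
def IsDiagonalColumn (s : ℕ) (F : Fin n → Poly n) : Prop :=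
  (∀ i, (F i).IsHomogeneous s) ∧ ∀ p q, F p - F q ∈ Ideal.span {x p - x q, y p - y q}

lemma x_isHomogeneous (i : Fin n) : (x i).IsHomogeneous 1 := MvPolynomial.isHomogeneous_X _ _

lemma y_isHomogeneous (i : Fin n) : (y i).IsHomogeneous 1 := MvPolynomial.isHomogeneous_X _ _

lemma isDiagonalColumn_const {s : ℕ} {c : Poly n} (hc : c.IsHomogeneous s) :
    IsDiagonalColumn s fun _ : Fin n => c := ⟨fun _ => hc, fun p q => by simp⟩

lemma isDiagonalColumn_x : IsDiagonalColumn 1 (x : Fin n → Poly n) :=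
  ⟨x_isHomogeneous, fun _ _ => Ideal.subset_span (by simp)⟩

lemma isDiagonalColumn_y : IsDiagonalColumn 1 (y : Fin n → Poly n) :=
  ⟨y_isHomogeneous, fun _ _ => Ideal.subset_span (by simp)⟩

lemma IsDiagonalColumn.mul {s t : ℕ} {F G : Fin n → Poly n} (hF : IsDiagonalColumn s F)
    (hG : IsDiagonalColumn t G) : IsDiagonalColumn (s + t) fun i => F i * G i :=
  ⟨fun i => (hF.1 i).mul (hG.1 i), fun p q => by
    have : F p * G p - F q * G q = G p * (F p - F q) + F q * (G p - G q) := by ring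
    rw [this]
    exact Ideal.add_mem _ (Ideal.mul_mem_left _ _ (hF.2 p q)) (Ideal.mul_mem_left _ _ (hG.2 p q))⟩

lemma IsDiagonalColumn.sub {s : ℕ} {F G : Fin n → Poly n} (hF : IsDiagonalColumn s F)
    (hG : IsDiagonalColumn s G) : IsDiagonalColumn s fun i => F i - G i :=
  ⟨fun i => (hF.1 i).sub (hG.1 i), fun p q => by
    have : F p - G p - (F q - G q) = (F p - F q) - (G p - G q) := by ring
    rw [this]
    exact Ideal.sub_mem _ (hF.2 p q) (hG.2 p q)⟩

/-- Modulo `(x p - x q, y p - y q)` the rows `p` and `q` of the matrix are equal. -/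
lemma det_mem_diagIdeal {M : Matrix (Fin n) (Fin n) (Poly n)} {s : Fin n → ℕ}
    (hM : ∀ j, IsDiagonalColumn (s j) fun i => M i j) : M.det ∈ diagIdeal n := by
  simp only [diagIdeal, Ideal.mem_iInf]
  intro p q hpq
  rw [← Ideal.Quotient.eq_zero_iff_mem, RingHom.map_det]
  refine Matrix.det_zero_of_row_eq hpq.ne (funext fun j => ?_)
  exact Ideal.Quotient.eq.2 ((hM j).2 p q)

lemma det_isHomogeneous {M : Matrix (Fin n) (Fin n) (Poly n)} {s : Fin n → ℕ}
    (hM : ∀ j, IsDiagonalColumn (s j) fun i => M i j) : M.det.IsHomogeneous (∑ j, s j) := by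
  rw [Matrix.det_apply]
  refine MvPolynomial.IsHomogeneous.sum _ _ _ fun σ _ => ?_
  have h : (∏ i, M (σ i) i).IsHomogeneous (∑ j, s j) :=
    MvPolynomial.IsHomogeneous.prod _ _ _ fun j _ => (hM j).1 _
  rcases Int.units_eq_one_or (Equiv.Perm.sign σ) with hσ | hσ
  · rw [hσ, one_smul]; exact h
  · rw [hσ, Units.neg_smul, one_smul]; exact h.neg

lemma det_mem_diagIdealLT {M : Matrix (Fin n) (Fin n) (Poly n)} {s : Fin n → ℕ} {D : ℕ}
    (hM : ∀ j, IsDiagonalColumn (s j) fun i => M i j) (hD : ∑ j, s j < D) :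
    M.det ∈ diagIdealLT n D :=
  Ideal.subset_span ⟨det_mem_diagIdeal hM, _, hD, det_isHomogeneous hM⟩

/-- The columns obtained from the constant column `1` by multiplying `p.1` times by a column
`x i - c` and `p.2` times by a column `y i - c`, where `c` is a linear form that does not depend on
the row `i`. -/
inductive IsMonicColumn : ℕ × ℕ → (Fin n → Poly n) → Prop
  | one : IsMonicColumn (0, 0) fun _ => 1
  | mul_x {p F c} : MvPolynomial.IsHomogeneous c 1 → IsMonicColumn p F →
      IsMonicColumn (p + (1, 0)) fun i => (x i - c) * F i
  | mul_y {p F c} : MvPolynomial.IsHomogeneous c 1 → IsMonicColumn p F →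
      IsMonicColumn (p + (0, 1)) fun i => (y i - c) * F i

lemma IsMonicColumn.isDiagonalColumn {p : ℕ × ℕ} {F : Fin n → Poly n} (h : IsMonicColumn p F) :
    IsDiagonalColumn (ptDeg p) F := by
  induction h with
  | one => exact isDiagonalColumn_const (MvPolynomial.isHomogeneous_one _ _)
  | mul_x hc _ ih =>
    rw [ptDeg_add, add_comm]
    exact (isDiagonalColumn_x.sub (isDiagonalColumn_const hc)).mul ih
  | mul_y hc _ ih =>
    rw [ptDeg_add, add_comm]
    exact (isDiagonalColumn_y.sub (isDiagonalColumn_const hc)).mul ih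

lemma isMonicColumn_monomial (p : ℕ × ℕ) :
    IsMonicColumn p fun i : Fin n => x i ^ p.1 * y i ^ p.2 := by
  obtain ⟨a, b⟩ := p
  have h0 : MvPolynomial.IsHomogeneous (0 : Poly n) 1 := MvPolynomial.isHomogeneous_zero _ _ _
  induction b with
  | zero =>
    induction a with
    | zero => simpa using IsMonicColumn.one (n := n)
    | succ a ih => simpa [pow_succ, mul_comm] using ih.mul_x h0
  | succ b ih =>
    have := ih.mul_y h0
    simp only [sub_zero, Prod.mk_add_mk, add_zero] at this
    convert this using 2
    ring

lemma IsDiagonalColumn.updateCol {M : Matrix (Fin n) (Fin n) (Poly n)} {s : Fin n → ℕ}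
    (hM : ∀ j, IsDiagonalColumn (s j) fun i => M i j) {j : Fin n} {e : ℕ} {G : Fin n → Poly n}
    (hG : IsDiagonalColumn e G) (j' : Fin n) :
    IsDiagonalColumn (Function.update s j e j') fun i => M.updateCol j G i j' := by
  by_cases h : j' = j
  · subst h; simpa using hG
  · simpa [Function.update_of_ne h, Matrix.updateCol_ne h] using hM j'

/-- Replacing a monic column by a monomial changes the determinant by an element of `I_{<D}`: the
difference is a combination of determinants of smaller degree. -/
lemma IsMonicColumn.det_sub_mem {M : Matrix (Fin n) (Fin n) (Poly n)} {s : Fin n → ℕ}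
    (hM : ∀ j, IsDiagonalColumn (s j) fun i => M i j) (j : Fin n) {p : ℕ × ℕ} {F : Fin n → Poly n}
    (hF : IsMonicColumn p F) {e : ℕ} {G : Fin n → Poly n} (hG : IsDiagonalColumn e G) {D : ℕ}
    (hD : ∑ j' ∈ univ \ {j}, s j' + e + ptDeg p = D) :
    (M.updateCol j fun i => G i * F i).det -
      (M.updateCol j fun i => G i * (x i ^ p.1 * y i ^ p.2)).det ∈ diagIdealLT n D := by
  induction hF generalizing e G D with
  | one => simp
  | @mul_x p F c hc hF ih =>
    have h1 := ih (hG.mul isDiagonalColumn_x) (D := D) (by rw [← hD, ptDeg_add]; simp [ptDeg]; ring)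
    have h2 : (M.updateCol j fun i => G i * F i).det ∈ diagIdealLT n D := by
      refine det_mem_diagIdealLT (s := _) (fun j' => (hG.mul hF.isDiagonalColumn).updateCol hM j') ?_
      rw [Finset.sum_update_of_mem (mem_univ j), ← hD, ptDeg_add]
      simp [ptDeg]; omega
    have e1 : (fun i => G i * ((x i - c) * F i)) =
        (fun i => G i * x i * F i) + (-c) • fun i => G i * F i := by
      ext1 i; simp; ring
    have e2 : (fun i => G i * x i * (x i ^ p.1 * y i ^ p.2)) =
        fun i => G i * (x i ^ (p + (1, 0)).1 * y i ^ (p + (1, 0)).2) := by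
      ext1 i; simp [pow_succ]; ring
    rw [e2] at h1
    rw [e1, Matrix.det_updateCol_add, Matrix.det_updateCol_smul, add_sub_right_comm]
    exact Ideal.add_mem _ h1 (Ideal.mul_mem_left _ _ h2)
  | @mul_y p F c hc hF ih =>
    have h1 := ih (hG.mul isDiagonalColumn_y) (D := D) (by rw [← hD, ptDeg_add]; simp [ptDeg]; ring)
    have h2 : (M.updateCol j fun i => G i * F i).det ∈ diagIdealLT n D := by
      refine det_mem_diagIdealLT (s := _) (fun j' => (hG.mul hF.isDiagonalColumn).updateCol hM j') ?_
      rw [Finset.sum_update_of_mem (mem_univ j), ← hD, ptDeg_add]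
      simp [ptDeg]; omega
    have e1 : (fun i => G i * ((y i - c) * F i)) =
        (fun i => G i * y i * F i) + (-c) • fun i => G i * F i := by
      ext1 i; simp; ring
    have e2 : (fun i => G i * y i * (x i ^ p.1 * y i ^ p.2)) =
        fun i => G i * (x i ^ (p + (0, 1)).1 * y i ^ (p + (0, 1)).2) := by
      ext1 i; simp [pow_succ]; ring
    rw [e2] at h1
    rw [e1, Matrix.det_updateCol_add, Matrix.det_updateCol_smul, add_sub_right_comm]
    exact Ideal.add_mem _ h1 (Ideal.mul_mem_left _ _ h2)

/-- A determinant with monic columns agrees with `Δ` modulo polynomials of smaller degree in the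
ideal. -/
lemma det_sub_Delta_mem {M : Matrix (Fin n) (Fin n) (Poly n)} {P : Fin n → ℕ × ℕ}
    (hM : ∀ j, IsMonicColumn (P j) fun i => M i j) :
    M.det - Delta P ∈ diagIdealLT n (∑ j, ptDeg (P j)) := by
  let N : Finset (Fin n) → Matrix (Fin n) (Fin n) (Poly n) := fun t =>
    Matrix.of fun i j => if j ∈ t then x i ^ (P j).1 * y i ^ (P j).2 else M i j
  have hN : ∀ t j, IsMonicColumn (P j) fun i => N t i j := fun t j => by
    by_cases h : j ∈ t
    · simpa [N, h] using isMonicColumn_monomial (P j)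
    · simpa [N, h] using hM j
  have key : ∀ t, M.det - (N t).det ∈ diagIdealLT n (∑ j, ptDeg (P j)) := by
    intro t
    induction t using Finset.induction_on with
    | empty => simp [N, show (Matrix.of fun i j => M i j) = M from rfl]
    | insert a t ha ih =>
      have h := IsMonicColumn.det_sub_mem (fun j => (hN t j).isDiagonalColumn) a (hM a)
        (isDiagonalColumn_const (MvPolynomial.isHomogeneous_one _ _)) (D := ∑ j, ptDeg (P j))
        (by rw [add_zero, ← Finset.sum_sdiff (subset_univ {a}), Finset.sum_singleton])
      simp only [one_mul] at h
      have e1 : (N t).updateCol a (fun i => M i a) = N t := by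
        ext1 i j
        by_cases hj : j = a
        · subst hj; simp [N, ha]
        · simp [Matrix.updateCol_ne hj]
      have e2 : ((N t).updateCol a fun i => x i ^ (P a).1 * y i ^ (P a).2) = N (insert a t) := by
        ext1 i j
        by_cases hj : j = a
        · subst hj; simp [N]
        · simp [N, hj]
      rw [e1, e2] at h
      rw [← sub_add_sub_cancel M.det (N t).det]
      exact Ideal.add_mem _ ih h
  have := key univ
  simpa [N, Delta] using this

end

/-! ### Staircase columns and the local power sum relations -/

section

open Finset

variable {n : ℕ}

/-- The linear form `u l` if `l < n`, and `0` otherwise. -/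
noncomputable def extendZero (u : Fin n → Poly n) (l : ℕ) : Poly n :=
  if h : l < n then u ⟨l, h⟩ else 0

lemma extendZero_coe (u : Fin n → Poly n) (l : Fin n) : extendZero u l = u l := by
  simp [extendZero]

lemma extendZero_isHomogeneous {u : Fin n → Poly n} (hu : ∀ i, (u i).IsHomogeneous 1) (l : ℕ) :
    (extendZero u l).IsHomogeneous 1 := by
  unfold extendZero
  split_ifs
  · exact hu _
  · exact MvPolynomial.isHomogeneous_zero _ _ _

/-- The column of a staircase form with point `p`: its `i`-th entry is the product of the
`x i - x l` for `l < p.1` and of the `y i - y l` for `p.1 ≤ l < p.1 + p.2`. -/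
noncomputable def stairColumn (p : ℕ × ℕ) (i : Fin n) : Poly n :=
  ∏ l ∈ range (ptDeg p), if l < p.1 then x i - extendZero x l else y i - extendZero y l

lemma isMonicColumn_stairColumn (p : ℕ × ℕ) :
    IsMonicColumn p (stairColumn p : Fin n → Poly n) := by
  obtain ⟨a, b⟩ := p
  induction b with
  | zero =>
    have key : ∀ a' ≤ a, IsMonicColumn (a', 0) fun i : Fin n => ∏ l ∈ range a',
        if l < a then x i - extendZero x l else y i - extendZero y l := by
      intro a' ha'
      induction a' with
      | zero => simpa using IsMonicColumn.one (n := n)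
      | succ a' ih =>
        have := (ih (by omega)).mul_x (extendZero_isHomogeneous x_isHomogeneous a')
        simp only [Prod.mk_add_mk, add_zero] at this
        convert this using 2
        rw [prod_range_succ, if_pos (by omega), mul_comm]
    exact key a le_rfl
  | succ b ih =>
    have := ih.mul_y (extendZero_isHomogeneous y_isHomogeneous (a + b))
    simp only [Prod.mk_add_mk, add_zero] at this
    convert this using 1
    ext1 i
    simp only [stairColumn, ptDeg, ← add_assoc]
    rw [prod_range_succ, if_neg (by omega), mul_comm]

/-- Entries of a staircase column above the stairs vanish. -/
lemma stairColumn_eq_zero {p : ℕ × ℕ} {i : Fin n} (h : (i : ℕ) < ptDeg p) :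
    stairColumn p i = 0 := by
  refine prod_eq_zero (mem_range.2 h) ?_
  simp only [extendZero_coe]
  split_ifs <;> simp

lemma IsMonicColumn.prod_mul {p : ℕ × ℕ} {F : Fin n → Poly n} (hF : IsMonicColumn p F)
    (t : Finset (Fin n)) :
    IsMonicColumn (p + (t.card, 0)) fun i => (∏ l ∈ t, (x i - x l)) * F i := by
  induction t using Finset.induction_on with
  | empty => simpa [show ((0, 0) : ℕ × ℕ) = 0 from rfl] using hF
  | insert a t ha ih =>
    have := ih.mul_x (x_isHomogeneous a)
    rw [card_insert_of_notMem ha]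
    simp only [prod_insert ha]
    convert this using 1
    · ext <;> simp [add_assoc]
    · ext1 i; ring

lemma perm_mem_iff {α : Type*} {t : Finset α} {σ : Equiv.Perm α}
    (h : ∀ j ∈ t, σ j ∈ t) (j : α) : σ j ∈ t ↔ j ∈ t := by
  have h2 : t.map σ.toEmbedding = t :=
    eq_of_subset_of_card_le (fun i hi => by
      obtain ⟨j, hj, rfl⟩ := mem_map.1 hi
      exact h j hj) (by rw [card_map])
  refine ⟨fun hj => ?_, h j⟩
  have h3 : σ j ∈ t.map σ.toEmbedding := by rwa [h2]
  simpa using h3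

/-- If the columns from `r` on vanish in the rows before `r`, then the permutations with nonzero
contribution to the determinant preserve `[r, n)`. -/
lemma le_perm_iff {M : Matrix (Fin n) (Fin n) (Poly n)} {r : ℕ}
    (hM : ∀ i j : Fin n, r ≤ (j : ℕ) → (i : ℕ) < r → M i j = 0) {σ : Equiv.Perm (Fin n)}
    (hσ : ∏ j, M (σ j) j ≠ 0) (j : Fin n) : r ≤ (σ j : ℕ) ↔ r ≤ (j : ℕ) := by
  have h := perm_mem_iff (t := univ.filter fun j : Fin n => r ≤ (j : ℕ)) (σ := σ)
    (fun j hj => by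
      simp only [mem_filter, mem_univ, true_and] at hj ⊢
      by_contra h
      exact hσ (prod_eq_zero (mem_univ j) (hM _ _ hj (not_le.1 h)))) j
  simpa using h

/-- Multiplying each of the columns in `[r, s)` in turn by the variables `v` of the rows amounts to
multiplying the determinant by the power sum of these variables. -/
lemma sum_det_updateCol {M : Matrix (Fin n) (Fin n) (Poly n)} {r s : ℕ}
    (hr : ∀ i j : Fin n, r ≤ (j : ℕ) → (i : ℕ) < r → M i j = 0)
    (hs : ∀ i j : Fin n, s ≤ (j : ℕ) → (i : ℕ) < s → M i j = 0) (v : Fin n → Poly n) :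
    ∑ c ∈ univ.filter (fun c : Fin n => r ≤ (c : ℕ) ∧ (c : ℕ) < s),
      (M.updateCol c fun i => v i * M i c).det =
    (∑ c ∈ univ.filter (fun c : Fin n => r ≤ (c : ℕ) ∧ (c : ℕ) < s), v c) * M.det := by
  simp only [Matrix.det_apply]
  rw [sum_comm, mul_sum]
  refine sum_congr rfl fun σ _ => ?_
  have h1 : ∀ c, ∏ j, (M.updateCol c fun i => v i * M i c) (σ j) j =
      v (σ c) * ∏ j, M (σ j) j := fun c => by
    rw [← mul_prod_erase univ _ (mem_univ c), ← mul_prod_erase univ (fun j => M (σ j) j)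
      (mem_univ c), Matrix.updateCol_self, mul_assoc]
    congr 2
    refine prod_congr rfl fun j hj => ?_
    rw [Matrix.updateCol_ne (ne_of_mem_erase hj)]
  simp only [h1]
  rw [← smul_sum, ← sum_mul]
  by_cases hσ : ∏ j, M (σ j) j = 0
  · simp [hσ]
  · rw [mul_smul_comm]
    congr 2
    refine sum_equiv σ (fun j => ?_) fun _ _ => rfl
    have e1 := le_perm_iff hr hσ j
    have e2 := le_perm_iff hs hσ j
    simp only [mem_filter, mem_univ, true_and]
    omega

lemma sum_fin_ptDeg (P : ℕ → ℕ × ℕ) :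
    ∑ j : Fin n, ptDeg (P j) = ptDeg (∑ j ∈ range n, P j) := by
  rw [ptDeg_sum, Finset.sum_range]

/-- The local power sum relations, modulo `I_{<D}`. -/
lemma sum_Delta_update_mem {P : ℕ → ℕ × ℕ} {w : ℕ × ℕ} {r s D : ℕ} (hsn : s ≤ n)
    (hw : ptDeg w = 1) (hD : ptDeg (∑ j ∈ range n, P j + w) = D)
    (hr : ∀ j, r ≤ j → j < n → r ≤ ptDeg (P j)) (hs : ∀ j, s ≤ j → j < n → s ≤ ptDeg (P j)) :
    ∑ c ∈ Ico r s, Delta (fun j : Fin n => Function.update P c (P c + w) j) ∈ diagIdealLT n D := by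
  obtain ⟨v, hv, hmul⟩ : ∃ v : Fin n → Poly n, (∀ i, (v i).IsHomogeneous 1) ∧
      ∀ (p : ℕ × ℕ) (F : Fin n → Poly n), IsMonicColumn p F →
        IsMonicColumn (p + w) fun i => v i * F i := by
    have h0 : MvPolynomial.IsHomogeneous (0 : Poly n) 1 := MvPolynomial.isHomogeneous_zero _ _ _
    obtain ⟨a, b⟩ := w
    obtain ⟨rfl, rfl⟩ | ⟨rfl, rfl⟩ : (a = 1 ∧ b = 0) ∨ (a = 0 ∧ b = 1) := by
      simp only [ptDeg] at hw; omega
    · exact ⟨x, x_isHomogeneous, fun p F hF => by simpa using hF.mul_x h0⟩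
    · exact ⟨y, y_isHomogeneous, fun p F hF => by simpa using hF.mul_y h0⟩
  set M : Matrix (Fin n) (Fin n) (Poly n) := Matrix.of fun i j => stairColumn (P j) i with hM
  have hMc : ∀ j : Fin n, IsMonicColumn (P j) fun i => M i j :=
    fun j => isMonicColumn_stairColumn (P j)
  have hMz : ∀ r, (∀ j, r ≤ j → j < n → r ≤ ptDeg (P j)) →
      ∀ i j : Fin n, r ≤ (j : ℕ) → (i : ℕ) < r → M i j = 0 := fun r hr i j hj hi =>
    stairColumn_eq_zero (hi.trans_le (hr j hj j.2))
  have h1 := sum_det_updateCol (hMz r hr) (hMz s hs) v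
  have h2 : ∑ c ∈ univ.filter (fun c : Fin n => r ≤ (c : ℕ) ∧ (c : ℕ) < s),
      (M.updateCol c fun i => v i * M i c).det ∈ diagIdealLT n D := by
    rw [h1]
    refine Ideal.mul_mem_left _ _ (det_mem_diagIdealLT (fun j => (hMc j).isDiagonalColumn) ?_)
    rw [sum_fin_ptDeg, ← hD, ptDeg_add, hw]
    exact Nat.lt_succ_self _
  have h3 : ∑ c ∈ Ico r s, Delta (fun j : Fin n => Function.update P c (P c + w) j) =
      ∑ c ∈ univ.filter (fun c : Fin n => r ≤ (c : ℕ) ∧ (c : ℕ) < s),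
        Delta (fun j : Fin n => Function.update P c (P c + w) j) := by
    symm
    refine sum_bij (fun c _ => (c : ℕ)) (fun c hc => by simpa using hc)
      (fun _ _ _ _ h => Fin.ext h) (fun c hc => ?_) fun _ _ => rfl
    rw [mem_Ico] at hc
    exact ⟨⟨c, by omega⟩, by simpa using hc, rfl⟩
  have h4 : ∀ c j : Fin n, IsMonicColumn (Function.update P c (P c + w) j)
      fun i => (M.updateCol c fun i => v i * M i c) i j := fun c j => by
    by_cases hj : j = c
    · subst hj
      simpa using hmul _ _ (hMc j)
    · have : (j : ℕ) ≠ c := fun h => hj (Fin.ext h)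
      simpa [Function.update_of_ne this, hj] using hMc j
  have h5 : ∀ c : Fin n, (M.updateCol c fun i => v i * M i c).det -
      Delta (fun j : Fin n => Function.update P c (P c + w) j) ∈ diagIdealLT n D := fun c => by
    have h5 := det_sub_Delta_mem (h4 c)
    rwa [sum_fin_ptDeg, sum_update_self_add c.2 (d := ∑ j ∈ range n, P j + w) rfl, hD] at h5
  have h6 := Ideal.sub_mem _ h2 (Ideal.sum_mem _ fun c (_ : c ∈ univ.filter
    fun c : Fin n => r ≤ (c : ℕ) ∧ (c : ℕ) < s) => h5 c)
  rwa [sum_sub_distrib, sub_sub_cancel, ← h3] at h6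

end

/-! ### The exchange of adjacent blocks -/

section

open Finset

variable {n : ℕ}

lemma Delta_comp_perm (P : Fin n → ℕ × ℕ) (σ : Equiv.Perm (Fin n)) :
    Delta (P ∘ σ) = (Equiv.Perm.sign σ : ℤ) • Delta P := by
  have := Matrix.det_permute' σ (Matrix.of fun i j : Fin n => x i ^ (P j).1 * y i ^ (P j).2)
  rw [zsmul_eq_mul]
  exact this

/-- If the permutations contributing to the determinant of `M` preserve `J ∪ K`, then after
multiplication of the columns in `K` by `∏ l ∈ J, (x i - x l)` only those preserving both `J` and
`K` contribute. -/
lemma det_mul_columns {M : Matrix (Fin n) (Fin n) (Poly n)} {J K : Finset (Fin n)}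
    (hJK : Disjoint J K)
    (hM : ∀ σ : Equiv.Perm (Fin n), ∏ j, M (σ j) j ≠ 0 → ∀ j, σ j ∈ J ∪ K ↔ j ∈ J ∪ K) :
    (Matrix.of fun i j => (if j ∈ K then ∏ l ∈ J, (x i - x l) else 1) * M i j).det =
      (∏ a ∈ K, ∏ l ∈ J, (x a - x l)) * ∑ σ : Equiv.Perm (Fin n), Equiv.Perm.sign σ •
        if ∀ j, (σ j ∈ J ↔ j ∈ J) ∧ (σ j ∈ K ↔ j ∈ K) then ∏ j, M (σ j) j else 0 := by
  rw [Matrix.det_apply, mul_sum]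
  refine sum_congr rfl fun σ _ => ?_
  rw [mul_smul_comm]
  congr 1
  simp only [Matrix.of_apply, prod_mul_distrib]
  rw [prod_ite_mem, univ_inter]
  split_ifs with h
  · congr 1
    exact prod_equiv σ (fun j => ((h j).2).symm) fun _ _ => rfl
  · rw [mul_zero]
    by_contra h0
    refine h fun j => ?_
    have h1 := hM σ (right_ne_zero_of_mul h0)
    have h2 : ∀ j, σ j ∈ K ↔ j ∈ K := perm_mem_iff fun j hj => by
      have h3 := (h1 j).2 (mem_union_right _ hj)
      refine (mem_union.1 h3).resolve_left fun h4 => left_ne_zero_of_mul h0 ?_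
      exact prod_eq_zero hj (prod_eq_zero h4 (sub_self _))
    refine ⟨?_, h2 j⟩
    have h3 := h1 j
    simp only [mem_union, h2 j] at h3
    have h4 : σ j ∈ J → j ∉ K := fun h hK => (disjoint_left.1 hJK h) ((h2 j).2 hK)
    have h5 : j ∈ J → j ∉ K := fun h hK => (disjoint_left.1 hJK h) hK
    tauto

/-- The determinants obtained by multiplying the columns in `K` by `∏ l ∈ J, (x i - x l)`, and
those in `J` by `∏ l ∈ K, (x i - x l)`, agree up to sign. -/
lemma det_mul_columns_comm {M : Matrix (Fin n) (Fin n) (Poly n)} {J K : Finset (Fin n)}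
    (hJK : Disjoint J K)
    (hM : ∀ σ : Equiv.Perm (Fin n), ∏ j, M (σ j) j ≠ 0 → ∀ j, σ j ∈ J ∪ K ↔ j ∈ J ∪ K) :
    (Matrix.of fun i j => (if j ∈ J then ∏ l ∈ K, (x i - x l) else 1) * M i j).det =
      (-1) ^ (J.card * K.card) *
        (Matrix.of fun i j => (if j ∈ K then ∏ l ∈ J, (x i - x l) else 1) * M i j).det := by
  rw [det_mul_columns hJK hM, det_mul_columns hJK.symm (by simpa only [union_comm] using hM),
    ← mul_assoc]
  congr 1
  · rw [prod_comm, pow_mul, ← prod_const, ← prod_const, ← prod_mul_distrib]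
    refine prod_congr rfl fun a _ => ?_
    rw [← prod_mul_distrib]
    exact prod_congr rfl fun l _ => by ring
  · refine sum_congr rfl fun σ _ => ?_
    simp only [and_comm]

lemma exists_finset_Ico (u v : ℕ) (huv : u + v ≤ n) : ∃ J : Finset (Fin n),
    (∀ j : Fin n, j ∈ J ↔ u ≤ (j : ℕ) ∧ (j : ℕ) < u + v) ∧ J.card = v := by
  refine ⟨univ.filter fun j => u ≤ (j : ℕ) ∧ (j : ℕ) < u + v, fun j => by simp, ?_⟩
  rw [← card_map Fin.valEmbedding]
  convert Nat.card_Ico u (u + v) using 2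
  · ext j
    simp only [mem_map, mem_filter, mem_univ, true_and, mem_Ico]
    exact ⟨fun ⟨i, hi, hij⟩ => hij ▸ hi, fun hj => ⟨⟨j, by omega⟩, hj, rfl⟩⟩
  · omega

/-- Exchanging two adjacent blocks of columns does not change `Δ` modulo `I_{<D}`, up to sign,
if the columns of each block are divisible, up to `I_{<D}`, by the product of the linear forms
`x i - x l` over the rows `l` of the other one. -/
lemma Delta_exchange {P Q : ℕ → ℕ × ℕ} {R a b : ℕ} (hn : R + a + b ≤ n)
    (hD : ∑ j ∈ range n, P j = ∑ j ∈ range n, Q j)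
    (hR : ∀ j, R ≤ j → j < n → R + (if R + a ≤ j ∧ j < R + a + b then a else 0) ≤ ptDeg (P j))
    (hRab : ∀ j, R + a + b ≤ j → j < n → R + a + b ≤ ptDeg (P j))
    (hPQ : ∀ j < n, j < R ∨ R + a + b ≤ j → Q j = P j)
    (hb : ∀ i < b, P (R + a + i) = Q (R + i) + (a, 0))
    (ha : ∀ i < a, Q (R + b + i) = P (R + i) + (b, 0)) :
    Delta (fun j : Fin n => Q j) - Delta (fun j : Fin n => P j) ∈
        diagIdealLT n (ptDeg (∑ j ∈ range n, P j)) ∨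
      Delta (fun j : Fin n => Q j) + Delta (fun j : Fin n => P j) ∈
        diagIdealLT n (ptDeg (∑ j ∈ range n, P j)) := by
  obtain ⟨J, memJ, cardJ⟩ := exists_finset_Ico (n := n) R a (by omega)
  obtain ⟨K, memK, cardK⟩ := exists_finset_Ico (n := n) (R + a) b (by omega)
  have hJK : Disjoint J K := disjoint_left.2 fun j h1 h2 => by
    rw [memJ] at h1; rw [memK] at h2; omega
  obtain ⟨p, pK0, pK'⟩ : ∃ p : Fin n → ℕ × ℕ, (∀ j ∈ K, p j = Q (j - a)) ∧ ∀ j ∉ K, p j = P j :=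
    ⟨fun j => if j ∈ K then Q (j - a) else P j, fun j hj => if_pos hj, fun j hj => if_neg hj⟩
  have pK : ∀ j ∈ K, P j = p j + (a, 0) := fun j hj => by
    have h := (memK j).1 hj
    rw [pK0 j hj, ← show R + (j - R - a) = (j : ℕ) - a by omega, ← hb _ (by omega)]
    congr 1; omega
  have hpR : ∀ j : Fin n, R ≤ (j : ℕ) → R ≤ ptDeg (p j) := fun j hj => by
    have h1 := hR j hj j.2
    by_cases h : j ∈ K
    · rw [if_pos ((memK j).1 h), pK j h, ptDeg_add] at h1
      simp only [ptDeg] at h1 ⊢; omega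
    · rw [pK' j h]; omega
  obtain ⟨M, hM⟩ : ∃ M : Matrix (Fin n) (Fin n) (Poly n), ∀ i j, M i j = stairColumn (p j) i :=
    ⟨Matrix.of fun i j => stairColumn (p j) i, fun _ _ => rfl⟩
  have hMσ : ∀ σ : Equiv.Perm (Fin n), ∏ j, M (σ j) j ≠ 0 →
      ∀ j, σ j ∈ J ∪ K ↔ j ∈ J ∪ K := fun σ hσ j => by
    have e1 := le_perm_iff (r := R)
      (fun i j hj hi => by rw [hM, stairColumn_eq_zero (hi.trans_le (hpR j hj))]) hσ j
    have e2 := le_perm_iff (r := R + a + b) (fun i j hj hi => by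
      have hpj := hRab j hj j.2
      rw [← pK' j (by rw [memK]; omega)] at hpj
      rw [hM, stairColumn_eq_zero (hi.trans_le hpj)]) hσ j
    simp only [mem_union, memJ, memK]
    omega
  have hdet := det_mul_columns_comm hJK hMσ
  have hMP : ∀ j : Fin n, IsMonicColumn (P j) fun i =>
      (Matrix.of fun i j => (if j ∈ K then ∏ l ∈ J, (x i - x l) else 1) * M i j) i j := fun j => by
    have h0 := isMonicColumn_stairColumn (n := n) (p j)
    by_cases h : j ∈ K
    · have := h0.prod_mul J
      rw [cardJ, ← pK j h] at this
      simpa [h, hM] using this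
    · simpa [h, hM, ← pK' j h] using h0
  obtain ⟨τ, hτ⟩ : ∃ τ : Equiv.Perm (Fin n), ∀ j : Fin n, (τ j : ℕ) =
      if j ∈ J then j + b else if j ∈ K then j - a else j := by
    have hinj : Function.Injective fun j : Fin n => (⟨if j ∈ J then j + b else
        if j ∈ K then j - a else j, by
          have := j.2
          simp only [memJ, memK]; split_ifs <;> omega⟩ : Fin n) := fun i j hij => by
      simp only [memJ, memK, Fin.mk.injEq] at hij
      ext
      split_ifs at hij <;> omega
    exact ⟨Equiv.ofBijective _ (Finite.injective_iff_bijective.1 hinj), fun j => rfl⟩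
  have hMQ : ∀ j : Fin n, IsMonicColumn (Q (τ j)) fun i =>
      (Matrix.of fun i j => (if j ∈ J then ∏ l ∈ K, (x i - x l) else 1) * M i j) i j := fun j => by
    have h0 := isMonicColumn_stairColumn (n := n) (p j)
    rw [hτ j]
    by_cases h : j ∈ J
    · have hjK : j ∉ K := disjoint_left.1 hJK h
      have hj := (memJ j).1 h
      have := h0.prod_mul K
      have e : Q (j + b) = P j + (b, 0) := by
        have := ha (j - R) (by omega)
        rwa [show R + b + (j - R) = (j : ℕ) + b by omega,
          show R + ((j : ℕ) - R) = j by omega] at this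
      rw [cardK, pK' j hjK, ← e] at this
      simpa [h, hM, pK' j hjK] using this
    · rw [if_neg h]
      by_cases hjK : j ∈ K
      · simpa [h, hjK, hM, pK0 j hjK] using h0
      · rw [if_neg hjK]
        rw [memJ] at h
        rw [memK] at hjK
        have e := hPQ j j.2 (by omega)
        rw [← memK] at hjK
        rw [← memJ] at h
        simpa [h, hM, pK' j hjK, e] using h0
  have h1 := det_sub_Delta_mem hMP
  have h2 := det_sub_Delta_mem hMQ
  rw [sum_fin_ptDeg] at h1
  rw [Equiv.sum_comp τ (fun j : Fin n => ptDeg (Q j)), sum_fin_ptDeg, ← hD, hdet,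
    show (fun j => Q (τ j)) = (fun j : Fin n => Q j) ∘ τ from rfl, Delta_comp_perm] at h2
  rcases neg_one_pow_eq_or (Poly n) (J.card * K.card) with e | e <;>
  rcases Int.units_eq_one_or (Equiv.Perm.sign τ) with e' | e' <;>
  rw [e, e'] at h2 <;> simp only [Units.val_one, Units.val_neg, one_smul, neg_smul, one_mul,
    neg_mul] at h2
  · left; simpa using Ideal.sub_mem _ h1 h2
  · right; convert Ideal.sub_mem _ h2 h1 using 1; ring
  · right; convert Ideal.neg_mem_iff _ |>.2 (Ideal.add_mem _ h1 h2) using 1; ring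
  · left; convert Ideal.add_mem _ h1 h2 using 1; ring

end

/-! ### Partition types and shapes -/

section

open Finset

variable {n : ℕ} {P : ℕ → ℕ × ℕ}

lemma HasShape.le_ptDeg_add_one {r : ℕ} {l : List ℕ} (h : HasShape P r l) {j : ℕ} (hj : r ≤ j)
    (hj' : j < r + width l) : j ≤ ptDeg (P j) + 1 := by
  induction l generalizing r with
  | nil => simp at hj'; omega
  | cons m l ih =>
    obtain ⟨h0, h1, h2⟩ := h
    simp only [width_cons] at hj'
    by_cases h : j < r + m + 1
    · rcases hj.eq_or_lt with rfl | h'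
      · omega
      · have := h1 (j - r) (by omega) (by omega)
        rw [show r + (j - r) = j by omega] at this
        omega
    · exact ih h2 (by omega) (by omega)

/-- Points of weakly increasing degree, the `j`-th of degree `j` or `j - 1`, split into blocks. -/
lemma exists_hasShape (h1 : ∀ j < n, ptDeg (P j) ≤ j) (h2 : ∀ j < n, j ≤ ptDeg (P j) + 1) :
    ∃ l, HasShape P 0 l ∧ width l = n := by
  have key : ∀ t r, r + t = n → (t = 0 ∨ ptDeg (P r) = r) →
      ∃ l, HasShape P r l ∧ r + width l = n := by
    intro t
    induction t using Nat.strong_induction_on with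
    | _ t ih =>
      intro r hr ht
      rcases Nat.eq_zero_or_pos t with rfl | hpos
      · exact ⟨[], trivial, by simpa using hr⟩
      have hr0 : ptDeg (P r) = r := ht.resolve_left hpos.ne'
      -- The next block starts at the least `r + m + 1` which is `n` or has full degree.
      have hex : ∃ m, r + m + 1 = n ∨ ptDeg (P (r + m + 1)) = r + m + 1 :=
        ⟨t - 1, .inl (by omega)⟩
      classical
      have hm := Nat.find_spec hex
      have hmin : ∀ i < Nat.find hex, _ := fun i hi => Nat.find_min hex hi
      have hle : Nat.find hex ≤ t - 1 := Nat.find_le (.inl (by omega))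
      generalize Nat.find hex = m at hm hmin hle
      obtain ⟨l, hl, hln⟩ := ih (t - (m + 1)) (by omega) (r + m + 1) (by omega)
        (hm.imp (fun h => by omega) id)
      refine ⟨m :: l, ⟨hr0, fun i hi him => ?_, hl⟩, by simp; omega⟩
      have h3 := hmin (i - 1) (by omega)
      rw [show r + (i - 1) + 1 = r + i by omega] at h3
      have h4 := h1 (r + i) (by omega)
      have h5 := h2 (r + i) (by omega)
      push Not at h3
      omega
  have := key n 0 (by omega) (by
    rcases Nat.eq_zero_or_pos n with h | h
    · exact .inl h
    · have := h1 0 h; right; omega)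
  simpa using this

/-- The first two points of a block have the same degree, hence different `x`-exponents. -/
lemma slope_ne_zero {r : ℕ} {l : List ℕ} (h : HasShape P r l) (hn : r + width l ≤ n)
    (hP : ∀ i < n, ∀ j < n, P i = P j → i = j) : slope P r l ≠ 0 := by
  induction l generalizing r with
  | nil => simp [slope]
  | cons m l ih =>
    obtain ⟨h0, h1, h2⟩ := h
    simp only [width_cons] at hn
    refine mul_ne_zero ?_ (ih h2 (by omega))
    split_ifs with hm
    · exact one_ne_zero
    · intro h
      have h3 := h1 1 le_rfl (by omega)
      have := hP r (by omega) (r + 1) (by omega) (by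
        simp only [ptDeg] at h0 h3
        ext <;> omega)
      omega

section Matrix

variable {p : Fin n → ℕ × ℕ} {S : Matrix (Fin n) (Fin n) (Poly n)}

lemma IsStaircaseForm.entry_eq_zero_iff (hS : IsStaircaseForm p S) (i j : Fin n) :
    S i j = 0 ↔ (i : ℕ) < ptDeg (p j) := by
  obtain ⟨a, ha, hSa⟩ := hS.entries
  rw [hSa]
  refine ⟨fun h => ?_, fun h => if_pos h⟩
  by_contra h'
  rw [if_neg h', prod_eq_zero_iff] at h
  obtain ⟨l, hl, h0⟩ := h
  have hil : i ≠ l := by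
    rintro rfl
    simp at hl; omega
  rcases ha i j l with e | e <;> rw [e, sub_eq_zero] at h0
  · exact hil (Sum.inl_injective (MvPolynomial.X_injective h0))
  · exact hil (Sum.inr_injective (MvPolynomial.X_injective h0))

/-- A staircase form with a column starting below the diagonal is singular: by monotonicity all later
columns start there as well, so that too few rows are left for them. -/
lemma IsStaircaseForm.ptDeg_le (hS : IsStaircaseForm p S) (h0 : S.det ≠ 0) (j : Fin n) :
    ptDeg (p j) ≤ j := by
  by_contra hj
  refine h0 ?_
  rw [Matrix.det_apply]
  refine sum_eq_zero fun σ _ => ?_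
  rw [smul_eq_zero_iff_eq]
  by_contra hσ
  have h1 : (Ici j).map σ.toEmbedding ⊆ Ioi j := fun i hi => by
    obtain ⟨j', hj', rfl⟩ := mem_map.1 hi
    rw [mem_Ici] at hj'
    rw [mem_Ioi]
    by_contra h
    refine hσ (prod_eq_zero (mem_univ j') ((hS.entry_eq_zero_iff _ _).2 ?_))
    have h2 := hS.monotone hj'
    have h3 : ((σ j' : Fin n) : ℕ) ≤ j := not_lt.1 h
    simp only at h2
    omega
  have h2 := card_le_card h1
  rw [card_map] at h2
  have h3 : Ioi j ⊂ Ici j := ⟨Ioi_subset_Ici_self, fun h => by simpa using h (mem_Ici.2 le_rfl)⟩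
  exact (card_lt_card h3).not_ge h2

lemma blockCount_eq {A B : List ℕ} {m : ℕ} (hP : HasShape P 0 (A ++ m :: B))
    (hn : width (A ++ m :: B) = n)
    (hS : ∀ i j : Fin n, S i j ≠ 0 ↔ ptDeg (P j) ≤ i) (r : Fin n) (hr : (r : ℕ) = width A) :
    blockCount (fun j : Fin n => P j) S r = m := by
  obtain ⟨hA, h0, h1, h2⟩ := hasShape_append.1 hP
  rw [zero_add, ← hr] at h0 h1 h2
  simp only [width_append, width_cons, ← hr] at hn
  have hin : ∀ j, (r : ℕ) < j → j ≤ r + m → ptDeg (P j) = j - 1 := fun j hj hj' => by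
    have := h1 (j - r) (by omega) (by omega)
    rwa [show (r : ℕ) + (j - r) = j by omega] at this
  have hblock : ∀ i : Fin n, i ∈ block (fun j : Fin n => P j) r ↔
      (r : ℕ) ≤ i ∧ (i : ℕ) ≤ r + m := fun i => by
    simp only [block, blockStarts, mem_filter, mem_univ, true_and, Fin.le_def]
    refine and_congr_right fun hri => ⟨fun h => ?_, fun h r' hr' hi => ?_⟩
    · by_contra hlt
      have hi := i.2
      have h3 := h ⟨r + m + 1, by omega⟩ (by
        cases B with
        | nil => simp at hn; omega
        | cons m' B => exact h2.1) (by simp; omega)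
      simp at h3
    · by_contra hlt
      have := hin r' (by omega) (by omega)
      omega
  have hr2 := r.2
  have e : m = (Ico ((r : ℕ) + 1) (r + m + 1)).card := by rw [Nat.card_Ico]; omega
  rw [blockCount]
  conv_rhs => rw [e]
  refine card_bij (fun q _ => (q.2 : ℕ)) (fun q hq => ?_) (fun q hq q' hq' h => ?_) fun c hc => ?_
  · simp only [mem_filter, mem_product, hblock, Fin.lt_def] at hq
    rw [mem_Ico]; omega
  · simp only [mem_filter, mem_product, hblock, hS, Fin.lt_def] at hq hq'
    have e1 := hin q.2 (by omega) (by omega)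
    have e2 := hin q'.2 (by omega) (by omega)
    exact Prod.ext (Fin.ext (by omega)) (Fin.ext h)
  · rw [mem_Ico] at hc
    have := hin c (by omega) (by omega)
    refine ⟨(⟨c - 1, by omega⟩, ⟨c, by omega⟩), ?_, rfl⟩
    simp only [mem_filter, mem_product, hblock, hS, Fin.lt_def]
    omega

/-- The numbers of nonzero entries above the diagonal in the blocks are the lengths of the shape. -/
lemma map_blockCount {l : List ℕ} (hP : HasShape P 0 l) (hn : width l = n)
    (hS : ∀ i j : Fin n, S i j ≠ 0 ↔ ptDeg (P j) ≤ i) :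
    (blockStarts fun j : Fin n => P j).val.map (blockCount (fun j : Fin n => P j) S) = l := by
  have key : ∀ B A : List ℕ, l = A ++ B →
      ((blockStarts fun j : Fin n => P j).filter fun j : Fin n => width A ≤ (j : ℕ)).val.map
        (blockCount (fun j : Fin n => P j) S) = B := by
    intro B
    induction B with
    | nil =>
      intro A hA
      rw [filter_false_of_mem fun j _ => ?_]
      · rfl
      · have := j.2
        simp only [hA, List.append_nil] at hn; omega
    | cons m B ih =>
      intro A hA
      subst hA
      have hn' := hn
      have hP' := hP
      simp only [width_append, width_cons] at hn'
      rw [hasShape_append, zero_add] at hP'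
      have e : (blockStarts fun j : Fin n => P j).filter (fun j : Fin n => width A ≤ (j : ℕ)) =
          insert ⟨width A, by omega⟩ ((blockStarts fun j : Fin n => P j).filter
            fun j : Fin n => width (A ++ [m]) ≤ (j : ℕ)) := by
        ext j
        simp only [blockStarts, mem_filter, mem_univ, true_and, mem_insert, Fin.ext_iff,
          width_append, width_cons, width_nil]
        constructor
        · rintro ⟨h3, h4⟩
          by_contra h5
          have := hP'.2.2.1 (j - width A) (by omega) (by omega)
          rw [show width A + ((j : ℕ) - width A) = j by omega] at this
          omega
        · rintro (h3 | h3)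
          · rw [h3]; exact ⟨hP'.2.1, le_rfl⟩
          · exact ⟨h3.1, by omega⟩
      rw [e, insert_val_of_notMem (by simp), Multiset.map_cons, ih (A ++ [m]) (by simp),
        blockCount_eq hP hn hS _ rfl]
      rfl
  simpa using key l [] rfl

/-- The matrix of staircase columns of distinct points of a given shape is a minimal staircase form,
unless it is singular. -/
lemma isMinimalStaircaseForm_of_hasShape {k : ℕ} {ν : Nat.Partition k} {l : List ℕ}
    (hP : HasShape P 0 l) (hn : width l = n) (hinj : Function.Injective fun j : Fin n => P j)
    (hν : posParts l = ν.parts)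
    (hdet : (Matrix.of fun i j : Fin n => stairColumn (P j) i).det ≠ 0) :
    IsMinimalStaircaseForm (fun j : Fin n => P j)
      (Matrix.of fun i j : Fin n => stairColumn (P j) i) ν := by
  have hle : ∀ j : Fin n, ptDeg (P j) ≤ j := fun j => hP.ptDeg_le (Nat.zero_le _) (by omega)
  have hge : ∀ j : Fin n, (j : ℕ) ≤ ptDeg (P j) + 1 :=
    fun j => hP.le_ptDeg_add_one (Nat.zero_le _) (by omega)
  have hform : IsStaircaseForm (fun j : Fin n => P j)
      (Matrix.of fun i j : Fin n => stairColumn (P j) i) := by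
    refine ⟨hinj, fun i j hij => ?_, ⟨fun i j l => if (l : ℕ) < (P j).1 then x i - x l else
      y i - y l, fun i j l => ?_, fun i j => ?_⟩,
      det_sub_Delta_mem fun j => isMonicColumn_stairColumn (P j)⟩
    · rcases hij.eq_or_lt with rfl | h
      · rfl
      · have h1 := hle i
        have h2 := hge j
        have h3 : (i : ℕ) < j := h
        simp only; omega
    · dsimp only; split_ifs <;> simp
    · split_ifs with h
      · exact stairColumn_eq_zero h
      · have hi := i.2
        rw [Matrix.of_apply, stairColumn, prod_filter]
        simp only [← extendZero_coe x, ← extendZero_coe y]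
        rw [Fin.prod_univ_eq_prod_range (fun l => if l < ptDeg (P j) then
          if l < (P j).1 then extendZero x i - extendZero x l else
            extendZero y i - extendZero y l else 1) n, ← prod_filter]
        congr 1
        ext l; simp; omega
  refine ⟨hform, hdet, ?_, fun i j hij => ?_⟩
  · rw [map_blockCount hP hn fun i j => ?_]
    · exact hν
    · rw [Ne, hform.entry_eq_zero_iff, not_lt]
  · rw [hform.entry_eq_zero_iff]
    have := hge j
    omega

/-- The points of a minimal staircase form have a shape whose positive lengths form its type. -/
lemma IsMinimalStaircaseForm.exists_hasShape {k : ℕ} {μ : Nat.Partition k}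
    (hS : IsMinimalStaircaseForm (fun j : Fin n => P j) S μ) :
    ∃ l, HasShape P 0 l ∧ width l = n ∧ posParts l = μ.parts := by
  obtain ⟨l, hl, hln⟩ := DiagonalIdeal.exists_hasShape (n := n) (P := P)
    (fun j hj => hS.isStaircaseForm.ptDeg_le hS.det_ne_zero ⟨j, hj⟩) (fun j hj => by
      rcases Nat.lt_or_ge j 2 with h | h
      · omega
      · have := hS.minimal ⟨j - 2, by omega⟩ ⟨j, hj⟩ (by simp; omega)
        rw [hS.isStaircaseForm.entry_eq_zero_iff] at this
        simp at this
        omega)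
  refine ⟨l, hl, hln, ?_⟩
  rw [← hS.type_eq, map_blockCount hl hln fun i j => ?_]
  · rfl
  · rw [Ne, hS.isStaircaseForm.entry_eq_zero_iff, not_lt]

end Matrix

end

/-! ### The symbol of the determinants modulo lower forms -/

section

open Finset

variable {n k : ℕ}

lemma strictSubpartition_of_split {ν μ : Nat.Partition k} {a b : ℕ} {R : Multiset ℕ}
    (hν : ν.parts = a ::ₘ b ::ₘ R) (hμ : μ.parts = (a + b) ::ₘ R) : StrictSubpartition ν μ := by
  refine ⟨fun h => ?_, {a, b} ::ₘ R.map fun c => {c}, ?_, ?_⟩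
  · rw [h, hμ] at hν
    have := congrArg Multiset.card hν
    simp at this
  · rw [Multiset.join_cons, hν, ← Multiset.bind, Multiset.bind_singleton, Multiset.map_id']
    simp
  · rw [hμ, Multiset.map_cons, Multiset.map_map]
    simp

lemma bidegree_coe (P : ℕ → ℕ × ℕ) :
    bidegree (fun j : Fin n => P j) = ∑ j ∈ range n, P j := by
  rw [Finset.sum_range]
  ext <;> simp [bidegree, Prod.fst_sum, Prod.snd_sum]

/-- Modulo `I_{<d}` and the lower forms, the determinants `Δ` have the formal properties of a
staircase symbol. -/
lemma isStaircaseSymbol_mk_Delta (n d₁ d₂ : ℕ) (μ : Nat.Partition k) :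
    IsStaircaseSymbol n (d₁, d₂) μ.parts fun P : ℕ → ℕ × ℕ =>
      Ideal.Quotient.mk (diagIdealLT n (d₁ + d₂) ⊔ lowerIdeal n d₁ d₂ μ)
        (Delta fun j : Fin n => P j) where
  congr P Q h := by
    rw [show (fun j : Fin n => P j) = fun j : Fin n => Q j from funext fun j => h j j.2]
  swap P i hi := by
    have e : (fun j : Fin n => (P ∘ Equiv.swap i (i + 1)) j) = (fun j : Fin n => P j) ∘
        Equiv.swap (⟨i, by omega⟩ : Fin n) ⟨i + 1, hi⟩ := by
      ext1 j
      simp only [Function.comp_apply, Equiv.swap_apply_def, Fin.ext_iff]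
      split_ifs <;> rfl
    rw [e, Delta_comp_perm, Equiv.Perm.sign_swap (by simp)]
    simp
  rel P w r s hrs hsn hw hd hr hs := by
    rw [← map_sum, Ideal.Quotient.eq_zero_iff_mem]
    refine Ideal.mem_sup_left ?_
    exact sum_Delta_update_mem hsn hw (by rw [hd]; rfl) hr hs
  split P A B a b ha hb hP hn hd hμ := by
    rw [Ideal.Quotient.eq_zero_iff_mem]
    by_cases hinj : Function.Injective fun j : Fin n => P j
    swap
    · obtain ⟨i, j, hij, hne⟩ := Function.not_injective_iff.1 hinj
      rw [Delta, Matrix.det_zero_of_column_eq hne fun l => by simp only [Matrix.of_apply, hij]]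
      exact Ideal.zero_mem _
    have h1 : (Matrix.of fun i j : Fin n => stairColumn (P j) i).det - Delta (fun j : Fin n => P j)
        ∈ diagIdealLT n (d₁ + d₂) := by
      have := det_sub_Delta_mem (M := Matrix.of fun i j : Fin n => stairColumn (P j) i)
        (P := fun j : Fin n => P j) fun j => isMonicColumn_stairColumn (P j)
      rwa [sum_fin_ptDeg, hd] at this
    rw [← sub_sub_cancel (Matrix.of fun i j : Fin n => stairColumn (P j) i).det (Delta _)]
    refine Ideal.sub_mem _ ?_ (Ideal.mem_sup_left h1)
    by_cases hdet : (Matrix.of fun i j : Fin n => stairColumn (P j) i).det = 0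
    · rw [hdet]; exact Ideal.zero_mem _
    have hν : posParts (A ++ a :: b :: B) = a ::ₘ b ::ₘ (posParts A + posParts B) := by
      rw [posParts_append, posParts_cons_pos ha, posParts_cons_pos hb, Multiset.add_cons,
        Multiset.add_cons]
    rw [posParts_append, posParts_cons_pos (by omega), Multiset.add_cons] at hμ
    let ν : Nat.Partition k :=
      { parts := posParts (A ++ a :: b :: B)
        parts_pos := fun hi => (Multiset.mem_filter.1 hi).2
        parts_sum := by
          rw [hν, ← μ.parts_sum, ← hμ]
          simp [add_assoc] }
    refine Ideal.mem_sup_right (Ideal.subset_span ⟨ν, fun j : Fin n => P j, _,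
      strictSubpartition_of_split hν hμ.symm, ?_,
      isMinimalStaircaseForm_of_hasShape hP hn hinj rfl hdet, rfl⟩)
    rw [bidegree_coe, hd]
  exchange P Q A B m m' hP hn hPd hQd hA hb ha hB := by
    simp only [width_append, width_cons] at hn
    have hAmm := (hasShape_append.1 hP).2
    rw [zero_add] at hAmm
    have h := Delta_exchange (n := n) (P := P) (Q := Q) (R := width A) (a := m + 1) (b := m' + 1)
      (by omega) (hPd.trans hQd.symm) (fun j hj hjn => by
        split_ifs with h
        · exact hAmm.2.2.le_ptDeg (by omega) (by simp only [width_cons]; omega)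
        · exact hAmm.le_ptDeg (by omega) (by simp only [width_cons]; omega))
      (fun j hj hjn => by
        have := hAmm.2.2.2.2.le_ptDeg (j := j) (by omega) (by omega)
        omega)
      (fun j hj h => h.elim (hA j hj) fun h => hB j hj (by omega))
      hb ha
    rw [hPd] at h
    refine h.imp (fun h => Ideal.Quotient.eq.2 (Ideal.mem_sup_left h)) fun h => ?_
    rw [eq_neg_iff_add_eq_zero, ← map_add, Ideal.Quotient.eq_zero_iff_mem]
    exact Ideal.mem_sup_left h

end

end DiagonalIdeal

theorem proposition2p9 (n k d₁ d₂ : ℕ) (hn : 8 * k + 5 ≤ n)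
    (hd₁ : (2 * k + 1) * n ≤ d₁) (hd₂ : (2 * k + 1) * n ≤ d₂) (μ : Nat.Partition k)
    (P P' : Fin n → ℕ × ℕ) (S S' : Matrix (Fin n) (Fin n) (DiagonalIdeal.Poly n))
    (hP : DiagonalIdeal.bidegree P = (d₁, d₂)) (hP' : DiagonalIdeal.bidegree P' = (d₁, d₂))
    (hS : DiagonalIdeal.IsMinimalStaircaseForm P S μ)
    (hS' : DiagonalIdeal.IsMinimalStaircaseForm P' S' μ) :
    S'.det ∈ Ideal.span {S.det} ⊔
      (DiagonalIdeal.diagIdealLT n (d₁ + d₂) ⊔ DiagonalIdeal.lowerIdeal n d₁ d₂ μ) := by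
  open DiagonalIdeal Finset in
  have ext : ∀ P : Fin n → ℕ × ℕ, ∃ p : ℕ → ℕ × ℕ, P = fun j : Fin n => p j :=
    fun P => ⟨fun j => if h : j < n then P ⟨j, h⟩ else 0, by ext1 j; simp⟩
  obtain ⟨p, rfl⟩ := ext P
  obtain ⟨p', rfl⟩ := ext P'
  have hdeg : ∀ {p : ℕ → ℕ × ℕ}, bidegree (fun j : Fin n => p j) = (d₁, d₂) →
      ∑ j ∈ range n, p j = (d₁, d₂) := fun h => by rw [← bidegree_coe, h]
  have hequiv : ∀ {p : ℕ → ℕ × ℕ} {S}, IsStaircaseForm (fun j : Fin n => p j) S →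
      bidegree (fun j : Fin n => p j) = (d₁, d₂) →
      Ideal.Quotient.mk (diagIdealLT n (d₁ + d₂) ⊔ lowerIdeal n d₁ d₂ μ) S.det =
        Ideal.Quotient.mk _ (Delta fun j : Fin n => p j) := fun hS h => by
    have := hS.det_equiv
    rw [totalDegree, sum_fin_ptDeg, hdeg h] at this
    exact Ideal.Quotient.eq.2 (Ideal.mem_sup_left this)
  obtain ⟨l, hl, hln, hlμ⟩ := hS.exists_hasShape
  obtain ⟨l', hl', hln', hlμ'⟩ := hS'.exists_hasShape
  obtain ⟨c, hc⟩ := (isStaircaseSymbol_mk_Delta n d₁ d₂ μ).exists_smul_eq μ.parts_sum (by omega)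
    hd₁ hd₂ hl hl' hln hln' hlμ hlμ' (hdeg hP) (hdeg hP')
    (slope_ne_zero (n := n) hl (by omega) fun i hi j hj hij => by
      simpa using @hS.isStaircaseForm.injective ⟨i, hi⟩ ⟨j, hj⟩ hij)
  rw [← hequiv hS.isStaircaseForm hP, ← hequiv hS'.isStaircaseForm hP'] at hc
  have hmem : S'.det - c • S.det ∈ diagIdealLT n (d₁ + d₂) ⊔ lowerIdeal n d₁ d₂ μ :=
    Ideal.Quotient.eq.1 hc
  rw [← sub_add_cancel S'.det (c • S.det), MvPolynomial.smul_eq_C_mul]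
  rw [MvPolynomial.smul_eq_C_mul] at hmem
  exact Ideal.add_mem _ (Ideal.mem_sup_right hmem)
    (Ideal.mem_sup_left (Ideal.mul_mem_left _ _ (Ideal.mem_span_singleton_self _)))
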